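/- **Setting.** For $k_F>0$ and $s\in\mathbb N$, $s\ge1$, let $B_F=\{p\in\mathbb Z^3: |p|\le k_F\}$, $N=s|B_F|$, and let $\mathcal H_N=\bigwedge^N L^2(\mathbb T^3;\mathbb C^s)$, $\mathbb T^3=[0,2\pi]^3$ with periodic boundary conditions. Let $c_{p,\sigma}^*,c_{p,\sigma}$ be the fermionic creation and annihilation operators of the plane waves $u_{p,\sigma}$ ($p\in\mathbb Z^3$, $1\le\sigma\le s$) and $\psi_F=\bigwedge_{p\in B_F,\,\sigma}u_{p,\sigma}$ the Fermi state. Write $\mathbb Z^3_*=\mathbb Z^3\setminus\{0\}$. For $k\in\mathbb Z^3_*$ let $L_k=(B_F+k)\setminus B_F$, $\lambda_{k,p}=\frac12(|p|^2-|p-k|^2)$, and $$b_{k,p}=\frac1{\sqrt s}\sum_{\sigma=1}^s c^*_{p-k,\sigma}c_{p,\sigma},\qquad b_k^*(\varphi)=\sum_{p\in L_k}\langle e_p,\varphi\rangle\, b_{k,p}^*,\quad \varphi\in\ell^2(L_k).$$ Let $\hat V:\mathbb Z^3\to\mathbb R$ with $\hat V_l=\hat V_{-l}\ge0$ for all $l\in\mathbb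 Z^3_*$. On $\ell^2(L_k)$ put (no mean-field scaling) $$h_ke_p=\lambda_{k,p}e_p,\quad v_k=\sqrt{\frac{s\hat V_k}{2(2\pi)^3}}\sum_{p\in L_k}e_p,\quad \tilde E_k=\bigl(h_k^2+2P_{h_k^{1/2}v_k}\bigr)^{1/2},\quad P_w=\langle w,\cdot\rangle w,$$ and on $\mathcal H_N$ let $$H_{\mathrm{eff}}=H_{\mathrm{kin}}'+2\sum_{l\in\mathbb Z^3_*}\sum_{p\in L_l}b_l^*\bigl((\tilde E_l-h_l)e_p\bigr)b_{l,p},\qquad H'_{\mathrm{kin}}=\sum_{p\notin B_F,\,\sigma}|p|^2c^*_{p,\sigma}c_{p,\sigma}-\sum_{p\in B_F,\,\sigma}|p|^2c_{p,\sigma}c^*_{p,\sigma},$$ defined on the vectors for which these sums converge. Let $\epsilon_k$ be the greatest eigenvalue of $2\tilde E_k$. For a normalized eigenvector $\phi$ of $2\tilde E_k$ with eigenvalue $\epsilon_k$ and $M\in\mathbb N_0$ put $\Psi_M=b_k^*(\phi)^M\psi_F$ and $\hat\Psi_M=\|\Psi_M\|^{-1}\Psi_M$. **(1) General potentials.** There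 are constants $c,C,c',C'>0$, independent of all quantities, such that for all sufficiently large $k_F$, uniformly in $s\ge1$, in $\hat V$ as above and in $k\in B_F\cap\mathbb Z^3_*$ with $\hat V_k>ck_F^{-1}$, the following holds. The greatest eigenvalue $\epsilon_k$ exists, $\epsilon_k\ge c's^{1/2}k_F^{3/2}|k|\hat V_k^{1/2}$, and $$0\le\epsilon_k-2\sqrt{2\langle v_k,h_kv_k\rangle+\frac{\langle v_k,h_k^3v_k\rangle}{\langle v_k,h_kv_k\rangle}}\le C'k_F^{-1/2}|k|\hat V_k^{-3/2}.$$ For every normalized eigenvector $\phi$ as above and every $M\in\mathbb N_0$ with $M\le Ck_F^2|k|$, one has $\Psi_M\ne0$, $\hat\Psi_M$ lies in the domain of $H_{\mathrm{eff}}$ in $\mathcal H_N$, and $$\|(H_{\mathrm{eff}}-M\epsilon_k)\hat\Psi_M\|\le C'\sqrt{\sum_{l\in\mathbb Z^3_*}\min\{1,k_F\hat V_l,k_F^3\hat V_l|l|^{-2}\}\hat V_l|l|^2}\;\frac{M^{5/2}}{\sqrt{k_F}\,|k|}$$ (where the last bound is void if the sum diverges). **(2) Coulomb potential.** Let $g>0$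 and $\hat V_k=g|k|^{-2}$. There are constants $c,C>0$ depending only on $g$ such that for all $\delta\in(0,\frac12)$, $\varepsilon\in(0,2)$ and all sufficiently large $k_F$ (depending on $g,\delta,\varepsilon$), uniformly in $s\ge1$ and in $k\in\mathbb Z^3_*$ with $|k|\le k_F^\delta$: $\epsilon_k$ exists, $\epsilon_k\ge ck_F^{3/2}$, $$0\le\epsilon_k-2\sqrt{\frac{s}{(2\pi)^3}\frac{g}{|k|^2}\sum_{p\in L_k}\lambda_{k,p}+\frac{\sum_{p\in L_k}\lambda_{k,p}^3}{\sum_{p\in L_k}\lambda_{k,p}}}\le Ck_F^{-1/2}|k|^4,$$ and for every $M\in\mathbb N_0$ with $M\le k_F^\varepsilon$ and every $\phi$ as above, $\Psi_M\neq0$, $\hat\Psi_M$ lies in the domain of $H_{\mathrm{eff}}$ in $\mathcal H_N$, and $$\|(H_{\mathrm{eff}}-M\epsilon_k)\hat\Psi_M\|\le C|k|^{-1}\sqrt{k_F}\,M^{5/2}.$$ **(3) Plasmon dispersion relation.** Let $g>0$, $\hat V_k=g|k|^{-2}$, $\delta\in(0,\frac12)$ and let $n=N/(2\pi)^3$ be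 the number density. Then, as $k_F\to\infty$, $$\epsilon_k^2=2gn+\tfrac{12}5k_F^2|k|^2+o\bigl(k_F^2|k|^2\bigr)$$ uniformly in $s\ge1$ and in $k\in\mathbb Z^3_*$ with $|k|\le k_F^\delta$. -/

import Mathlib

open Filter

namespace Plasmon

noncomputable section

/-! ### Momenta, Fermi ball, lunes -/

/-- Momenta on the torus of side length `2π`: the lattice `ℤ³`. -/
abbrev Momentum : Type := Fin 3 → ℤ

/-- The squared Euclidean length `|p|²`. -/
def sqLen (p : Momentum) : ℝ := ∑ i, (p i : ℝ) ^ 2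

/-- The Euclidean length `|p|`. -/
def len (p : Momentum) : ℝ := √(sqLen p)

theorem abs_coord_le_len (p : Momentum) (i : Fin 3) : |(p i : ℝ)| ≤ len p := by
  rw [len, ← Real.sqrt_sq_eq_abs]
  exact Real.sqrt_le_sqrt
    (Finset.single_le_sum (f := fun i => (p i : ℝ) ^ 2) (fun j _ => sq_nonneg _)
      (Finset.mem_univ i))

theorem finite_ball (kF : ℝ) : {p : Momentum | len p ≤ kF}.Finite := by
  refine (Set.finite_Icc (fun _ => -⌈kF⌉ : Momentum) (fun _ => ⌈kF⌉)).subset ?_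
  intro p hp
  have h : ∀ i, |(p i : ℝ)| ≤ (⌈kF⌉ : ℝ) := fun i =>
    (abs_coord_le_len p i).trans (le_trans hp (Int.le_ceil kF))
  refine ⟨fun i => ?_, fun i => ?_⟩
  · have := (abs_le.mp (h i)).1
    exact_mod_cast this
  · have := (abs_le.mp (h i)).2
    exact_mod_cast this

/-- The closed Fermi ball `B_F = {p ∈ ℤ³ : |p| ≤ k_F}`. -/
def fermiBall (kF : ℝ) : Finset Momentum := (finite_ball kF).toFinset

theorem mem_fermiBall {kF : ℝ} {p : Momentum} : p ∈ fermiBall kF ↔ len p ≤ kF := by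
  simp [fermiBall]

/-- The lune `L_k = (B_F + k) \ B_F`. -/
def lune (kF : ℝ) (k : Momentum) : Finset Momentum :=
  (fermiBall kF).image (fun q => q + k) \ fermiBall kF

theorem mem_lune {kF : ℝ} {k p : Momentum} :
    p ∈ lune kF k ↔ len (p - k) ≤ kF ∧ kF < len p := by
  simp only [lune, Finset.mem_sdiff, Finset.mem_image, mem_fermiBall, not_le]
  refine and_congr_left fun _ => ⟨?_, fun h => ⟨p - k, h, sub_add_cancel p k⟩⟩
  rintro ⟨q, hq, rfl⟩
  simpa using hq

/-- `λ_{k,p} = (|p|² - |p - k|²) / 2`. -/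
def lam (k p : Momentum) : ℝ := (sqLen p - sqLen (p - k)) / 2

/-! ### Fermionic Fock space

The one-particle space `L²(𝕋³; ℂˢ)` has the orthonormal basis of plane waves `u_{p,σ}`, indexed by
the modes `(p, σ)`. The Slater determinants of finite sets of plane waves, each written with its
modes in increasing order, form an orthonormal basis of the fermionic Fock space, which is
accordingly `ℓ²` of the finite sets of modes. -/

/-- A plane-wave mode: momentum and spin. -/
abbrev Mode (s : ℕ) : Type := Momentum × Fin s

/-- The (lexicographic) total order on modes in which Slater determinants are written. -/
def modeLT {s : ℕ} (a b : Mode s) : Prop :=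
  toLex (toLex a.1, a.2) < toLex (toLex b.1, b.2)

/-- The fermionic Fock space over `L²(𝕋³; ℂˢ)` in the Slater determinant basis. -/
abbrev Fock (s : ℕ) : Type := lp (fun _ : Finset (Mode s) => ℂ) 2

open Classical in
/-- The sign `(-1)^{#{b ∈ S : b < a}}`. -/
def fermiSign {s : ℕ} (a : Mode s) (S : Finset (Mode s)) : ℂ :=
  (-1) ^ (S.filter fun b => modeLT b a).card

theorem norm_fermiSign {s : ℕ} (a : Mode s) (S : Finset (Mode s)) : ‖fermiSign a S‖ = 1 := by
  simp [fermiSign]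

/-- Coefficients of `c_a Ψ`. As `c_a` maps the determinant of `S ∪ {a}` (with `a ∉ S`) to
`(-1)^{#{b ∈ S : b < a}}` times that of `S`, and the determinants not containing `a` to `0`, the
coefficient of `c_a Ψ` at `S` is that sign times the coefficient of `Ψ` at `S ∪ {a}`, for
`a ∉ S`, and `0` for `a ∈ S`. -/
def annihilateFun {s : ℕ} (a : Mode s) (Ψ : Finset (Mode s) → ℂ) (S : Finset (Mode s)) : ℂ :=
  if a ∈ S then 0 else fermiSign a S * Ψ (insert a S)

theorem sum_annihilateFun_le {s : ℕ} (a : Mode s) (Ψ : Fock s) (F : Finset (Finset (Mode s))) :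
    ∑ S ∈ F, ‖annihilateFun a Ψ S‖ ^ (2 : ENNReal).toReal ≤ ‖Ψ‖ ^ (2 : ENNReal).toReal := by
  have h2 : (0 : ℝ) < (2 : ENNReal).toReal := by norm_num
  have hinj : Set.InjOn (fun S : Finset (Mode s) => insert a S)
      (F.filter fun S => a ∉ S : Finset (Finset (Mode s))) := by
    intro S hS T hT h
    have hS' : a ∉ S := (Finset.mem_filter.mp hS).2
    have hT' : a ∉ T := (Finset.mem_filter.mp hT).2
    have h' : insert a S = insert a T := h
    rw [← Finset.erase_insert hS', h', Finset.erase_insert hT']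
  calc ∑ S ∈ F, ‖annihilateFun a Ψ S‖ ^ (2 : ENNReal).toReal
      = ∑ S ∈ F.filter (fun S => a ∉ S), ‖Ψ (insert a S)‖ ^ (2 : ENNReal).toReal := by
        rw [Finset.sum_filter]
        refine Finset.sum_congr rfl fun S _ => ?_
        by_cases h : a ∈ S <;> simp [annihilateFun, h, norm_fermiSign]
    _ = ∑ T ∈ (F.filter (fun S => a ∉ S)).image (fun S => insert a S),
          ‖Ψ T‖ ^ (2 : ENNReal).toReal := by
        rw [Finset.sum_image hinj]
    _ ≤ ‖Ψ‖ ^ (2 : ENNReal).toReal := lp.sum_rpow_le_norm_rpow h2 Ψ _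

/-- The annihilation operator `c_{p,σ}`. -/
def annihilate {s : ℕ} (a : Mode s) : Fock s →L[ℂ] Fock s :=
  LinearMap.mkContinuous
    { toFun := fun Ψ => ⟨annihilateFun a Ψ, memℓp_gen' (sum_annihilateFun_le a Ψ)⟩
      map_add' := fun Ψ Φ => by
        ext S
        change annihilateFun a (Ψ + Φ : Fock s) S = annihilateFun a Ψ S + annihilateFun a Φ S
        by_cases h : a ∈ S <;> simp [annihilateFun, h, mul_add]
      map_smul' := fun z Ψ => by
        ext S
        by_cases h : a ∈ S <;> simp [annihilateFun, h, mul_left_comm] }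
    1 fun Ψ => by
      rw [one_mul]
      exact lp.norm_le_of_forall_sum_le (by norm_num) (norm_nonneg Ψ) (sum_annihilateFun_le a Ψ)

/-- The creation operator `c*_{p,σ}`, the adjoint of `c_{p,σ}`. -/
def create {s : ℕ} (a : Mode s) : Fock s →L[ℂ] Fock s :=
  ContinuousLinearMap.adjoint (annihilate a)

/-- The `N`-particle space `⋀ᴺ L²(𝕋³; ℂˢ)` inside the Fock space. -/
def particleSector (s N : ℕ) : Submodule ℂ (Fock s) where
  carrier := {Ψ | ∀ S : Finset (Mode s), S.card ≠ N → Ψ S = 0}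
  zero_mem' := fun S _ => by simp
  add_mem' := fun {Ψ Φ} hΨ hΦ S hS => by simp [hΨ S hS, hΦ S hS]
  smul_mem' := fun z Ψ hΨ S hS => by simp [hΨ S hS]

/-- The number of particles `N = s |B_F|`. -/
def particleNumber (kF : ℝ) (s : ℕ) : ℕ := s * (fermiBall kF).card

open Classical in
/-- The Fermi state `ψ_F`: the Slater determinant of all `u_{p,σ}` with `p ∈ B_F`. -/
def fermiState (kF : ℝ) (s : ℕ) : Fock s :=
  lp.single 2 (fermiBall kF ×ˢ (Finset.univ : Finset (Fin s))) (1 : ℂ)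

/-! ### Excitation operators -/

/-- `b_{k,p} = s^{-1/2} ∑_σ c*_{p-k,σ} c_{p,σ}`. -/
def excAnnihilate {s : ℕ} (k p : Momentum) : Fock s →L[ℂ] Fock s :=
  (((√(s : ℝ))⁻¹ : ℝ) : ℂ) • ∑ σ : Fin s, create (p - k, σ) ∘L annihilate (p, σ)

/-- `b*_{k,p} = s^{-1/2} ∑_σ c*_{p,σ} c_{p-k,σ}`. -/
def excCreate {s : ℕ} (k p : Momentum) : Fock s →L[ℂ] Fock s :=
  (((√(s : ℝ))⁻¹ : ℝ) : ℂ) • ∑ σ : Fin s, create (p, σ) ∘L annihilate (p - k, σ)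

/-- The one-body space `ℓ²(L_k)`. -/
abbrev LuneSpace (kF : ℝ) (k : Momentum) : Type := EuclideanSpace ℂ (lune kF k)

/-- `b*_k(φ) = ∑_{p ∈ L_k} ⟨e_p, φ⟩ b*_{k,p}`. -/
def excCreateVec {kF : ℝ} {s : ℕ} {k : Momentum} (φ : LuneSpace kF k) : Fock s →L[ℂ] Fock s :=
  ∑ p : lune kF k, φ p • excCreate k (p : Momentum)

/-! ### One-body operators on `ℓ²(L_k)` -/

/-- `h_k e_p = λ_{k,p} e_p`. -/
def hOp (kF : ℝ) (k : Momentum) : LuneSpace kF k →L[ℂ] LuneSpace kF k :=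
  Matrix.toEuclideanCLM (𝕜 := ℂ) (n := lune kF k)
    (Matrix.diagonal fun p : lune kF k => (lam k p : ℂ))

/-- `v_k = √(s V̂_k / (2 (2π)³)) ∑_{p ∈ L_k} e_p` (without mean-field scaling). -/
def vVec (kF : ℝ) (s : ℕ) (V : Momentum → ℝ) (k : Momentum) : LuneSpace kF k :=
  WithLp.toLp 2 fun _ => ((√(s * V k / (2 * (2 * Real.pi) ^ 3)) : ℝ) : ℂ)

/-- `Ẽ_k = (h_k² + 2 P_w)^{1/2}` with `w = h_k^{1/2} v_k` and `P_w = ⟨w, ·⟩ w`. -/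
def EOp (kF : ℝ) (s : ℕ) (V : Momentum → ℝ) (k : Momentum) :
    LuneSpace kF k →L[ℂ] LuneSpace kF k :=
  CFC.sqrt (hOp kF k ^ 2 + (2 : ℂ) • InnerProductSpace.rankOne ℂ
    (CFC.sqrt (hOp kF k) (vVec kF s V k)) (CFC.sqrt (hOp kF k) (vVec kF s V k)))

/-- The (real) eigenvalues of `2 Ẽ_k`. -/
def plasmonSpectrum (kF : ℝ) (s : ℕ) (V : Momentum → ℝ) (k : Momentum) : Set ℝ :=
  {x | ∃ φ : LuneSpace kF k, φ ≠ 0 ∧ (2 : ℂ) • EOp kF s V k φ = (x : ℂ) • φ}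

/-- `ε_k`, the greatest eigenvalue of `2 Ẽ_k`. -/
def plasmonEnergy (kF : ℝ) (s : ℕ) (V : Momentum → ℝ) (k : Momentum) : ℝ :=
  sSup (plasmonSpectrum kF s V k)

/-- `φ` is a normalized eigenvector of `2 Ẽ_k` for the eigenvalue `ε_k`. -/
def IsPlasmonMode (kF : ℝ) (s : ℕ) (V : Momentum → ℝ) (k : Momentum) (φ : LuneSpace kF k) :
    Prop :=
  ‖φ‖ = 1 ∧ (2 : ℂ) • EOp kF s V k φ = (plasmonEnergy kF s V k : ℂ) • φ

/-- The moment `⟨v_k, h_kʲ v_k⟩`. -/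
def moment (kF : ℝ) (s : ℕ) (V : Momentum → ℝ) (k : Momentum) (j : ℕ) : ℝ :=
  RCLike.re (inner ℂ (vVec kF s V k) ((hOp kF k ^ j) (vVec kF s V k)))

/-! ### The effective Hamiltonian -/

/-- The terms `|p|² c*_{p,σ} c_{p,σ} Ψ`, with `p ∉ B_F`, of the first sum in `H'_kin Ψ`. -/
def kinTerm (kF : ℝ) {s : ℕ} (Ψ : Fock s) (a : {a : Mode s // a.1 ∉ fermiBall kF}) : Fock s :=
  (sqLen a.1.1 : ℂ) • create a.1 (annihilate a.1 Ψ)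

/-- The second sum in `H'_kin Ψ`, which is `∑_{p ∈ B_F} ∑_σ |p|² c_{p,σ} c*_{p,σ} Ψ`. -/
def kinHole (kF : ℝ) {s : ℕ} (Ψ : Fock s) : Fock s :=
  ∑ p ∈ fermiBall kF, ∑ σ : Fin s, (sqLen p : ℂ) • annihilate (p, σ) (create (p, σ) Ψ)

/-- `Q_l Ψ = ∑_{p ∈ L_l} b*_l((Ẽ_l - h_l) e_p) b_{l,p} Ψ`. -/
def quadTerm (kF : ℝ) {s : ℕ} (V : Momentum → ℝ) (Ψ : Fock s) (l : {l : Momentum // l ≠ 0}) :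
    Fock s :=
  ∑ p : lune kF l.1,
    excCreateVec ((EOp kF s V l.1 - hOp kF l.1) (EuclideanSpace.single p 1))
      (excAnnihilate l.1 (p : Momentum) Ψ)

theorem kinTerm_add (kF : ℝ) {s : ℕ} (Ψ Φ : Fock s) :
    kinTerm kF (Ψ + Φ) = fun a => kinTerm kF Ψ a + kinTerm kF Φ a := by
  funext a; simp [kinTerm]

theorem kinTerm_smul (kF : ℝ) {s : ℕ} (z : ℂ) (Ψ : Fock s) :
    kinTerm kF (z • Ψ) = fun a => z • kinTerm kF Ψ a := by
  funext a; simp only [kinTerm, map_smul]; rw [smul_comm]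

theorem quadTerm_add (kF : ℝ) {s : ℕ} (V : Momentum → ℝ) (Ψ Φ : Fock s) :
    quadTerm kF V (Ψ + Φ) = fun l => quadTerm kF V Ψ l + quadTerm kF V Φ l := by
  funext l; simp [quadTerm, Finset.sum_add_distrib]

theorem quadTerm_smul (kF : ℝ) {s : ℕ} (V : Momentum → ℝ) (z : ℂ) (Ψ : Fock s) :
    quadTerm kF V (z • Ψ) = fun l => z • quadTerm kF V Ψ l := by
  funext l; simp [quadTerm, Finset.smul_sum]

theorem kinHole_add (kF : ℝ) {s : ℕ} (Ψ Φ : Fock s) :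
    kinHole kF (Ψ + Φ) = kinHole kF Ψ + kinHole kF Φ := by
  simp [kinHole, Finset.sum_add_distrib]

theorem kinHole_smul (kF : ℝ) {s : ℕ} (z : ℂ) (Ψ : Fock s) :
    kinHole kF (z • Ψ) = z • kinHole kF Ψ := by
  simp only [kinHole, map_smul, Finset.smul_sum]
  exact Finset.sum_congr rfl fun p _ => Finset.sum_congr rfl fun σ _ => smul_comm _ _ _

/-- The domain of `H_eff`: the vectors of the `N`-particle space, `N = s |B_F|`, for which both
infinite sums in the definition of `H_eff` converge. -/
def heffDomain (kF : ℝ) (s : ℕ) (V : Momentum → ℝ) : Submodule ℂ (Fock s) where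
  carrier := {Ψ | Ψ ∈ particleSector s (particleNumber kF s) ∧
    Summable (kinTerm kF Ψ) ∧ Summable (quadTerm kF V Ψ)}
  zero_mem' := by
    refine ⟨Submodule.zero_mem _, ?_, ?_⟩
    · have h : kinTerm kF (0 : Fock s) = fun _ => 0 := by funext a; simp [kinTerm]
      rw [h]; exact summable_zero
    · have h : quadTerm kF V (0 : Fock s) = fun _ => 0 := by funext l; simp [quadTerm]
      rw [h]; exact summable_zero
  add_mem' := fun {Ψ Φ} hΨ hΦ => by
    refine ⟨Submodule.add_mem _ hΨ.1 hΦ.1, ?_, ?_⟩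
    · rw [kinTerm_add]; exact hΨ.2.1.add hΦ.2.1
    · rw [quadTerm_add]; exact hΨ.2.2.add hΦ.2.2
  smul_mem' := fun z Ψ hΨ => by
    refine ⟨Submodule.smul_mem _ z hΨ.1, ?_, ?_⟩
    · rw [kinTerm_smul]; exact hΨ.2.1.const_smul z
    · rw [quadTerm_smul]; exact hΨ.2.2.const_smul z

/-- `H_eff Ψ = H'_kin Ψ + 2 ∑_{l ≠ 0} Q_l Ψ`, where
`H'_kin = ∑_{p ∉ B_F, σ} |p|² c*_{p,σ} c_{p,σ} - ∑_{p ∈ B_F, σ} |p|² c_{p,σ} c*_{p,σ}`. -/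
def heffFun (kF : ℝ) {s : ℕ} (V : Momentum → ℝ) (Ψ : Fock s) : Fock s :=
  ((∑' a, kinTerm kF Ψ a) - kinHole kF Ψ) + (2 : ℂ) • ∑' l, quadTerm kF V Ψ l

theorem heffFun_add (kF : ℝ) {s : ℕ} (V : Momentum → ℝ) {Ψ Φ : Fock s}
    (hΨ : Ψ ∈ heffDomain kF s V) (hΦ : Φ ∈ heffDomain kF s V) :
    heffFun kF V (Ψ + Φ) = heffFun kF V Ψ + heffFun kF V Φ := by
  unfold heffFun
  rw [kinTerm_add, quadTerm_add, kinHole_add, hΨ.2.1.tsum_add hΦ.2.1, hΨ.2.2.tsum_add hΦ.2.2,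
    smul_add]
  abel

theorem heffFun_smul (kF : ℝ) {s : ℕ} (V : Momentum → ℝ) (z : ℂ) {Ψ : Fock s}
    (hΨ : Ψ ∈ heffDomain kF s V) : heffFun kF V (z • Ψ) = z • heffFun kF V Ψ := by
  unfold heffFun
  rw [kinTerm_smul, quadTerm_smul, kinHole_smul, hΨ.2.1.tsum_const_smul z,
    hΨ.2.2.tsum_const_smul z, smul_comm (2 : ℂ) z, smul_add, smul_sub]

/-- The effective Hamiltonian `H_eff` as a densely defined operator on the `N`-particle space. -/
def Heff (kF : ℝ) (s : ℕ) (V : Momentum → ℝ) : Fock s →ₗ.[ℂ] Fock s where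
  domain := heffDomain kF s V
  toFun :=
    { toFun := fun Ψ => heffFun kF V Ψ.1
      map_add' := fun Ψ Φ => heffFun_add kF V Ψ.2 Φ.2
      map_smul' := fun z Ψ => heffFun_smul kF V z Ψ.2 }

/-! ### Plasmon states -/

/-- `Ψ_M = b*_k(φ)^M ψ_F`. -/
def plasmonState {kF : ℝ} (s : ℕ) {k : Momentum} (φ : LuneSpace kF k) (M : ℕ) : Fock s :=
  ((excCreateVec φ : Fock s →L[ℂ] Fock s) ^ M) (fermiState kF s)

/-- `Ψ̂_M = ‖Ψ_M‖⁻¹ Ψ_M`. -/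
def plasmonStateNormalized {kF : ℝ} (s : ℕ) {k : Momentum} (φ : LuneSpace kF k) (M : ℕ) :
    Fock s :=
  ((‖plasmonState s φ M‖⁻¹ : ℝ) : ℂ) • plasmonState s φ M

/-- The summand `min{1, k_F V̂_l, k_F³ V̂_l |l|⁻²} V̂_l |l|²` of the error bound. -/
def errorTerm (kF : ℝ) (V : Momentum → ℝ) (l : {l : Momentum // l ≠ 0}) : ℝ :=
  min 1 (min (kF * V l.1) (kF ^ 3 * V l.1 / sqLen l.1)) * V l.1 * sqLen l.1

/-- The Coulomb potential `V̂_k = g |k|⁻²`. -/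
def coulomb (g : ℝ) (k : Momentum) : ℝ := g / sqLen k

/-- The number density `n = N / (2π)³`. -/
def density (kF : ℝ) (s : ℕ) : ℝ := particleNumber kF s / (2 * Real.pi) ^ 3

end

end Plasmon

/-! Write κ for `coupling`, w for `wVec`, m for the sum of λ over the lune, D_l = Ẽ_l − h_l, and T =
(ε_k/2)².

One-body part. Ẽ_k² = h_k² + 2P_w is a rank-one perturbation of a diagonal operator. Testing it on w
gives T ≥ 2κm + (Σλ³)/m (`energyLower_le`). Conversely, the eigenvalue equation in components makes
a top eigenvector a multiple of √λ_p / (T − λ_p²) and yields the secular equation 1 = 2 Σ κλ_p / (T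
− λ_p²). A lower bound on k_F V̂_k ensures the gap max λ² ≤ κm ≤ T/2. Under it, expanding the
secular equation to second order gives the matching upper bound on T (`sq_sub_energyLower_le`), and
the component formula shows that the mode is spread out: |φ_p|² = O(1/(k_F²|k|))
(`norm_sq_mode_le`).

Many-body part. b_k^*(φ) is a sum of commuting pair creation operators of square zero, so Ψ_M = M!
Σ_{|A|=M} ∏_{a∈A} y_a |A⟩ with orthonormal kets and y = φ/√s; its norm is an elementary symmetric
sum in |y_a|² ≤ β. If Mβ ≤ 1/2, lowering the number of pairs by one costs at most a factor 2M in
these sums (`esum_le_succ`). Hence Ψ_M ≠ 0, and the configurations that violate bosonic behaviour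
have relative weight O(M²β²).

The kinetic energy acts exactly: it replaces one factor φ by 2hφ (`kinetic_modeState_succ`). Were
pairs bosons, 2Q_k would replace one φ by 2(Ẽ_k − h_k)φ and Q_l with l ≠ k would give zero; the
total 2Ẽ_kφ = ε_kφ produces the eigenvalue Mε_k. What remains is `errVec`: the hard-core correction
for l = k, and for l ≠ k the removal of a particle and a hole belonging to different pairs.

Summing the error. A determinant with n particles and n holes contains at most n² particle-hole
pairs, and such a pair determines both l and p. Summing b* over all l therefore costs only a factor
of order M², and the error vectors overlap at most of order M times, which gives C M⁵ β² Σ_l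
‖D_l‖²_HS (`norm_sq_sum_errQuad_le`). Positivity of D_l and Ẽ_l² = h_l² + 2P_w bound its columns and
entries, and counting lune points turns this into the summand of the error bound
(`hsNormSq_le_errorTerm`).

For the Coulomb potential the inversion p ↦ k − p makes Σλ and Σλ³ exact expressions in the
cardinality and second moment of the Fermi ball. The dispersion relation then follows because the
mean of |q|² over the ball is asymptotic to (3/5)k_F². The error sum is estimated over shells of the
maximum norm. -/

namespace Plasmon

noncomputable section

/-! ### Coefficients of the fermionic operators -/

section FockAlgebra

variable {s : ℕ}

/-- The Slater determinant of a finite set of modes. -/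
def slaterDet (S : Finset (Mode s)) : Fock s := lp.single 2 S (1 : ℂ)

theorem slaterDet_apply (S T : Finset (Mode s)) :
    slaterDet S T = if T = S then 1 else 0 := by
  by_cases h : T = S
  · subst h; simp [slaterDet]
  · simp [slaterDet, lp.single_apply, h]

theorem fermiState_eq (kF : ℝ) :
    fermiState kF s = slaterDet (fermiBall kF ×ˢ (Finset.univ : Finset (Fin s))) := by
  ext T
  by_cases h : T = fermiBall kF ×ˢ (Finset.univ : Finset (Fin s))
  · rw [slaterDet_apply, if_pos h]; subst h; simp [fermiState]
  · rw [slaterDet_apply, if_neg h, fermiState, lp.single_apply, Pi.single_eq_of_ne h]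

theorem inner_slaterDet_left (S : Finset (Mode s)) (Ψ : Fock s) :
    inner ℂ (slaterDet S) Ψ = Ψ S := by
  rw [slaterDet, lp.inner_single_left]; simp

theorem hasSum_norm_sq (Ψ : Fock s) : HasSum (fun S => ‖Ψ S‖ ^ 2) (‖Ψ‖ ^ 2) := by
  have h := lp.hasSum_norm (p := 2) (by norm_num) Ψ
  simpa using h

theorem lp_sum_apply {ι : Type*} (I : Finset ι) (f : ι → Fock s) (S : Finset (Mode s)) :
    (∑ i ∈ I, f i) S = ∑ i ∈ I, f i S := by
  rw [lp.coeFn_sum, Finset.sum_apply]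

theorem conj_fermiSign (a : Mode s) (S : Finset (Mode s)) :
    (starRingEnd ℂ) (fermiSign a S) = fermiSign a S := by
  simp [fermiSign]

theorem fermiSign_mul_self (a : Mode s) (S : Finset (Mode s)) :
    fermiSign a S * fermiSign a S = 1 := by
  rw [fermiSign, ← mul_pow]; simp

theorem annihilate_apply (a : Mode s) (Ψ : Fock s) (S : Finset (Mode s)) :
    annihilate a Ψ S = if a ∈ S then 0 else fermiSign a S * Ψ (insert a S) := rfl

theorem annihilate_slaterDet (a : Mode s) (S : Finset (Mode s)) :
    annihilate a (slaterDet S) =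
      if a ∈ S then fermiSign a (S.erase a) • slaterDet (S.erase a) else 0 := by
  ext T
  rw [annihilate_apply, slaterDet_apply]
  by_cases haS : a ∈ S
  · rw [if_pos haS, lp.coeFn_smul, Pi.smul_apply, slaterDet_apply]
    by_cases haT : a ∈ T
    · have : T ≠ S.erase a := by rintro rfl; simp at haT
      simp [haT, this]
    · by_cases hTS : T = S.erase a
      · subst hTS; simp [haS]
      · have : insert a T ≠ S := by rintro rfl; simp [haT] at hTS
        simp [haT, hTS, this]
  · have : insert a T ≠ S := by rintro rfl; simp at haS
    simp [haS, this]

theorem create_apply (a : Mode s) (Ψ : Fock s) (S : Finset (Mode s)) :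
    create a Ψ S = if a ∈ S then fermiSign a (S.erase a) * Ψ (S.erase a) else 0 := by
  rw [← inner_slaterDet_left, create, ContinuousLinearMap.adjoint_inner_right,
    annihilate_slaterDet]
  split_ifs with h
  · rw [inner_smul_left, inner_slaterDet_left, conj_fermiSign]
  · rw [inner_zero_left]

theorem create_slaterDet (a : Mode s) (S : Finset (Mode s)) :
    create a (slaterDet S) =
      if a ∈ S then 0 else fermiSign a S • slaterDet (insert a S) := by
  ext T
  rw [create_apply, slaterDet_apply]
  by_cases haS : a ∈ S
  · have : T.erase a ≠ S := by rintro rfl; simp at haS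
    simp [haS, this]
  · rw [if_neg haS, lp.coeFn_smul, Pi.smul_apply, slaterDet_apply]
    by_cases haT : a ∈ T
    · by_cases hTS : T = insert a S
      · subst hTS; simp [haS]
      · have : T.erase a ≠ S := by rintro rfl; simp [haT] at hTS
        simp [hTS, this]
    · have : T ≠ insert a S := by rintro rfl; simp at haT
      simp [haT, this]

theorem adjoint_create (a : Mode s) : ContinuousLinearMap.adjoint (create a) = annihilate a := by
  rw [create, ContinuousLinearMap.adjoint_adjoint]

theorem adjoint_annihilate (a : Mode s) :
    ContinuousLinearMap.adjoint (annihilate a) = create a := rfl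

theorem create_annihilate_apply (a : Mode s) (Ψ : Fock s) (S : Finset (Mode s)) :
    create a (annihilate a Ψ) S = if a ∈ S then Ψ S else 0 := by
  rw [create_apply]
  split_ifs with h
  · rw [annihilate_apply, if_neg (Finset.notMem_erase a S), ← mul_assoc, fermiSign_mul_self,
      one_mul, Finset.insert_erase h]
  · rfl

theorem annihilate_create_apply (a : Mode s) (Ψ : Fock s) (S : Finset (Mode s)) :
    annihilate a (create a Ψ) S = if a ∈ S then 0 else Ψ S := by
  rw [annihilate_apply]
  split_ifs with h
  · rfl
  · rw [create_apply, if_pos (Finset.mem_insert_self a S), Finset.erase_insert h, ← mul_assoc,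
      fermiSign_mul_self, one_mul]

/-! ### Anticommutation relations -/

theorem fermiSign_insert_of_lt {a b : Mode s} {S : Finset (Mode s)} (hb : b ∉ S)
    (h : modeLT b a) : fermiSign a (insert b S) = -fermiSign a S := by
  classical
  unfold fermiSign
  rw [Finset.filter_insert, if_pos h, Finset.card_insert_of_notMem (by simp [hb]), pow_succ]
  ring

theorem fermiSign_insert_of_not_lt {a b : Mode s} {S : Finset (Mode s)}
    (h : ¬ modeLT b a) : fermiSign a (insert b S) = fermiSign a S := by
  classical
  unfold fermiSign
  rw [Finset.filter_insert, if_neg h]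

theorem modeLT_trichotomy {a b : Mode s} (h : a ≠ b) :
    (modeLT a b ∧ ¬ modeLT b a) ∨ (modeLT b a ∧ ¬ modeLT a b) := by
  unfold modeLT
  rcases lt_trichotomy (toLex (toLex a.1, a.2)) (toLex (toLex b.1, b.2)) with h1 | h1 | h1
  · exact Or.inl ⟨h1, not_lt_of_gt h1⟩
  · refine absurd ?_ h
    have := toLex.injective h1
    rw [Prod.mk.injEq] at this
    exact Prod.ext (toLex.injective this.1) this.2
  · exact Or.inr ⟨h1, not_lt_of_gt h1⟩

/-- Exchanging two modes changes the sign. -/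
theorem fermiSign_exchange {a b : Mode s} (h : a ≠ b) {S : Finset (Mode s)} (ha : a ∉ S)
    (hb : b ∉ S) :
    fermiSign a S * fermiSign b (insert a S) = -(fermiSign b S * fermiSign a (insert b S)) := by
  rcases modeLT_trichotomy h with ⟨h1, h2⟩ | ⟨h1, h2⟩
  · rw [fermiSign_insert_of_lt ha h1, fermiSign_insert_of_not_lt h2]; ring
  · rw [fermiSign_insert_of_lt hb h1, fermiSign_insert_of_not_lt h2]; ring

/-- Of two distinct modes exactly one precedes the other, so exactly one of the two insertions flips
a sign. -/
theorem fermiSign_exchange' {a b : Mode s} (h : a ≠ b) {S : Finset (Mode s)} (ha : a ∉ S)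
    (hb : b ∉ S) :
    fermiSign a (insert b S) * fermiSign b (insert a S) = -(fermiSign a S * fermiSign b S) := by
  rcases modeLT_trichotomy h with ⟨h1, h2⟩ | ⟨h1, h2⟩
  · rw [fermiSign_insert_of_lt ha h1, fermiSign_insert_of_not_lt h2]; ring
  · rw [fermiSign_insert_of_lt hb h1, fermiSign_insert_of_not_lt h2]; ring

theorem annihilate_annihilate {a b : Mode s} (h : a ≠ b) (Ψ : Fock s) :
    annihilate a (annihilate b Ψ) = -annihilate b (annihilate a Ψ) := by
  ext S
  rw [lp.coeFn_neg, Pi.neg_apply, annihilate_apply, annihilate_apply, annihilate_apply,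
    annihilate_apply]
  by_cases ha : a ∈ S
  · simp [ha]
  by_cases hb : b ∈ S
  · simp [hb]
  simp only [ha, hb, Finset.mem_insert, h, h.symm, or_self, if_false]
  rw [Finset.insert_comm b a, ← mul_assoc, ← mul_assoc, fermiSign_exchange h ha hb, neg_mul]

theorem create_create {a b : Mode s} (h : a ≠ b) (Ψ : Fock s) :
    create a (create b Ψ) = -create b (create a Ψ) := by
  refine ext_inner_right ℂ fun Φ => ?_
  rw [inner_neg_left, create, create, ContinuousLinearMap.adjoint_inner_left,
    ContinuousLinearMap.adjoint_inner_left, ContinuousLinearMap.adjoint_inner_left,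
    ContinuousLinearMap.adjoint_inner_left, annihilate_annihilate h.symm, inner_neg_right]

theorem annihilate_create {a b : Mode s} (h : a ≠ b) (Ψ : Fock s) :
    annihilate a (create b Ψ) = -create b (annihilate a Ψ) := by
  ext S
  rw [lp.coeFn_neg, Pi.neg_apply, annihilate_apply, create_apply, create_apply, annihilate_apply]
  by_cases ha : a ∈ S
  · simp [ha, h]
  by_cases hb : b ∈ S
  · obtain ⟨S', hb', rfl⟩ : ∃ S', b ∉ S' ∧ insert b S' = S :=
      ⟨S.erase b, by simp, Finset.insert_erase hb⟩
    have ha' : a ∉ S' := fun h' => ha (Finset.mem_insert_of_mem h')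
    have h1 : (insert a (insert b S')).erase b = insert a S' := by
      rw [Finset.insert_comm, Finset.erase_insert]
      simp [hb', h.symm]
    have h3 : b ∈ insert a (insert b S') := by simp
    rw [if_neg ha, if_pos h3, if_pos (Finset.mem_insert_self b S'), h1, Finset.erase_insert hb',
      if_neg ha', ← mul_assoc, ← mul_assoc, fermiSign_exchange' h ha' hb']
    ring
  · simp [hb, h.symm]

/-! ### Hopping operators -/

/-- `c*_b c_a` moves a particle from `a` to `b`. -/
def hop (b a : Mode s) : Fock s →L[ℂ] Fock s := create b ∘L annihilate a

theorem adjoint_hop (b a : Mode s) : ContinuousLinearMap.adjoint (hop b a) = hop a b := by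
  rw [hop, ContinuousLinearMap.adjoint_comp, adjoint_create, adjoint_annihilate, hop]

theorem norm_hop_apply {a b : Mode s} (h : a ≠ b) (Ψ : Fock s) (S : Finset (Mode s)) :
    ‖hop b a Ψ S‖ = if b ∈ S ∧ a ∉ S then ‖Ψ (insert a (S.erase b))‖ else 0 := by
  rw [hop, ContinuousLinearMap.comp_apply, create_apply]
  by_cases hb : b ∈ S
  · rw [if_pos hb, norm_mul, norm_fermiSign, one_mul, annihilate_apply]
    by_cases ha : a ∈ S
    · simp [ha, h]
    · simp [ha, hb, norm_fermiSign]
  · simp [hb]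

/-- Hopping forth and back meets every sign twice, so the product is the diagonal projection n_a(1 −
n_b). -/
theorem hop_hop_apply {a b : Mode s} (h : a ≠ b) (Ψ : Fock s) (S : Finset (Mode s)) :
    hop a b (hop b a Ψ) S = if a ∈ S ∧ b ∉ S then Ψ S else 0 := by
  rw [hop, hop, ContinuousLinearMap.comp_apply, ContinuousLinearMap.comp_apply, create_apply]
  by_cases ha : a ∈ S
  · rw [if_pos ha, annihilate_create_apply]
    by_cases hb : b ∈ S
    · simp [hb, h.symm]
    · have hb' : b ∉ S.erase a := fun h' => hb (Finset.mem_of_mem_erase h')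
      rw [if_neg hb', annihilate_apply, if_neg (Finset.notMem_erase a S), ← mul_assoc,
        fermiSign_mul_self, one_mul, Finset.insert_erase ha, if_pos ⟨ha, hb⟩]
  · simp [ha]

/-- Since `hop a b` is the adjoint of `hop b a`, the squared norm is the expectation of n_a(1 −
n_b). Norms of hopped states thus become weights of configurations, and signs disappear from all
later estimates. -/
theorem hasSum_norm_sq_hop {a b : Mode s} (h : a ≠ b) (Ψ : Fock s) :
    HasSum (fun S => if a ∈ S ∧ b ∉ S then ‖Ψ S‖ ^ 2 else 0) (‖hop b a Ψ‖ ^ 2) := by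
  have h1 : (inner ℂ Ψ (hop a b (hop b a Ψ)) : ℂ) = ((‖hop b a Ψ‖ ^ 2 : ℝ) : ℂ) := by
    rw [← adjoint_hop b a, ContinuousLinearMap.adjoint_inner_right, inner_self_eq_norm_sq_to_K]
    simp
  have h2 := lp.hasSum_inner (𝕜 := ℂ) Ψ (hop a b (hop b a Ψ))
  rw [h1] at h2
  have h3 := Complex.hasSum_re h2
  rw [Complex.ofReal_re] at h3
  refine h3.congr_fun ?_
  intro S
  rw [hop_hop_apply h]
  split_ifs
  · rw [inner_self_eq_norm_sq_to_K]
    simp [← Complex.ofReal_pow]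
  · simp

/-- Each of two fermionic operators passes two others, all anticommuting, so the number of sign
changes is even. -/
theorem hop_comm {p q p' q' : Mode s} (h1 : p ≠ p') (h2 : q ≠ q') (h3 : p ≠ q')
    (h4 : p' ≠ q) (Ψ : Fock s) :
    hop p q (hop p' q' Ψ) = hop p' q' (hop p q Ψ) := by
  simp only [hop, ContinuousLinearMap.comp_apply]
  rw [annihilate_create h4.symm, annihilate_annihilate h2, map_neg, map_neg, map_neg, neg_neg,
    create_create h1, annihilate_create h3.symm, map_neg]

end FockAlgebra

/-! ### Hard-core pairs -/

/-- A finite family of particle-hole pairs over a filled set `F` of modes. -/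
structure PairFamily (s : ℕ) (Λ : Type*) where
  /-- the filled modes -/
  F : Finset (Mode s)
  /-- the particle of a pair -/
  part : Λ → Mode s
  /-- the hole of a pair -/
  hole : Λ → Mode s
  part_injective : Function.Injective part
  hole_injective : Function.Injective hole
  part_notMem : ∀ a, part a ∉ F
  hole_mem : ∀ a, hole a ∈ F

namespace PairFamily

variable {s : ℕ} {Λ : Type*} (X : PairFamily s Λ)

theorem part_ne_hole (a b : Λ) : X.part a ≠ X.hole b := fun h =>
  X.part_notMem a (h ▸ X.hole_mem b)

/-- The creation operator `c*_{part a} c_{hole a}` of a pair. -/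
def pairCreate (a : Λ) : Fock s →L[ℂ] Fock s := hop (X.part a) (X.hole a)

/-- The annihilation operator `c*_{hole a} c_{part a}` of a pair. -/
def pairAnnihilate (a : Λ) : Fock s →L[ℂ] Fock s := hop (X.hole a) (X.part a)

theorem pairCreate_commute (a b : Λ) : Commute (X.pairCreate a) (X.pairCreate b) := by
  classical
  by_cases h : a = b
  · subst h; exact Commute.refl _
  · exact ContinuousLinearMap.ext fun Ψ =>
      hop_comm (X.part_injective.ne h) (X.hole_injective.ne h) (X.part_ne_hole a b)
        (X.part_ne_hole b a) Ψ

theorem pairCreate_pairwise_commute (A : Finset Λ) :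
    (A : Set Λ).Pairwise (Function.onFun Commute X.pairCreate) :=
  fun a _ b _ _ => X.pairCreate_commute a b

/-- The state in which exactly the pairs in `A` are excited. -/
def ket (A : Finset Λ) : Fock s :=
  (A.noncommProd X.pairCreate (X.pairCreate_pairwise_commute A)) (slaterDet X.F)

theorem ket_empty : X.ket ∅ = slaterDet X.F := by
  rw [ket, Finset.noncommProd_empty]; rfl

variable [DecidableEq Λ]

/-- The occupied modes once the pairs in `A` are excited. -/
def slater (A : Finset Λ) : Finset (Mode s) := (X.F \ A.image X.hole) ∪ A.image X.part

omit [DecidableEq Λ] in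
theorem mem_slater {A : Finset Λ} {m : Mode s} :
    m ∈ X.slater A ↔ (m ∈ X.F ∧ ∀ a ∈ A, X.hole a ≠ m) ∨ ∃ a ∈ A, X.part a = m := by
  simp [slater]

omit [DecidableEq Λ] in
theorem part_mem_slater {A : Finset Λ} {a : Λ} : X.part a ∈ X.slater A ↔ a ∈ A := by
  rw [mem_slater]
  constructor
  · rintro (⟨h, -⟩ | ⟨b, hb, h⟩)
    · exact absurd h (X.part_notMem a)
    · exact X.part_injective h ▸ hb
  · exact fun h => Or.inr ⟨a, h, rfl⟩

omit [DecidableEq Λ] in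
theorem hole_mem_slater {A : Finset Λ} {a : Λ} : X.hole a ∈ X.slater A ↔ a ∉ A := by
  rw [mem_slater]
  constructor
  · rintro (⟨-, h⟩ | ⟨b, hb, h⟩)
    · exact fun ha => h a ha rfl
    · exact absurd h (X.part_ne_hole b a)
  · exact fun h => Or.inl ⟨X.hole_mem a, fun b hb hba => h (X.hole_injective hba ▸ hb)⟩

omit [DecidableEq Λ] in
theorem slater_injective : Function.Injective X.slater := by
  intro A B h
  ext a
  rw [← X.part_mem_slater, h, X.part_mem_slater]

omit [DecidableEq Λ] in
theorem slater_empty : X.slater ∅ = X.F := by simp [slater]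

omit [DecidableEq Λ] in
theorem slater_sdiff (A : Finset Λ) : X.slater A \ X.F = A.image X.part := by
  ext m
  rw [Finset.mem_sdiff, mem_slater, Finset.mem_image]
  constructor
  · rintro ⟨⟨h, -⟩ | h, h'⟩
    · exact absurd h h'
    · exact h
  · rintro ⟨a, ha, rfl⟩
    exact ⟨Or.inr ⟨a, ha, rfl⟩, X.part_notMem a⟩

omit [DecidableEq Λ] in
theorem sdiff_slater (A : Finset Λ) : X.F \ X.slater A = A.image X.hole := by
  ext m
  rw [Finset.mem_sdiff, mem_slater, Finset.mem_image]
  constructor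
  · rintro ⟨h, h'⟩
    by_contra hc
    push Not at hc
    exact h' (Or.inl ⟨h, hc⟩)
  · rintro ⟨a, ha, rfl⟩
    refine ⟨X.hole_mem a, ?_⟩
    rintro (⟨-, h⟩ | ⟨b, -, h⟩)
    · exact h a ha rfl
    · exact X.part_ne_hole b a h

omit [DecidableEq Λ] in
theorem card_slater_sdiff (A : Finset Λ) : (X.slater A \ X.F).card = A.card := by
  rw [slater_sdiff, Finset.card_image_of_injective _ X.part_injective]

omit [DecidableEq Λ] in
theorem card_sdiff_slater (A : Finset Λ) : (X.F \ X.slater A).card = A.card := by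
  rw [sdiff_slater, Finset.card_image_of_injective _ X.hole_injective]

omit [DecidableEq Λ] in
theorem card_slater (A : Finset Λ) : (X.slater A).card = X.F.card := by
  have h1 := Finset.card_sdiff_add_card_inter (X.slater A) X.F
  have h2 := Finset.card_sdiff_add_card_inter X.F (X.slater A)
  rw [card_slater_sdiff] at h1
  rw [card_sdiff_slater, Finset.inter_comm] at h2
  omega

/-- No sign appears, because `ket` is a product of the pair creators themselves rather than an
ordered Slater determinant. -/
theorem pairCreate_ket_of_notMem {a : Λ} {A : Finset Λ} (h : a ∉ A) :
    X.pairCreate a (X.ket A) = X.ket (insert a A) := by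
  rw [ket, ket, Finset.noncommProd_insert_of_notMem _ _ _ _ h]
  rfl

theorem slater_insert (a : Λ) (A : Finset Λ) :
    insert (X.part a) ((X.slater A).erase (X.hole a)) = X.slater (insert a A) := by
  ext m
  simp only [Finset.mem_insert, Finset.mem_erase, mem_slater, forall_eq_or_imp, exists_eq_or_imp]
  constructor
  · rintro (rfl | ⟨h1, ⟨h2, h3⟩ | h2⟩)
    · exact Or.inr (Or.inl rfl)
    · exact Or.inl ⟨h2, h1.symm, h3⟩
    · exact Or.inr (Or.inr h2)
  · rintro (⟨h1, h2, h3⟩ | rfl | ⟨b, hb, rfl⟩)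
    · exact Or.inr ⟨h2.symm, Or.inl ⟨h1, h3⟩⟩
    · exact Or.inl rfl
    · exact Or.inr ⟨X.part_ne_hole b a, Or.inr ⟨b, hb, rfl⟩⟩

/-- The phase depends on the ordering of the modes; only its modulus is ever used. -/
theorem exists_ket_eq (A : Finset Λ) :
    ∃ z : ℂ, ‖z‖ = 1 ∧ X.ket A = z • slaterDet (X.slater A) := by
  induction A using Finset.induction_on with
  | empty => exact ⟨1, by simp, by rw [ket_empty, slater_empty, one_smul]⟩
  | insert a A h ih =>
    obtain ⟨z, hz, hA⟩ := ih
    rw [← X.pairCreate_ket_of_notMem h, hA, map_smul, pairCreate, hop,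
      ContinuousLinearMap.comp_apply, annihilate_slaterDet, if_pos (X.hole_mem_slater.2 h),
      map_smul, create_slaterDet, if_neg, slater_insert, smul_smul, smul_smul]
    · refine ⟨_, ?_, rfl⟩
      simp [hz, norm_fermiSign]
    · intro h'
      exact h (X.part_mem_slater.1 (Finset.mem_of_mem_erase h'))

theorem ket_apply_of_ne {A : Finset Λ} {T : Finset (Mode s)} (h : T ≠ X.slater A) :
    X.ket A T = 0 := by
  obtain ⟨z, -, hA⟩ := X.exists_ket_eq A
  rw [hA, lp.coeFn_smul, Pi.smul_apply, slaterDet_apply, if_neg h, smul_zero]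

theorem norm_ket_apply_self (A : Finset Λ) : ‖X.ket A (X.slater A)‖ = 1 := by
  obtain ⟨z, hz, hA⟩ := X.exists_ket_eq A
  rw [hA, lp.coeFn_smul, Pi.smul_apply, slaterDet_apply, if_pos rfl, smul_eq_mul, mul_one, hz]

theorem pairCreate_ket_of_mem {a : Λ} {A : Finset Λ} (h : a ∈ A) :
    X.pairCreate a (X.ket A) = 0 := by
  obtain ⟨z, hz, hA⟩ := X.exists_ket_eq A
  rw [hA, map_smul, pairCreate, hop, ContinuousLinearMap.comp_apply, annihilate_slaterDet,
    if_neg (fun h' => X.hole_mem_slater.1 h' h), map_zero, smul_zero]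

theorem pairAnnihilate_ket_of_notMem {a : Λ} {A : Finset Λ} (h : a ∉ A) :
    X.pairAnnihilate a (X.ket A) = 0 := by
  obtain ⟨z, hz, hA⟩ := X.exists_ket_eq A
  rw [hA, map_smul, pairAnnihilate, hop, ContinuousLinearMap.comp_apply, annihilate_slaterDet,
    if_neg (fun h' => h (X.part_mem_slater.1 h')), map_zero, smul_zero]

/-- Annihilation after creation of the pair a is the projection onto "hole filled, particle empty",
which fixes the ket of `A.erase a`. -/
theorem pairAnnihilate_ket_of_mem {a : Λ} {A : Finset Λ} (h : a ∈ A) :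
    X.pairAnnihilate a (X.ket A) = X.ket (A.erase a) := by
  conv_lhs => rw [← Finset.insert_erase h]
  rw [← X.pairCreate_ket_of_notMem (Finset.notMem_erase a A)]
  ext T
  rw [pairAnnihilate, pairCreate, hop_hop_apply (X.part_ne_hole a a).symm]
  split_ifs with hT
  · rfl
  · by_cases hT' : T = X.slater (A.erase a)
    · subst hT'
      refine absurd ⟨X.hole_mem_slater.2 (Finset.notMem_erase a A), fun h' => ?_⟩ hT
      exact Finset.notMem_erase a A (X.part_mem_slater.1 h')
    · exact (X.ket_apply_of_ne hT').symm

/-! ### Superpositions of pair states -/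

variable [Fintype Λ]

/-- The superposition `∑_A f(A) |A⟩`. -/
def comb (f : Finset Λ → ℂ) : Fock s := ∑ A, f A • X.ket A

theorem comb_apply_slater (f : Finset Λ → ℂ) (A : Finset Λ) :
    X.comb f (X.slater A) = f A * X.ket A (X.slater A) := by
  rw [comb, lp_sum_apply, Finset.sum_eq_single A]
  · rfl
  · intro B _ hB
    rw [lp.coeFn_smul, Pi.smul_apply, X.ket_apply_of_ne (X.slater_injective.ne hB.symm), smul_zero]
  · simp

theorem norm_comb_apply_slater (f : Finset Λ → ℂ) (A : Finset Λ) :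
    ‖X.comb f (X.slater A)‖ = ‖f A‖ := by
  rw [comb_apply_slater, norm_mul, norm_ket_apply_self, mul_one]

theorem comb_apply_of_notMem_range (f : Finset Λ → ℂ) {T : Finset (Mode s)}
    (h : T ∉ Set.range X.slater) : X.comb f T = 0 := by
  rw [comb, lp_sum_apply]
  refine Finset.sum_eq_zero fun B _ => ?_
  rw [lp.coeFn_smul, Pi.smul_apply, X.ket_apply_of_ne (fun h' => h ⟨B, h'.symm⟩), smul_zero]

theorem exists_of_comb_apply_ne_zero {f : Finset Λ → ℂ} {T : Finset (Mode s)}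
    (h : X.comb f T ≠ 0) : ∃ A, X.slater A = T ∧ f A ≠ 0 := by
  by_cases hT : T ∈ Set.range X.slater
  · obtain ⟨A, rfl⟩ := hT
    refine ⟨A, rfl, fun hA => h ?_⟩
    rw [comb_apply_slater, hA, zero_mul]
  · exact absurd (X.comb_apply_of_notMem_range f hT) h

-- Distinct sets of pairs occupy distinct sets of modes, so the kets are orthonormal and any weight
-- that depends on the configuration can be evaluated term by term.
open Classical in
theorem hasSum_comb (f : Finset Λ → ℂ) (P : Finset (Mode s) → Prop) :
    HasSum (fun S => if P S then ‖X.comb f S‖ ^ 2 else 0)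
      (∑ A, if P (X.slater A) then ‖f A‖ ^ 2 else 0) := by
  refine (X.slater_injective.hasSum_iff ?_).1 ?_
  · intro T hT
    simp [X.comb_apply_of_notMem_range f hT]
  · convert hasSum_fintype (fun A : Finset Λ => if P (X.slater A) then ‖f A‖ ^ 2 else 0) using 2
    simp only [Function.comp_apply, norm_comb_apply_slater]

theorem norm_sq_comb (f : Finset Λ → ℂ) : ‖X.comb f‖ ^ 2 = ∑ A, ‖f A‖ ^ 2 := by
  have h := X.hasSum_comb f (fun _ => True)
  simp only [if_true] at h
  exact (hasSum_norm_sq _).unique h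

theorem norm_sq_hop_comb {a b : Mode s} (h : a ≠ b) (f : Finset Λ → ℂ) :
    ‖hop b a (X.comb f)‖ ^ 2 =
      ∑ A, if a ∈ X.slater A ∧ b ∉ X.slater A then ‖f A‖ ^ 2 else 0 := by
  classical
  have h1 := X.hasSum_comb f (fun S => a ∈ S ∧ b ∉ S)
  have h2 := hasSum_norm_sq_hop h (X.comb f)
  exact (h2.unique (by convert h1)).trans (by congr!)

end PairFamily

/-! ### Elementary symmetric sums -/

section Esymm

variable {Λ : Type*} [Fintype Λ] [DecidableEq Λ]

/-- Double counting: adding an element to an M-set is the same datum as marking an element of an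
(M+1)-set. -/
theorem sum_powersetCard_insert {β : Type*} [AddCommMonoid β] (M : ℕ)
    (G : Λ → Finset Λ → β) :
    ∑ A ∈ Finset.powersetCard M (Finset.univ : Finset Λ), ∑ a ∈ Aᶜ, G a (insert a A) =
      ∑ B ∈ Finset.powersetCard (M + 1) (Finset.univ : Finset Λ), ∑ a ∈ B, G a B := by
  rw [Finset.sum_sigma', Finset.sum_sigma']
  refine Finset.sum_bij' (fun x _ => ⟨insert x.2 x.1, x.2⟩) (fun x _ => ⟨x.1.erase x.2, x.2⟩)
    ?_ ?_ ?_ ?_ ?_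
  · rintro ⟨A, a⟩ h
    simp only [Finset.mem_sigma, Finset.mem_powersetCard_univ, Finset.mem_compl] at h ⊢
    exact ⟨by rw [Finset.card_insert_of_notMem h.2, h.1], Finset.mem_insert_self _ _⟩
  · rintro ⟨A, a⟩ h
    simp only [Finset.mem_sigma, Finset.mem_powersetCard_univ, Finset.mem_compl] at h ⊢
    exact ⟨by rw [Finset.card_erase_of_mem h.2, h.1]; rfl, Finset.notMem_erase _ _⟩
  · rintro ⟨A, a⟩ h
    simp only [Finset.mem_sigma, Finset.mem_compl] at h
    simp [Finset.erase_insert h.2]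
  · rintro ⟨A, a⟩ h
    simp only [Finset.mem_sigma] at h
    simp [Finset.insert_erase h.2]
  · rintro ⟨A, a⟩ h
    rfl

/-- The elementary symmetric sum `∑_{|A| = M} ∏_{a ∈ A} x_a`. -/
def esum (x : Λ → ℝ) (M : ℕ) : ℝ :=
  ∑ A ∈ Finset.powersetCard M (Finset.univ : Finset Λ), ∏ a ∈ A, x a

variable {x : Λ → ℝ}

omit [DecidableEq Λ] in
theorem esum_zero : esum x 0 = 1 := by simp [esum]

omit [DecidableEq Λ] in
theorem esum_nonneg (hx : ∀ a, 0 ≤ x a) (M : ℕ) : 0 ≤ esum x M :=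
  Finset.sum_nonneg fun _ _ => Finset.prod_nonneg fun a _ => hx a

theorem succ_mul_esum_succ (M : ℕ) :
    (M + 1 : ℝ) * esum x (M + 1) =
      ∑ A ∈ Finset.powersetCard M (Finset.univ : Finset Λ), ∑ a ∈ Aᶜ, x a * ∏ b ∈ A, x b := by
  have h := sum_powersetCard_insert (Λ := Λ) M (fun _ B => ∏ b ∈ B, x b)
  rw [esum, Finset.mul_sum]
  trans ∑ B ∈ Finset.powersetCard (M + 1) (Finset.univ : Finset Λ), ∑ _a ∈ B, ∏ b ∈ B, x b
  · refine Finset.sum_congr rfl fun B hB => ?_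
    rw [Finset.sum_const, (Finset.mem_powersetCard.1 hB).2]
    simp
  · rw [← h]
    refine Finset.sum_congr rfl fun A _ => Finset.sum_congr rfl fun a ha => ?_
    rw [Finset.prod_insert (Finset.mem_compl.1 ha)]

/-- A set of M elements carries weight at most Mβ ≤ 1/2 of the total 1, so its complement, from
which an additional element is drawn, carries at least 1/2. -/
theorem esum_le_succ (hx : ∀ a, 0 ≤ x a) (hsum : ∑ a, x a = 1) {β : ℝ} (hβ : ∀ a, x a ≤ β)
    {M : ℕ} (hM : M * β ≤ 1 / 2) : esum x M ≤ 2 * (M + 1) * esum x (M + 1) := by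
  rw [mul_assoc, succ_mul_esum_succ, esum, Finset.mul_sum]
  refine Finset.sum_le_sum fun A hA => ?_
  rw [← Finset.sum_mul, ← mul_assoc]
  refine le_mul_of_one_le_left (Finset.prod_nonneg fun a _ => hx a) ?_
  have h1 : ∑ a ∈ A, x a ≤ M * β := by
    have := Finset.sum_le_card_nsmul A x β fun a _ => hβ a
    rwa [(Finset.mem_powersetCard.1 hA).2, nsmul_eq_mul] at this
  have h2 := Finset.sum_add_sum_compl A x
  rw [hsum] at h2
  linarith

theorem esum_pos (hx : ∀ a, 0 ≤ x a) (hsum : ∑ a, x a = 1) {β : ℝ} (hβ0 : 0 ≤ β)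
    (hβ : ∀ a, x a ≤ β) {M : ℕ} (hM : M * β ≤ 1 / 2) : 0 < esum x M := by
  induction M with
  | zero => rw [esum_zero]; exact one_pos
  | succ M ih =>
    have hM' : (M : ℝ) * β ≤ 1 / 2 := by push_cast at hM; nlinarith
    have h1 := esum_le_succ hx hsum hβ hM'
    have h2 := ih hM'
    have h3 : (0 : ℝ) < 2 * (M + 1) := by positivity
    by_contra hc
    have := mul_nonpos_of_nonneg_of_nonpos h3.le (not_lt.1 hc)
    linarith

theorem sum_powersetCard_mem {β : Type*} [AddCommMonoid β] (M : ℕ) (a : Λ)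
    (g : Finset Λ → β) :
    ∑ B ∈ Finset.powersetCard (M + 1) (Finset.univ : Finset Λ), (if a ∈ B then g B else 0) =
      ∑ A ∈ Finset.powersetCard M (Finset.univ : Finset Λ),
        if a ∈ A then 0 else g (insert a A) := by
  have h := sum_powersetCard_insert (Λ := Λ) M (fun c B => if c = a then g B else 0)
  simp only [Finset.sum_ite_eq', Finset.mem_compl] at h
  rw [← h]
  refine Finset.sum_congr rfl fun A _ => ?_
  split_ifs <;> rfl

/-- Sets containing one given element. -/
theorem sum_powersetCard_mem_le (hx : ∀ a, 0 ≤ x a) (M : ℕ) (a : Λ) :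
    ∑ A ∈ Finset.powersetCard (M + 1) (Finset.univ : Finset Λ),
      (if a ∈ A then ∏ c ∈ A, x c else 0) ≤ x a * esum x M := by
  rw [sum_powersetCard_mem, esum, Finset.mul_sum]
  refine Finset.sum_le_sum fun A _ => ?_
  have h : 0 ≤ x a * ∏ c ∈ A, x c := mul_nonneg (hx a) (Finset.prod_nonneg fun c _ => hx c)
  split_ifs with ha
  · exact h
  · rw [Finset.prod_insert ha]

/-- Sets containing two given elements. -/
theorem sum_powersetCard_mem_mem_le (hx : ∀ a, 0 ≤ x a) (M : ℕ) {a b : Λ} (hab : a ≠ b) :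
    ∑ A ∈ Finset.powersetCard (M + 2) (Finset.univ : Finset Λ),
      (if a ∈ A ∧ b ∈ A then ∏ c ∈ A, x c else 0) ≤ x a * x b * esum x M := by
  simp only [ite_and]
  rw [sum_powersetCard_mem, mul_assoc]
  refine le_trans ?_ (mul_le_mul_of_nonneg_left (sum_powersetCard_mem_le hx M b) (hx a))
  rw [Finset.mul_sum]
  refine Finset.sum_le_sum fun A _ => ?_
  have h : 0 ≤ ∏ c ∈ A, x c := Finset.prod_nonneg fun c _ => hx c
  have h' := hx a
  by_cases ha : a ∈ A
  · rw [if_pos ha]; split_ifs <;> positivity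
  · rw [if_neg ha, Finset.prod_insert ha]
    simp [Finset.mem_insert, hab.symm]

/-- Every error term fixes two amplitudes, leaving an elementary sum two levels down; this compares
it with the norm of the full state. -/
theorem esum_le_add_two (hx : ∀ a, 0 ≤ x a) (hsum : ∑ a, x a = 1) {β : ℝ} (hβ0 : 0 ≤ β)
    (hβ : ∀ a, x a ≤ β) {M : ℕ} (hM : (M + 2) * β ≤ 1 / 2) :
    esum x M ≤ 4 * (M + 2) ^ 2 * esum x (M + 2) := by
  have h1 := esum_le_succ hx hsum hβ (M := M) (by nlinarith)
  have h2 := esum_le_succ hx hsum hβ (M := M + 1) (by push_cast; nlinarith)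
  push_cast at h2
  have h3 := esum_nonneg hx (M + 2)
  have hM0 : (0 : ℝ) ≤ M := M.cast_nonneg
  calc esum x M ≤ 2 * (M + 1) * esum x (M + 1) := h1
    _ ≤ 2 * (M + 1) * (2 * (M + 1 + 1) * esum x (M + 2)) := by gcongr
    _ = 4 * ((M + 1) * (M + 2)) * esum x (M + 2) := by ring
    _ ≤ 4 * (M + 2) ^ 2 * esum x (M + 2) := by gcongr; nlinarith

end Esymm

/-! ### Powers of a pair creation operator -/

namespace PairFamily

variable {s : ℕ} {Λ : Type*} [DecidableEq Λ] [Fintype Λ] (X : PairFamily s Λ)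

/-- `∑_{|A| = M} ∏_{a ∈ A} y_a |A⟩`. -/
def pairState (y : Λ → ℂ) (M : ℕ) : Fock s :=
  ∑ A ∈ Finset.powersetCard M (Finset.univ : Finset Λ), (∏ a ∈ A, y a) • X.ket A

omit [DecidableEq Λ] in
theorem sum_powersetCard_eq_comb (f : Finset Λ → ℂ) (M : ℕ) :
    ∑ A ∈ Finset.powersetCard M (Finset.univ : Finset Λ), f A • X.ket A =
      X.comb fun A => if A.card = M then f A else 0 := by
  rw [comb, Finset.powersetCard_eq_filter, Finset.powerset_univ, Finset.sum_filter]
  simp [ite_smul]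

omit [DecidableEq Λ] in
theorem pairState_eq_comb (y : Λ → ℂ) (M : ℕ) :
    X.pairState y M = X.comb fun A => if A.card = M then ∏ a ∈ A, y a else 0 :=
  X.sum_powersetCard_eq_comb _ M

omit [DecidableEq Λ] in
theorem sum_ite_card_eq {β : Type*} [AddCommMonoid β] (f : Finset Λ → β) (M : ℕ) :
    ∑ A, (if A.card = M then f A else 0) =
      ∑ A ∈ Finset.powersetCard M (Finset.univ : Finset Λ), f A := by
  rw [Finset.powersetCard_eq_filter, Finset.powerset_univ, Finset.sum_filter]

theorem norm_sq_pairState (y : Λ → ℂ) (M : ℕ) :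
    ‖X.pairState y M‖ ^ 2 = esum (fun a => ‖y a‖ ^ 2) M := by
  rw [pairState_eq_comb, norm_sq_comb, esum, ← sum_ite_card_eq]
  refine Finset.sum_congr rfl fun A _ => ?_
  split_ifs
  · rw [norm_prod, Finset.prod_pow]
  · simp

theorem sum_smul_pairCreate_pairState (y c : Λ → ℂ) (M : ℕ) :
    (∑ a, (y a * c a) • X.pairCreate a) (X.pairState y M) =
      ∑ B ∈ Finset.powersetCard (M + 1) (Finset.univ : Finset Λ),
        ((∑ a ∈ B, c a) * ∏ b ∈ B, y b) • X.ket B := by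
  have h := sum_powersetCard_insert (Λ := Λ) M
    (fun a B => (c a * ∏ b ∈ B, y b) • X.ket B)
  simp only [Finset.sum_mul, Finset.sum_smul]
  rw [← h, pairState, map_sum]
  refine Finset.sum_congr rfl fun A _ => ?_
  rw [sum_apply, ← Finset.sum_add_sum_compl A, Finset.sum_eq_zero, zero_add]
  · refine Finset.sum_congr rfl fun a ha => ?_
    rw [Finset.mem_compl] at ha
    rw [smul_apply, map_smul, X.pairCreate_ket_of_notMem ha, smul_smul,
      Finset.prod_insert ha]
    congr 1
    ring
  · intro a ha
    rw [smul_apply, map_smul, X.pairCreate_ket_of_mem ha, smul_zero, smul_zero]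

theorem sum_pairCreate_pairState (y : Λ → ℂ) (M : ℕ) :
    (∑ a, y a • X.pairCreate a) (X.pairState y M) = ((M : ℂ) + 1) • X.pairState y (M + 1) := by
  have h := X.sum_smul_pairCreate_pairState y (fun _ => 1) M
  simp only [mul_one] at h
  rw [h, pairState, Finset.smul_sum]
  refine Finset.sum_congr rfl fun B hB => ?_
  rw [smul_smul, Finset.sum_const, (Finset.mem_powersetCard.1 hB).2]
  simp

/-- Each M-set is reached in M! orders, and repetitions vanish because a pair cannot be created
twice. -/
theorem pow_sum_pairCreate_ket_empty (y : Λ → ℂ) (M : ℕ) :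
    ((∑ a, y a • X.pairCreate a) ^ M) (X.ket ∅) = (M.factorial : ℂ) • X.pairState y M := by
  induction M with
  | zero => simp [pairState]
  | succ M ih =>
    rw [pow_succ', mul_apply_eq_comp, ih, map_smul, sum_pairCreate_pairState,
      smul_smul, Nat.factorial_succ]
    push_cast
    rw [mul_comm]

/-- The bosonic rule would return y_a times the state with one pair fewer. That state also contains
sets in which a is still excited, and annihilating a cannot produce these: they are the whole
defect. -/
theorem pairAnnihilate_pairState_sub (y : Λ → ℂ) (M : ℕ) (a : Λ) :
    X.pairAnnihilate a (X.pairState y (M + 1)) - y a • X.pairState y M =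
      X.comb fun A => if A.card = M then (if a ∈ A then -(y a * ∏ b ∈ A, y b) else 0) else 0 := by
  rw [← sum_powersetCard_eq_comb, pairState, map_sum]
  have h := sum_powersetCard_mem (Λ := Λ) M a (fun B => (∏ b ∈ B, y b) • X.ket (B.erase a))
  have h1 : ∑ B ∈ Finset.powersetCard (M + 1) (Finset.univ : Finset Λ),
      X.pairAnnihilate a ((∏ b ∈ B, y b) • X.ket B) =
      ∑ B ∈ Finset.powersetCard (M + 1) (Finset.univ : Finset Λ),
        if a ∈ B then (∏ b ∈ B, y b) • X.ket (B.erase a) else 0 := by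
    refine Finset.sum_congr rfl fun B _ => ?_
    rw [map_smul]
    split_ifs with ha
    · rw [X.pairAnnihilate_ket_of_mem ha]
    · rw [X.pairAnnihilate_ket_of_notMem ha, smul_zero]
  rw [h1, h, pairState, Finset.smul_sum, ← Finset.sum_sub_distrib]
  refine Finset.sum_congr rfl fun A _ => ?_
  split_ifs with ha
  · rw [zero_sub, smul_smul, neg_smul]
  · rw [Finset.prod_insert ha, Finset.erase_insert ha, smul_smul, sub_self, zero_smul]

/-! ### Smallness of the deviations from bosonic behaviour -/

section Bounds

variable {y : Λ → ℂ} {β : ℝ} (hsum : ∑ a, ‖y a‖ ^ 2 = 1) (hβ : ∀ a, ‖y a‖ ^ 2 ≤ β)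

include hsum hβ

omit [DecidableEq Λ] in
theorem bound_nonneg : 0 ≤ β := by
  rcases isEmpty_or_nonempty Λ with h | ⟨⟨a⟩⟩
  · simp at hsum
  · exact (sq_nonneg _).trans (hβ a)

theorem pairState_norm_pos {M : ℕ} (hM : M * β ≤ 1 / 2) : 0 < ‖X.pairState y M‖ := by
  have h := esum_pos (fun a => sq_nonneg ‖y a‖) hsum (bound_nonneg hsum hβ) hβ hM
  rw [← norm_sq_pairState X] at h
  exact (norm_nonneg _).lt_of_ne' fun h0 => by simp [h0] at h

/-- The defect carries one factor |y_a|² explicitly and a second one because its sets contain a; the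
remaining elementary sum lies two levels below the full norm. -/
theorem norm_sq_pairAnnihilate_sub_le {M : ℕ} (hM : (M + 1 : ℕ) * β ≤ 1 / 2) (a : Λ) :
    ‖X.pairAnnihilate a (X.pairState y (M + 1)) - y a • X.pairState y M‖ ^ 2 ≤
      4 * ((M + 1 : ℕ) : ℝ) ^ 2 * β ^ 2 * ‖X.pairState y (M + 1)‖ ^ 2 := by
  have hx : ∀ a, 0 ≤ ‖y a‖ ^ 2 := fun a => sq_nonneg _
  have hβ0 := bound_nonneg hsum hβ
  rw [pairAnnihilate_pairState_sub, norm_sq_comb, norm_sq_pairState]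
  have h1 : ∑ A : Finset Λ, ‖(if A.card = M then
        (if a ∈ A then -(y a * ∏ b ∈ A, y b) else 0) else 0 : ℂ)‖ ^ 2 =
      ‖y a‖ ^ 2 * ∑ A ∈ Finset.powersetCard M (Finset.univ : Finset Λ),
        if a ∈ A then ∏ b ∈ A, ‖y b‖ ^ 2 else 0 := by
    rw [Finset.mul_sum, ← sum_ite_card_eq]
    refine Finset.sum_congr rfl fun A _ => ?_
    split_ifs
    · rw [norm_neg, norm_mul, norm_prod, mul_pow, Finset.prod_pow]
    · simp
    · simp
  rw [h1]
  cases M with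
  -- The empty set does not contain a, so a single pair has no defect.
  | zero => simp; have := esum_nonneg hx 1; positivity
  | succ M =>
    have h2 := sum_powersetCard_mem_le hx M a
    have h3 := esum_le_add_two hx hsum hβ0 hβ (M := M) (by push_cast at hM ⊢; linarith)
    have h4 := esum_nonneg hx M
    calc _ ≤ ‖y a‖ ^ 2 * (‖y a‖ ^ 2 * esum (fun a => ‖y a‖ ^ 2) M) := by gcongr
      _ ≤ β * (β * (4 * (M + 2) ^ 2 * esum (fun a => ‖y a‖ ^ 2) (M + 2))) := by
        gcongr
        · exact hβ a
        · exact hβ a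
      _ = _ := by push_cast; ring

/-- If m is the particle of a pair a and m' the hole of a pair b ≠ a, only sets containing both a
and b survive, with relative weight |y_a|²|y_b|². If m is no particle or m' no hole of the family,
nothing survives. -/
theorem norm_sq_hop_pairState_le {M : ℕ} (hM : M * β ≤ 1 / 2) {m m' : Mode s} (hm : m ∉ X.F)
    (hm' : m' ∈ X.F) (hne : ∀ a, X.part a = m → X.hole a ≠ m') :
    ‖hop m' m (X.pairState y M)‖ ^ 2 ≤ 4 * (M : ℝ) ^ 2 * β ^ 2 * ‖X.pairState y M‖ ^ 2 := by
  have hx : ∀ a, 0 ≤ ‖y a‖ ^ 2 := fun a => sq_nonneg _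
  have hβ0 := bound_nonneg hsum hβ
  have hmm : m ≠ m' := fun h => hm (h ▸ hm')
  rw [norm_sq_pairState]
  conv_lhs => rw [pairState_eq_comb]
  rw [norm_sq_hop_comb X hmm]
  by_cases hab : ∃ a b, X.part a = m ∧ X.hole b = m'
  · obtain ⟨a, b, rfl, rfl⟩ := hab
    have hab : a ≠ b := fun h => hne a rfl (h ▸ rfl)
    have h1 : ∑ A : Finset Λ, (if X.part a ∈ X.slater A ∧ X.hole b ∉ X.slater A then
          ‖(if A.card = M then ∏ c ∈ A, y c else 0 : ℂ)‖ ^ 2 else 0) =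
        ∑ A ∈ Finset.powersetCard M (Finset.univ : Finset Λ),
          if a ∈ A ∧ b ∈ A then ∏ c ∈ A, ‖y c‖ ^ 2 else 0 := by
      rw [← sum_ite_card_eq]
      refine Finset.sum_congr rfl fun A _ => ?_
      simp only [part_mem_slater, hole_mem_slater, not_not]
      by_cases h : a ∈ A ∧ b ∈ A
      · rw [if_pos h, if_pos h]
        split_ifs
        · rw [norm_prod, Finset.prod_pow]
        · simp
      · rw [if_neg h, if_neg h, ite_self]
    rw [h1]
    rcases lt_or_ge M 2 with h | h
    · refine le_of_eq_of_le (Finset.sum_eq_zero fun A hA => if_neg fun hA' => ?_) ?_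
      · have := Finset.one_lt_card.2 ⟨a, hA'.1, b, hA'.2, hab⟩
        rw [(Finset.mem_powersetCard.1 hA).2] at this
        omega
      · have := esum_nonneg hx M
        positivity
    · obtain ⟨M, rfl⟩ := Nat.exists_eq_add_of_le' h
      have h2 := sum_powersetCard_mem_mem_le hx M hab
      have h3 := esum_le_add_two hx hsum hβ0 hβ (M := M) (by push_cast at hM ⊢; linarith)
      have h4 := esum_nonneg hx M
      calc _ ≤ ‖y a‖ ^ 2 * ‖y b‖ ^ 2 * esum (fun a => ‖y a‖ ^ 2) M := h2
        _ ≤ β * β * (4 * (M + 2) ^ 2 * esum (fun a => ‖y a‖ ^ 2) (M + 2)) := by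
          gcongr
          · exact hβ a
          · exact hβ b
        _ = _ := by push_cast; ring
  · refine le_of_eq_of_le (Finset.sum_eq_zero fun A _ => if_neg ?_) ?_
    · rintro ⟨h1, h2⟩
      refine hab ?_
      rcases X.mem_slater.1 h1 with ⟨h, -⟩ | ⟨a, -, ha⟩
      · exact absurd h hm
      · by_contra hc
        push Not at hc
        exact h2 (X.mem_slater.2 (Or.inl ⟨hm', fun b _ => hc a b ha⟩))
    · have := esum_nonneg hx M
      positivity

end Bounds

/-! ### Which determinants occur in the error vectors -/

theorem pairState_apply_ne_zero {y : Λ → ℂ} {M : ℕ} {T : Finset (Mode s)}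
    (h : X.pairState y M T ≠ 0) : ∃ A, X.slater A = T ∧ A.card = M := by
  rw [pairState_eq_comb] at h
  obtain ⟨A, hA, hf⟩ := X.exists_of_comb_apply_ne_zero h
  exact ⟨A, hA, by_contra fun hc => hf (if_neg hc)⟩

theorem pairAnnihilate_sub_apply_ne_zero {y : Λ → ℂ} {M : ℕ} {a : Λ} {T : Finset (Mode s)}
    (h : (X.pairAnnihilate a (X.pairState y (M + 1)) - y a • X.pairState y M) T ≠ 0) :
    (T \ X.F).card = M ∧ (X.F \ T).card = M ∧ X.hole a ∈ X.F \ T := by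
  rw [pairAnnihilate_pairState_sub] at h
  obtain ⟨A, rfl, hf⟩ := X.exists_of_comb_apply_ne_zero h
  split_ifs at hf with h1 h2
  · rw [card_slater_sdiff, card_sdiff_slater, Finset.mem_sdiff, hole_mem_slater, not_not]
    exact ⟨h1, h1, X.hole_mem a, h2⟩
  · exact absurd rfl hf
  · exact absurd rfl hf

/-- The particle m is removed together with a hole of another pair, so the hole belonging to m stays
open. It remains visible in T and identifies m, which later limits how many error vectors can meet
at T. -/
theorem hop_pairState_apply_ne_zero {y : Λ → ℂ} {M : ℕ} {m m' : Mode s} (hm : m ∉ X.F)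
    (hm' : m' ∈ X.F) (hne : ∀ a, X.part a = m → X.hole a ≠ m') {T : Finset (Mode s)}
    (h : hop m' m (X.pairState y M) T ≠ 0) :
    (T \ X.F).card + 1 = M ∧ (X.F \ T).card + 1 = M ∧
      ∃ a, X.part a = m ∧ X.hole a ∈ X.F \ T := by
  have hmm : m ≠ m' := fun h => hm (h ▸ hm')
  rw [← norm_ne_zero_iff, norm_hop_apply hmm] at h
  split_ifs at h with hT
  swap
  · exact absurd rfl h
  obtain ⟨hT1, hT2⟩ := hT
  rw [norm_ne_zero_iff] at h
  obtain ⟨A, hA, hcard⟩ := X.pairState_apply_ne_zero h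
  have hmA : m ∈ X.slater A := hA ▸ Finset.mem_insert_self _ _
  have hm'A : m' ∉ X.slater A := by
    rw [hA]; simp [hmm.symm]
  have hTA : ∀ x, x ∈ T ↔ x = m' ∨ (x ∈ X.slater A ∧ x ≠ m) := by
    intro x
    rw [hA, Finset.mem_insert, Finset.mem_erase]
    constructor
    · intro hx
      by_cases h1 : x = m'
      · exact Or.inl h1
      · exact Or.inr ⟨Or.inr ⟨h1, hx⟩, fun h2 => hT2 (h2 ▸ hx)⟩
    · rintro (rfl | ⟨rfl | ⟨-, h1⟩, h2⟩)
      · exact hT1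
      · exact absurd rfl h2
      · exact h1
  have hTF : T \ X.F = (X.slater A \ X.F).erase m := by
    ext x
    rw [Finset.mem_sdiff, hTA, Finset.mem_erase, Finset.mem_sdiff]
    constructor
    · rintro ⟨rfl | ⟨h1, h2⟩, h3⟩
      · exact absurd hm' h3
      · exact ⟨h2, h1, h3⟩
    · rintro ⟨h1, h2, h3⟩
      exact ⟨Or.inr ⟨h2, h1⟩, h3⟩
  have hFT : X.F \ T = (X.F \ X.slater A).erase m' := by
    ext x
    rw [Finset.mem_sdiff, hTA, Finset.mem_erase, Finset.mem_sdiff]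
    constructor
    · rintro ⟨h1, h2⟩
      push Not at h2
      refine ⟨h2.1, h1, fun h3 => hm (h2.2 h3 ▸ h1)⟩
    · rintro ⟨h1, h2, h3⟩
      exact ⟨h2, by rintro (h4 | ⟨h4, -⟩) <;> contradiction⟩
  refine ⟨?_, ?_, ?_⟩
  · rw [hTF, Finset.card_erase_add_one (Finset.mem_sdiff.2 ⟨hmA, hm⟩), card_slater_sdiff, hcard]
  · rw [hFT, Finset.card_erase_add_one (Finset.mem_sdiff.2 ⟨hm', hm'A⟩), card_sdiff_slater, hcard]
  · rcases X.mem_slater.1 hmA with ⟨h1, -⟩ | ⟨a, ha, rfl⟩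
    · exact absurd h1 hm
    · refine ⟨a, rfl, ?_⟩
      rw [hFT, Finset.mem_erase, Finset.mem_sdiff, hole_mem_slater, not_not]
      exact ⟨hne a rfl, X.hole_mem a, ha⟩

end PairFamily

/-! ### Lengths and positivity of λ on the lune -/

theorem sqLen_nonneg (p : Momentum) : 0 ≤ sqLen p := Finset.sum_nonneg fun _ _ => sq_nonneg _

theorem len_nonneg (p : Momentum) : 0 ≤ len p := Real.sqrt_nonneg _

theorem len_sq (p : Momentum) : len p ^ 2 = sqLen p := Real.sq_sqrt (sqLen_nonneg p)

theorem lam_pos {kF : ℝ} {k p : Momentum} (h : p ∈ lune kF k) : 0 < lam k p := by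
  obtain ⟨h1, h2⟩ := mem_lune.1 h
  have h3 := pow_lt_pow_left₀ (h1.trans_lt h2) (len_nonneg _) two_ne_zero
  rw [len_sq, len_sq] at h3
  rw [lam]
  linarith

/-! ### The one-body operators -/

section OneBody

variable {kF : ℝ} {k : Momentum}

/-- A diagonal operator on `ℓ²(L_k)`. -/
def diagOp (d : lune kF k → ℝ) : LuneSpace kF k →L[ℂ] LuneSpace kF k :=
  Matrix.toEuclideanCLM (𝕜 := ℂ) (n := lune kF k) (Matrix.diagonal fun p => (d p : ℂ))

theorem diagOp_apply (d : lune kF k → ℝ) (φ : LuneSpace kF k) (p : lune kF k) :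
    diagOp d φ p = d p * φ p := by
  rw [diagOp, Matrix.ofLp_toEuclideanCLM, Matrix.mulVec_diagonal]

theorem diagOp_mul (d e : lune kF k → ℝ) : diagOp d * diagOp e = diagOp fun p => d p * e p := by
  rw [diagOp, diagOp, ← map_mul, Matrix.diagonal_mul_diagonal, diagOp]
  simp

theorem star_diagOp (d : lune kF k → ℝ) : star (diagOp d) = diagOp d := by
  rw [diagOp, ← map_star, Matrix.star_eq_conjTranspose, Matrix.diagonal_conjTranspose]
  congr 2
  ext p
  simp

theorem diagOp_nonneg {d : lune kF k → ℝ} (hd : ∀ p, 0 ≤ d p) : 0 ≤ diagOp d := by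
  have h : diagOp d = star (diagOp fun p => √(d p)) * diagOp fun p => √(d p) := by
    rw [star_diagOp, diagOp_mul]
    congr 1
    ext p
    exact (Real.mul_self_sqrt (hd p)).symm
  rw [h]
  exact star_mul_self_nonneg _

theorem sqrt_diagOp {d : lune kF k → ℝ} (hd : ∀ p, 0 ≤ d p) :
    CFC.sqrt (diagOp d) = diagOp fun p => √(d p) := by
  refine CFC.sqrt_unique ?_ (diagOp_nonneg fun p => Real.sqrt_nonneg _)
  rw [diagOp_mul]
  congr 1
  ext p
  exact Real.mul_self_sqrt (hd p)

theorem hOp_eq_diagOp : hOp kF k = diagOp fun p => lam k p := rfl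

theorem hOp_apply (φ : LuneSpace kF k) (p : lune kF k) : hOp kF k φ p = lam k p * φ p := by
  rw [hOp_eq_diagOp, diagOp_apply]

theorem hOp_single (p : lune kF k) :
    hOp kF k (EuclideanSpace.single p 1) = (lam k p : ℂ) • EuclideanSpace.single p 1 := by
  ext q
  rw [hOp_apply]
  by_cases h : q = p
  · subst h; simp
  · simp [h]

theorem hOp_nonneg : 0 ≤ hOp kF k := diagOp_nonneg fun p => (lam_pos p.2).le

theorem hOp_pow_apply (j : ℕ) (φ : LuneSpace kF k) (p : lune kF k) :
    (hOp kF k ^ j) φ p = lam k p ^ j * φ p := by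
  induction j generalizing φ with
  | zero => simp
  | succ j ih =>
    rw [pow_succ, mul_apply_eq_comp, ih, hOp_apply]
    push_cast
    ring

variable (s : ℕ) (V : Momentum → ℝ)

/-- The squared coupling `s V̂_k / (2 (2π)³)`. -/
def coupling (k : Momentum) : ℝ := s * V k / (2 * (2 * Real.pi) ^ 3)

/-- The vector `w = h_k^{1/2} v_k`. -/
def wVec (kF : ℝ) (k : Momentum) : LuneSpace kF k := CFC.sqrt (hOp kF k) (vVec kF s V k)

variable {s V}

theorem coupling_nonneg (hV : 0 ≤ V k) : 0 ≤ coupling s V k := by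
  rw [coupling]; positivity

theorem wVec_apply (p : lune kF k) :
    wVec s V kF k p = ((√(lam k p) * √(coupling s V k) : ℝ) : ℂ) := by
  rw [wVec, hOp_eq_diagOp, sqrt_diagOp fun p => (lam_pos p.2).le, diagOp_apply, vVec, coupling]
  push_cast
  rfl

theorem norm_sq_wVec_apply (hV : 0 ≤ V k) (p : lune kF k) :
    ‖wVec s V kF k p‖ ^ 2 = coupling s V k * lam k p := by
  rw [wVec_apply, Complex.norm_real, Real.norm_eq_abs, sq_abs, mul_pow,
    Real.sq_sqrt (lam_pos p.2).le, Real.sq_sqrt (coupling_nonneg hV), mul_comm]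

theorem norm_sq_wVec (hV : 0 ≤ V k) :
    ‖wVec s V kF k‖ ^ 2 = coupling s V k * ∑ p ∈ lune kF k, lam k p := by
  rw [EuclideanSpace.norm_sq_eq, ← Finset.sum_coe_sort (lune kF k), Finset.mul_sum]
  exact Finset.sum_congr rfl fun p _ => norm_sq_wVec_apply hV p

theorem moment_eq (hV : 0 ≤ V k) (j : ℕ) :
    moment kF s V k j = coupling s V k * ∑ p ∈ lune kF k, lam k p ^ j := by
  rw [moment, PiLp.inner_apply, ← Finset.sum_coe_sort (lune kF k), Finset.mul_sum, map_sum]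
  refine Finset.sum_congr rfl fun p _ => ?_
  have h : (vVec kF s V k) p = ((√(coupling s V k) : ℝ) : ℂ) := rfl
  rw [hOp_pow_apply, h, RCLike.inner_apply, Complex.conj_ofReal, ← Complex.ofReal_pow,
    ← Complex.ofReal_mul, ← Complex.ofReal_mul]
  have h1 := Real.mul_self_sqrt (coupling_nonneg (s := s) hV)
  change lam k p ^ j * √(coupling s V k) * √(coupling s V k) = _
  rw [mul_assoc, h1, mul_comm]

/-- The square `h_k² + 2 P_w` of `Ẽ_k`. -/
def ESq (s : ℕ) (V : Momentum → ℝ) (kF : ℝ) (k : Momentum) :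
    LuneSpace kF k →L[ℂ] LuneSpace kF k :=
  hOp kF k ^ 2 + (2 : ℂ) • InnerProductSpace.rankOne ℂ (wVec s V kF k) (wVec s V kF k)

open scoped ComplexOrder in
theorem two_rankOne_nonneg :
    0 ≤ (2 : ℂ) • InnerProductSpace.rankOne ℂ (wVec s V kF k) (wVec s V kF k) := by
  rw [ContinuousLinearMap.nonneg_iff_isPositive]
  exact (InnerProductSpace.isPositive_rankOne_self _).smul_of_nonneg zero_le_two

theorem hOp_sq_nonneg : 0 ≤ hOp kF k ^ 2 := by
  have h : star (hOp kF k) = hOp kF k := star_diagOp _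
  rw [pow_two]
  nth_rewrite 1 [← h]
  exact star_mul_self_nonneg _

theorem hOp_sq_le_ESq : hOp kF k ^ 2 ≤ ESq s V kF k :=
  le_add_of_nonneg_right two_rankOne_nonneg

theorem EOp_mul_self : EOp kF s V k * EOp kF s V k = ESq s V kF k :=
  CFC.sqrt_mul_sqrt_self _ (hOp_sq_nonneg.trans hOp_sq_le_ESq)

theorem EOp_nonneg : 0 ≤ EOp kF s V k := CFC.sqrt_nonneg _

/-- The square root is operator monotone and 2P_w ≥ 0. -/
theorem hOp_le_EOp : hOp kF k ≤ EOp kF s V k := by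
  rw [← CFC.sqrt_sq (hOp kF k) hOp_nonneg]
  exact CFC.sqrt_le_sqrt _ _ hOp_sq_le_ESq

theorem EOp_isPositive : (EOp kF s V k).IsPositive :=
  (ContinuousLinearMap.nonneg_iff_isPositive _).1 EOp_nonneg

theorem ESq_apply (φ : LuneSpace kF k) (p : lune kF k) :
    ESq s V kF k φ p = lam k p ^ 2 * φ p + 2 * inner ℂ (wVec s V kF k) φ * wVec s V kF k p := by
  have h : ESq s V kF k φ =
      (hOp kF k ^ 2) φ + (2 : ℂ) • ((inner ℂ (wVec s V kF k) φ : ℂ) • wVec s V kF k) := rfl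
  rw [h, PiLp.add_apply, PiLp.smul_apply, PiLp.smul_apply, hOp_pow_apply, smul_eq_mul,
    smul_eq_mul, mul_assoc]

/-- This is ⟨φ, Ẽ²φ⟩, so the square root need not be known explicitly. -/
theorem norm_sq_EOp (φ : LuneSpace kF k) :
    ‖EOp kF s V k φ‖ ^ 2 = ‖hOp kF k φ‖ ^ 2 + 2 * ‖(inner ℂ (wVec s V kF k) φ : ℂ)‖ ^ 2 := by
  have h1 : (inner ℂ φ (ESq s V kF k φ) : ℂ) = ((‖EOp kF s V k φ‖ ^ 2 : ℝ) : ℂ) := by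
    rw [← EOp_mul_self, mul_apply_eq_comp, ← EOp_isPositive.inner_left_eq_inner_right,
      inner_self_eq_norm_sq_to_K]
    simp
  have h2 : (inner ℂ φ ((hOp kF k ^ 2) φ) : ℂ) = ((‖hOp kF k φ‖ ^ 2 : ℝ) : ℂ) := by
    rw [pow_two, mul_apply_eq_comp, ← ((ContinuousLinearMap.nonneg_iff_isPositive _).1
      hOp_nonneg).inner_left_eq_inner_right, inner_self_eq_norm_sq_to_K]
    simp
  have h : ESq s V kF k φ =
      (hOp kF k ^ 2) φ + (2 : ℂ) • ((inner ℂ (wVec s V kF k) φ : ℂ) • wVec s V kF k) := rfl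
  rw [h, inner_add_right, inner_smul_right, inner_smul_right, h2,
    ← inner_conj_symm φ (wVec s V kF k), Complex.mul_conj, Complex.normSq_eq_norm_sq] at h1
  exact_mod_cast h1.symm

/-! ### The excitation part `Ẽ_k - h_k` -/

/-- `Ẽ_k - h_k`. -/
def DOp (kF : ℝ) (s : ℕ) (V : Momentum → ℝ) (k : Momentum) :
    LuneSpace kF k →L[ℂ] LuneSpace kF k := EOp kF s V k - hOp kF k

theorem DOp_nonneg : 0 ≤ DOp kF s V k := sub_nonneg.2 hOp_le_EOp

/-- Insert Ẽ = h + D into the formula for ‖Ẽe_p‖² and cancel λ_p². Both terms on the left are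
nonnegative, so one identity bounds the column norm and the diagonal entry of D. -/
theorem norm_sq_DOp_single (hV : 0 ≤ V k) (p : lune kF k) :
    ‖DOp kF s V k (EuclideanSpace.single p 1)‖ ^ 2 +
      2 * lam k p * (DOp kF s V k (EuclideanSpace.single p 1) p).re =
        2 * coupling s V k * lam k p := by
  set e : LuneSpace kF k := EuclideanSpace.single p 1 with he
  have h1 : EOp kF s V k e = DOp kF s V k e + (lam k p : ℂ) • e := by
    rw [DOp, sub_apply, hOp_single, sub_add_cancel]
  have h2 := norm_sq_EOp (s := s) (V := V) e
  rw [h1, hOp_single, norm_add_sq (𝕜 := ℂ), inner_smul_right] at h2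
  have h3 : ‖(inner ℂ (wVec s V kF k) e : ℂ)‖ ^ 2 = coupling s V k * lam k p := by
    rw [← norm_sq_wVec_apply hV, he, EuclideanSpace.inner_single_right]
    simp
  have h4 : (inner ℂ (DOp kF s V k e) e : ℂ) = (starRingEnd ℂ) (DOp kF s V k e p) := by
    rw [he, EuclideanSpace.inner_single_right, one_mul]
  rw [h3, h4] at h2
  have h5 : RCLike.re ((lam k p : ℂ) * (starRingEnd ℂ) (DOp kF s V k e p)) =
      lam k p * (DOp kF s V k e p).re := by
    simp
  rw [h5] at h2
  linarith

theorem DOp_diag_nonneg (p : lune kF k) :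
    0 ≤ (DOp kF s V k (EuclideanSpace.single p 1) p).re := by
  have h := ((ContinuousLinearMap.nonneg_iff_isPositive _).1
    (DOp_nonneg (kF := kF) (k := k) (s := s) (V := V))).re_inner_nonneg_right
      (EuclideanSpace.single p 1)
  rwa [EuclideanSpace.inner_single_left, map_one, one_mul] at h

theorem norm_sq_DOp_single_le (hV : 0 ≤ V k) (p : lune kF k) :
    ‖DOp kF s V k (EuclideanSpace.single p 1)‖ ^ 2 ≤ 2 * coupling s V k * lam k p := by
  have h1 := norm_sq_DOp_single (s := s) hV p
  have h2 := mul_nonneg (lam_pos p.2).le (DOp_diag_nonneg (s := s) (V := V) p)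
  linarith

theorem DOp_diag_le (hV : 0 ≤ V k) (p : lune kF k) :
    (DOp kF s V k (EuclideanSpace.single p 1) p).re ≤ coupling s V k := by
  have h1 := norm_sq_DOp_single (s := s) hV p
  have h2 := lam_pos p.2
  have h3 := sq_nonneg ‖DOp kF s V k (EuclideanSpace.single p 1)‖
  nlinarith

/-- D is positive, hence its entries are Gram products of the vectors √D e_p, and Cauchy–Schwarz
bounds each by the diagonal entries. -/
theorem norm_sq_DOp_entry_le (hV : 0 ≤ V k) (p q : lune kF k) :
    ‖DOp kF s V k (EuclideanSpace.single p 1) q‖ ^ 2 ≤ coupling s V k ^ 2 := by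
  set S := CFC.sqrt (DOp kF s V k) with hS
  have hSS : S * S = DOp kF s V k := CFC.sqrt_mul_sqrt_self _ DOp_nonneg
  have hpos : S.IsPositive :=
    (ContinuousLinearMap.nonneg_iff_isPositive _).1 (CFC.sqrt_nonneg _)
  have h1 : ∀ p q : lune kF k, DOp kF s V k (EuclideanSpace.single p 1) q =
      inner ℂ (S (EuclideanSpace.single q 1)) (S (EuclideanSpace.single p 1)) := by
    intro p q
    rw [hpos.inner_left_eq_inner_right, ← mul_apply_eq_comp, hSS, EuclideanSpace.inner_single_left,
      map_one, one_mul]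
  have h2 : ∀ p : lune kF k, ‖S (EuclideanSpace.single p 1)‖ ^ 2 ≤ coupling s V k := by
    intro p
    have h3 := DOp_diag_le (s := s) hV p
    rw [h1, inner_self_eq_norm_sq_to_K] at h3
    exact_mod_cast h3
  rw [h1]
  calc _ ≤ (‖S (EuclideanSpace.single q 1)‖ * ‖S (EuclideanSpace.single p 1)‖) ^ 2 := by
        gcongr; exact norm_inner_le_norm _ _
    _ = ‖S (EuclideanSpace.single q 1)‖ ^ 2 * ‖S (EuclideanSpace.single p 1)‖ ^ 2 := by ring
    _ ≤ coupling s V k * coupling s V k :=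
        mul_le_mul (h2 q) (h2 p) (sq_nonneg _) (coupling_nonneg hV)
    _ = _ := by ring

/-- The squared Hilbert–Schmidt norm of `Ẽ_k - h_k`. -/
def hsNormSq (kF : ℝ) (s : ℕ) (V : Momentum → ℝ) (k : Momentum) : ℝ :=
  ∑ p : lune kF k, ∑ q : lune kF k, ‖DOp kF s V k (EuclideanSpace.single p 1) q‖ ^ 2

theorem hsNormSq_le_sum_lam (hV : 0 ≤ V k) :
    hsNormSq kF s V k ≤ 2 * coupling s V k * ∑ p ∈ lune kF k, lam k p := by
  rw [hsNormSq, ← Finset.sum_coe_sort (lune kF k), Finset.mul_sum]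
  refine Finset.sum_le_sum fun p _ => ?_
  rw [← EuclideanSpace.norm_sq_eq]
  exact norm_sq_DOp_single_le hV p

theorem hsNormSq_le_card (hV : 0 ≤ V k) :
    hsNormSq kF s V k ≤ (coupling s V k * (lune kF k).card) ^ 2 := by
  calc hsNormSq kF s V k ≤ ∑ _p : lune kF k, ∑ _q : lune kF k, coupling s V k ^ 2 :=
        Finset.sum_le_sum fun p _ => Finset.sum_le_sum fun q _ => norm_sq_DOp_entry_le hV p q
    _ = _ := by
        simp only [Finset.sum_const, Finset.card_univ, Fintype.card_coe, nsmul_eq_mul]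
        ring

end OneBody

/-! ### The greatest eigenvalue of `2 Ẽ_k` -/

section Spectrum

variable {kF : ℝ} {k : Momentum} {s : ℕ} {V : Momentum → ℝ}

theorem exists_eigenbasis_EOp (kF : ℝ) (s : ℕ) (V : Momentum → ℝ) (k : Momentum) :
    ∃ (n : ℕ) (b : OrthonormalBasis (Fin n) ℂ (LuneSpace kF k)) (μ : Fin n → ℝ),
      n = (lune kF k).card ∧ (∀ i, 0 ≤ μ i) ∧ ∀ i, EOp kF s V k (b i) = (μ i : ℂ) • b i := by
  have hT := (EOp_isPositive (kF := kF) (s := s) (V := V) (k := k)).isSymmetric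
  have hn : Module.finrank ℂ (LuneSpace kF k) = (lune kF k).card := by simp
  exact ⟨_, hT.eigenvectorBasis hn, hT.eigenvalues hn, rfl,
    (EOp_isPositive (kF := kF) (s := s) (V := V) (k := k)).toLinearMap.nonneg_eigenvalues hn,
    fun i => hT.apply_eigenvectorBasis hn i⟩

theorem plasmonSpectrum_eq_range {n : ℕ} {b : OrthonormalBasis (Fin n) ℂ (LuneSpace kF k)}
    {μ : Fin n → ℝ} (h : ∀ i, EOp kF s V k (b i) = (μ i : ℂ) • b i) :
    plasmonSpectrum kF s V k = Set.range fun i => 2 * μ i := by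
  ext x
  constructor
  · rintro ⟨φ, hφ, hx⟩
    obtain ⟨i, hi⟩ : ∃ i, (inner ℂ (b i) φ : ℂ) ≠ 0 := by
      by_contra hc
      push Not at hc
      exact hφ (by rw [← b.sum_repr' φ]; simp [hc])
    refine ⟨i, ?_⟩
    have h1 := congrArg (fun ψ => (inner ℂ (b i) ψ : ℂ)) hx
    simp only [inner_smul_right] at h1
    rw [← EOp_isPositive.inner_left_eq_inner_right, h, inner_smul_left, Complex.conj_ofReal,
      ← mul_assoc] at h1
    have h2 := mul_right_cancel₀ hi h1
    change 2 * μ i = x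
    exact_mod_cast h2
  · rintro ⟨i, rfl⟩
    refine ⟨b i, b.orthonormal.ne_zero i, ?_⟩
    rw [h, smul_smul]
    push_cast
    rfl

theorem isGreatest_plasmonEnergy (s : ℕ) (V : Momentum → ℝ) (hne : (lune kF k).Nonempty) :
    IsGreatest (plasmonSpectrum kF s V k) (plasmonEnergy kF s V k) := by
  obtain ⟨n, b, μ, hn, -, h⟩ := exists_eigenbasis_EOp kF s V k
  have hfin : (plasmonSpectrum kF s V k).Finite := by
    rw [plasmonSpectrum_eq_range h]; exact Set.finite_range _
  have : Nonempty (Fin n) := ⟨⟨0, by rw [hn]; exact hne.card_pos⟩⟩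
  have hnon : (plasmonSpectrum kF s V k).Nonempty := by
    rw [plasmonSpectrum_eq_range h]; exact Set.range_nonempty _
  exact ⟨hnon.csSup_mem hfin, fun x hx => le_csSup hfin.bddAbove hx⟩

theorem norm_sq_EOp_le (hne : (lune kF k).Nonempty) (ψ : LuneSpace kF k) :
    ‖EOp kF s V k ψ‖ ^ 2 ≤ (plasmonEnergy kF s V k / 2) ^ 2 * ‖ψ‖ ^ 2 := by
  obtain ⟨n, b, μ, hn, hμ, h⟩ := exists_eigenbasis_EOp kF s V k
  have hmax := (isGreatest_plasmonEnergy s V hne).2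
  rw [plasmonSpectrum_eq_range h] at hmax
  rw [← b.sum_sq_norm_inner_right, ← b.sum_sq_norm_inner_right ψ, Finset.mul_sum]
  refine Finset.sum_le_sum fun i _ => ?_
  rw [← EOp_isPositive.inner_left_eq_inner_right, h, inner_smul_left, Complex.conj_ofReal,
    norm_mul, Complex.norm_real, Real.norm_eq_abs, mul_pow, sq_abs]
  have h1 : 2 * μ i ≤ plasmonEnergy kF s V k := hmax ⟨i, rfl⟩
  have h2 := hμ i
  gcongr
  linarith

theorem plasmonEnergy_nonneg (hne : (lune kF k).Nonempty) : 0 ≤ plasmonEnergy kF s V k := by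
  obtain ⟨n, b, μ, hn, hμ, h⟩ := exists_eigenbasis_EOp kF s V k
  have hmem := (isGreatest_plasmonEnergy s V hne).1
  rw [plasmonSpectrum_eq_range h] at hmem
  obtain ⟨i, hi⟩ := hmem
  have := hμ i
  rw [← hi]
  simp only
  linarith

theorem sum_lam_pos (hne : (lune kF k).Nonempty) : 0 < ∑ p ∈ lune kF k, lam k p :=
  Finset.sum_pos (fun _ hp => lam_pos hp) hne

/-- The quantity `2⟨v, h v⟩ + ⟨v, h³ v⟩ / ⟨v, h v⟩`. -/
def energyLower (kF : ℝ) (s : ℕ) (V : Momentum → ℝ) (k : Momentum) : ℝ :=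
  2 * (coupling s V k * ∑ p ∈ lune kF k, lam k p) +
    (∑ p ∈ lune kF k, lam k p ^ 3) / ∑ p ∈ lune kF k, lam k p

/-- The Rayleigh quotient of Ẽ² at the test vector w. -/
theorem energyLower_le (hne : (lune kF k).Nonempty) (hc : 0 < coupling s V k) (hV : 0 ≤ V k) :
    energyLower kF s V k ≤ (plasmonEnergy kF s V k / 2) ^ 2 := by
  have h1 := norm_sq_EOp_le (s := s) (V := V) hne (wVec s V kF k)
  have h2 : ‖hOp kF k (wVec s V kF k)‖ ^ 2 =
      coupling s V k * ∑ p ∈ lune kF k, lam k p ^ 3 := by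
    rw [EuclideanSpace.norm_sq_eq, ← Finset.sum_coe_sort (lune kF k), Finset.mul_sum]
    refine Finset.sum_congr rfl fun p _ => ?_
    rw [hOp_apply, norm_mul, mul_pow, norm_sq_wVec_apply hV, Complex.norm_real,
      Real.norm_eq_abs, sq_abs]
    ring
  have h3 : ‖(inner ℂ (wVec s V kF k) (wVec s V kF k) : ℂ)‖ = ‖wVec s V kF k‖ ^ 2 := by
    rw [inner_self_eq_norm_sq_to_K]; simp
  rw [norm_sq_EOp, h2, h3, norm_sq_wVec hV] at h1
  have hm := sum_lam_pos hne
  set m := ∑ p ∈ lune kF k, lam k p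
  set m3 := ∑ p ∈ lune kF k, lam k p ^ 3
  set κ := coupling s V k
  set T := (plasmonEnergy kF s V k / 2) ^ 2
  rw [energyLower, ← le_sub_iff_add_le', div_le_iff₀ hm]
  have h4 : κ * (m3 + 2 * κ * m * m) ≤ κ * (T * m) := by nlinarith
  have h5 := le_of_mul_le_mul_left h4 hc
  linarith

/-- An eigenvector for the greatest eigenvalue, in components. -/
theorem eigenvector_apply {φ : LuneSpace kF k}
    (hφ : (2 : ℂ) • EOp kF s V k φ = (plasmonEnergy kF s V k : ℂ) • φ) (p : lune kF k) :
    (((plasmonEnergy kF s V k / 2) ^ 2 - lam k p ^ 2 : ℝ) : ℂ) * φ p =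
      2 * inner ℂ (wVec s V kF k) φ * wVec s V kF k p := by
  have h1 : EOp kF s V k φ = ((plasmonEnergy kF s V k / 2 : ℝ) : ℂ) • φ := by
    have h := congrArg (fun ψ => (2 : ℂ)⁻¹ • ψ) hφ
    simp only [smul_smul] at h
    rw [inv_mul_cancel₀ two_ne_zero, one_smul] at h
    rw [h]
    congr 1
    push_cast
    ring
  have h2 : ESq s V kF k φ = (((plasmonEnergy kF s V k / 2) ^ 2 : ℝ) : ℂ) • φ := by
    rw [← EOp_mul_self, mul_apply_eq_comp, h1, map_smul, h1, smul_smul]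
    congr 1
    push_cast
    ring
  have h3 := ESq_apply (s := s) (V := V) φ p
  rw [h2, PiLp.smul_apply, smul_eq_mul] at h3
  push_cast at h3 ⊢
  linear_combination h3

variable {B : ℝ}

theorem mode_bound {T m l x C κ : ℝ} (hT : 0 < T) (hm : 0 < m) (hl : 0 < l)
    (hlT : l ^ 2 ≤ T / 2) (hx : 0 ≤ x) (h : (T - l ^ 2) ^ 2 * x = 4 * C * (κ * l))
    (hsum : 4 * C * (κ * m) ≤ T ^ 2) : x * m ≤ 4 * l := by
  have h3 : (T / 2) ^ 2 ≤ (T - l ^ 2) ^ 2 := by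
    apply pow_le_pow_left₀ <;> linarith
  have h4 : (T / 2) ^ 2 * x ≤ 4 * C * (κ * l) := h ▸ mul_le_mul_of_nonneg_right h3 hx
  have h5 : T ^ 2 * (x * m) ≤ T ^ 2 * (4 * l) := by
    calc T ^ 2 * (x * m) = 4 * m * ((T / 2) ^ 2 * x) := by ring
      _ ≤ 4 * m * (4 * C * (κ * l)) := by gcongr
      _ = 4 * l * (4 * C * (κ * m)) := by ring
      _ ≤ 4 * l * T ^ 2 := by gcongr
      _ = _ := by ring
  exact le_of_mul_le_mul_left h5 (by positivity)

/-- |φ_p|² is proportional to λ_p/(T − λ_p²)². Under the gap condition T − λ_p² lies between T/2 and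
T, so normalization gives |φ_p|² ≤ 4λ_p/m; the overlap with w drops out. -/
theorem norm_sq_mode_le (hne : (lune kF k).Nonempty) (hc : 0 < coupling s V k) (hV : 0 ≤ V k)
    (hB : ∀ p ∈ lune kF k, lam k p ≤ B)
    (hgap : B ^ 2 ≤ coupling s V k * ∑ p ∈ lune kF k, lam k p)
    {φ : LuneSpace kF k} (hφ : IsPlasmonMode kF s V k φ) (p : lune kF k) :
    ‖φ p‖ ^ 2 ≤ 4 * B / ∑ p ∈ lune kF k, lam k p := by
  have hm := sum_lam_pos hne
  have hlow := energyLower_le hne hc hV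
  have happ := eigenvector_apply hφ.2
  have hm3 : 0 ≤ (∑ p ∈ lune kF k, lam k p ^ 3) / ∑ p ∈ lune kF k, lam k p :=
    div_nonneg (Finset.sum_nonneg fun p hp => pow_nonneg (lam_pos hp).le 3) hm.le
  rw [energyLower] at hlow
  have hwn := norm_sq_wVec (kF := kF) (s := s) hV
  have hwp := norm_sq_wVec_apply (kF := kF) (s := s) hV
  set c : ℂ := inner ℂ (wVec s V kF k) φ
  set m := ∑ p ∈ lune kF k, lam k p
  set T := (plasmonEnergy kF s V k / 2) ^ 2
  set κ := coupling s V k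
  have hT : 0 < T := by nlinarith [mul_pos hc hm]
  have hl2 : ∀ p : lune kF k, lam k p ^ 2 ≤ T / 2 := by
    intro p
    have h1 := pow_le_pow_left₀ (lam_pos p.2).le (hB p p.2) 2
    linarith
  have hsq : ∀ p : lune kF k, (T - lam k p ^ 2) ^ 2 * ‖φ p‖ ^ 2 =
      4 * ‖c‖ ^ 2 * (κ * lam k p) := by
    intro p
    have h := congrArg (fun z => ‖z‖ ^ 2) (happ p)
    simp only [norm_mul, mul_pow, Complex.norm_real, Real.norm_eq_abs, sq_abs] at h
    rw [hwp] at h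
    rw [h]
    norm_num
  have hsum : 4 * ‖c‖ ^ 2 * (κ * m) ≤ T ^ 2 := by
    have h1 : ‖φ‖ ^ 2 = 1 := by rw [hφ.1, one_pow]
    rw [EuclideanSpace.norm_sq_eq] at h1
    have h2 : (∑ p : lune kF k, lam k p) = m := Finset.sum_coe_sort (lune kF k) _
    rw [← mul_one (T ^ 2), ← h1, ← h2, Finset.mul_sum, Finset.mul_sum, Finset.mul_sum]
    refine Finset.sum_le_sum fun p _ => ?_
    rw [← hsq p]
    have h3 := hl2 p
    have h4 : (T - lam k p ^ 2) ^ 2 ≤ T ^ 2 := by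
      apply pow_le_pow_left₀ <;> nlinarith [sq_nonneg (lam k p)]
    exact mul_le_mul_of_nonneg_right h4 (sq_nonneg _)
  have h6 := mode_bound hT hm (lam_pos p.2) (hl2 p) (sq_nonneg _) (hsq p) hsum
  rw [le_div_iff₀ hm]
  have h7 := hB p p.2
  linarith

/-- The geometric series with its tail absorbed into twice the quadratic term; after clearing T − u
the surplus is u²(T − 2u)/T² ≥ 0. -/
theorem inv_sub_le {T u : ℝ} (hT : 0 < T) (huT : u ≤ T / 2) :
    T / (T - u) ≤ 1 + u / T + 2 * u ^ 2 / T ^ 2 := by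
  rw [div_le_iff₀ (by linarith)]
  have h1 : (1 + u / T + 2 * u ^ 2 / T ^ 2) * (T - u) = T + u ^ 2 * (T - 2 * u) / T ^ 2 := by
    field_simp
    ring
  rw [h1]
  have : 0 ≤ u ^ 2 * (T - 2 * u) / T ^ 2 := by
    have : 0 ≤ T - 2 * u := by linarith
    positivity
  linarith

/-- Expand the secular equation in λ²/T: the first two orders are bounded by `energyLower`, and the
remainder by the right-hand side. -/
theorem sq_sub_energyLower_le (hne : (lune kF k).Nonempty) (hc : 0 < coupling s V k)
    (hV : 0 ≤ V k) (hB : ∀ p ∈ lune kF k, lam k p ≤ B)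
    (hgap : B ^ 2 ≤ coupling s V k * ∑ p ∈ lune kF k, lam k p) :
    (plasmonEnergy kF s V k / 2) ^ 2 - energyLower kF s V k ≤
      B ^ 4 / (coupling s V k * ∑ p ∈ lune kF k, lam k p) := by
  have hm := sum_lam_pos hne
  have hlow := energyLower_le hne hc hV
  obtain ⟨φ, hφ0, hφ⟩ := (isGreatest_plasmonEnergy (kF := kF) (k := k) s V hne).1
  have happ := eigenvector_apply hφ
  have hm3 : 0 ≤ (∑ p ∈ lune kF k, lam k p ^ 3) / ∑ p ∈ lune kF k, lam k p :=
    div_nonneg (Finset.sum_nonneg fun p hp => pow_nonneg (lam_pos hp).le 3) hm.le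
  have hwp := wVec_apply (kF := kF) (k := k) (s := s) (V := V)
  rw [energyLower] at hlow ⊢
  set m := ∑ p ∈ lune kF k, lam k p with hmdef
  set m3 := ∑ p ∈ lune kF k, lam k p ^ 3 with hm3def
  set T := (plasmonEnergy kF s V k / 2) ^ 2
  set κ := coupling s V k with hκ
  have hκm : 0 < κ * m := mul_pos hc hm
  have hT : 0 < T := by nlinarith
  have hl2 : ∀ p ∈ lune kF k, lam k p ^ 2 ≤ T / 2 := by
    intro p hp
    have h1 := pow_le_pow_left₀ (lam_pos hp).le (hB p hp) 2
    linarith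
  obtain ⟨c, hcdef⟩ : ∃ c : ℂ, c = inner ℂ (wVec s V kF k) φ := ⟨_, rfl⟩
  have hφp : ∀ p : lune kF k,
      φ p = 2 * c * ((√(lam k p) * √κ / (T - lam k p ^ 2) : ℝ) : ℂ) := by
    intro p
    have h1 := happ p
    rw [hwp p, ← hcdef] at h1
    have h2 : T - lam k p ^ 2 ≠ 0 := by have := hl2 p p.2; intro h; linarith
    rw [Complex.ofReal_div, mul_div_assoc', eq_div_iff (Complex.ofReal_ne_zero.2 h2), mul_comm, h1]
  -- An eigenvector orthogonal to w would vanish, as T exceeds every λ_p².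
  have hc0 : c ≠ 0 := by
    rintro rfl
    apply hφ0
    ext p
    rw [hφp p]
    simp
  -- The secular equation: take the inner product of the component formula with w and divide by c.
  have hsec : (1 : ℝ) = 2 * ∑ p ∈ lune kF k, κ * lam k p / (T - lam k p ^ 2) := by
    have h1 : c = c * ((2 * ∑ p ∈ lune kF k, κ * lam k p / (T - lam k p ^ 2) : ℝ) : ℂ) := by
      conv_lhs => rw [hcdef]
      rw [PiLp.inner_apply, ← Finset.sum_coe_sort (lune kF k), Finset.mul_sum, Complex.ofReal_sum,
        Finset.mul_sum]
      refine Finset.sum_congr rfl fun p _ => ?_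
      rw [RCLike.inner_apply, hwp p, hφp p, Complex.conj_ofReal, mul_assoc, ← Complex.ofReal_mul,
        mul_comm (2 : ℂ), mul_assoc]
      congr 1
      rw [← Complex.ofReal_ofNat, ← Complex.ofReal_mul]
      refine congrArg _ ?_
      have h2 := Real.mul_self_sqrt (lam_pos p.2).le
      have h3 := Real.mul_self_sqrt hc.le
      calc 2 * (√(lam k p) * √κ / (T - lam k p ^ 2) * (√(lam k p) * √κ))
          = 2 * ((√κ * √κ) * (√(lam k p) * √(lam k p)) / (T - lam k p ^ 2)) := by ring
        _ = _ := by rw [h2, h3]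
    have h2 : c * 1 = c * ((2 * ∑ p ∈ lune kF k, κ * lam k p / (T - lam k p ^ 2) : ℝ) : ℂ) := by
      rw [mul_one]; exact h1
    exact_mod_cast mul_left_cancel₀ hc0 h2
  have hupper : T ≤ 2 * (κ * m) + 2 * κ * m3 / T + 4 * κ * (B ^ 4 * m) / T ^ 2 := by
    calc T = 2 * ∑ p ∈ lune kF k, κ * lam k p * (T / (T - lam k p ^ 2)) := by
          conv_lhs => rw [← mul_one T, hsec]
          rw [mul_left_comm, Finset.mul_sum]
          congr 1
          refine Finset.sum_congr rfl fun p _ => ?_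
          ring
      _ ≤ 2 * ∑ p ∈ lune kF k, κ * lam k p *
            (1 + lam k p ^ 2 / T + 2 * B ^ 4 / T ^ 2) := by
          gcongr with p hp
          · exact mul_nonneg hc.le (lam_pos hp).le
          · refine (inv_sub_le hT (hl2 p hp)).trans ?_
            have h1 := pow_le_pow_left₀ (lam_pos hp).le (hB p hp) 4
            rw [← pow_mul]
            gcongr
      _ = _ := by
          rw [hmdef, hm3def]
          simp only [Finset.mul_sum, Finset.sum_div, ← Finset.sum_add_distrib]
          refine Finset.sum_congr rfl fun p _ => ?_
          ring
  have hT2 : 2 * (κ * m) ≤ T := by linarith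
  have hm3' : 0 ≤ m3 := Finset.sum_nonneg fun p hp => pow_nonneg (lam_pos hp).le 3
  -- The lower bound T ≥ 2κm is fed back into the denominators of the expansion, here and in the
  -- remainder.
  have h1 : 2 * κ * m3 / T ≤ m3 / m := by
    rw [div_le_div_iff₀ hT hm]
    nlinarith
  have h2 : 4 * κ * (B ^ 4 * m) / T ^ 2 ≤ B ^ 4 / (κ * m) := by
    rw [div_le_div_iff₀ (by positivity) hκm]
    have h3 : (2 * (κ * m)) ^ 2 ≤ T ^ 2 := pow_le_pow_left₀ (by positivity) hT2 2
    calc 4 * κ * (B ^ 4 * m) * (κ * m) = B ^ 4 * (2 * (κ * m)) ^ 2 := by ring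
      _ ≤ B ^ 4 * T ^ 2 := by
        have : 0 ≤ B ^ 4 := by positivity
        gcongr
  linarith

end Spectrum

/-! ### Lattice sums -/

section Lattice

theorem sqLen_eq (p : Momentum) : sqLen p = (p 0 : ℝ) ^ 2 + (p 1 : ℝ) ^ 2 + (p 2 : ℝ) ^ 2 := by
  rw [sqLen, Fin.sum_univ_three]

theorem sqLen_neg (p : Momentum) : sqLen (-p) = sqLen p := by simp [sqLen]

theorem len_neg (p : Momentum) : len (-p) = len p := by rw [len, sqLen_neg, len]

theorem one_le_sqLen {p : Momentum} (hp : p ≠ 0) : 1 ≤ sqLen p := by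
  obtain ⟨i, hi⟩ := Function.ne_iff.1 hp
  have h1 : (1 : ℝ) ≤ (p i : ℝ) ^ 2 := by
    have : (1 : ℤ) ≤ p i ^ 2 :=
      Int.one_le_abs (pow_ne_zero 2 hi) |>.trans_eq (abs_of_nonneg (sq_nonneg _))
    exact_mod_cast this
  exact h1.trans (Finset.single_le_sum (f := fun i => (p i : ℝ) ^ 2) (fun j _ => sq_nonneg _)
    (Finset.mem_univ i))

theorem one_le_len {p : Momentum} (hp : p ≠ 0) : 1 ≤ len p :=
  Real.one_le_sqrt.2 (one_le_sqLen hp)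

/-- The Euclidean inner product. -/
def dot (p q : Momentum) : ℝ := (p 0 : ℝ) * q 0 + (p 1 : ℝ) * q 1 + (p 2 : ℝ) * q 2

theorem lam_eq (k p : Momentum) : lam k p = dot p k - sqLen k / 2 := by
  rw [lam, sqLen_eq, sqLen_eq, sqLen_eq, dot]
  simp only [Pi.sub_apply]
  push_cast
  ring

theorem dot_le (p k : Momentum) : dot p k ≤ len p * len k := by
  rw [len, len, ← Real.sqrt_mul (sqLen_nonneg p)]
  refine Real.le_sqrt_of_sq_le ?_
  rw [sqLen_eq, sqLen_eq, dot]
  nlinarith [sq_nonneg ((p 0 : ℝ) * k 1 - p 1 * k 0), sq_nonneg ((p 0 : ℝ) * k 2 - p 2 * k 0),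
    sq_nonneg ((p 1 : ℝ) * k 2 - p 2 * k 1)]

theorem lam_le {kF : ℝ} {k p : Momentum} (hk : len k ≤ kF) (hp : p ∈ lune kF k) :
    lam k p ≤ 3 / 2 * (kF * len k) := by
  have h1 := dot_le (p - k) k
  have h2 : lam k p = dot (p - k) k + sqLen k / 2 := by
    rw [lam_eq, sqLen_eq, dot, dot]
    simp only [Pi.sub_apply]
    push_cast
    ring
  have h3 := (mem_lune.1 hp).1
  have h4 := len_nonneg k
  rw [h2, ← len_sq]
  nlinarith

theorem neg_mem_fermiBall {kF : ℝ} {q : Momentum} : -q ∈ fermiBall kF ↔ q ∈ fermiBall kF := by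
  rw [mem_fermiBall, mem_fermiBall, len_neg]

theorem sum_fermiBall_odd (kF : ℝ) (f : Momentum → ℝ) (hf : ∀ q, f (-q) = -f q) :
    ∑ q ∈ fermiBall kF, f q = 0 := by
  have h : ∑ q ∈ fermiBall kF, f q = ∑ q ∈ fermiBall kF, f (-q) :=
    Finset.sum_nbij' (fun q => -q) (fun q => -q) (fun q hq => neg_mem_fermiBall.2 hq)
      (fun q hq => neg_mem_fermiBall.2 hq) (fun q _ => neg_neg q) (fun q _ => neg_neg q)
      (fun q _ => by rw [neg_neg])
  simp only [hf, Finset.sum_neg_distrib] at h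
  linarith

/-- Odd functions of `λ_{k,p}` sum over the lune as over the shifted Fermi ball. -/
theorem sum_lune_odd (kF : ℝ) (k : Momentum) (f : ℝ → ℝ) (hf : ∀ x, f (-x) = -f x) :
    ∑ p ∈ lune kF k, f (lam k p) = ∑ q ∈ fermiBall kF, f (dot q k + sqLen k / 2) := by
  set S := (fermiBall kF).image (fun q => q + k) with hS
  have hmem : ∀ p, p ∈ S ↔ len (p - k) ≤ kF := by
    intro p
    rw [hS, Finset.mem_image]
    constructor
    · rintro ⟨q, hq, rfl⟩
      simpa using mem_fermiBall.1 hq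
    · exact fun h => ⟨p - k, mem_fermiBall.2 h, sub_add_cancel p k⟩
  -- The inversion p ↦ k − p exchanges |p| and |p − k|: it preserves the intersection of the two
  -- balls and changes the sign of λ.
  have h1 : ∑ p ∈ S ∩ fermiBall kF, f (lam k p) = 0 := by
    have hinv : ∀ p ∈ S ∩ fermiBall kF, k - p ∈ S ∩ fermiBall kF := by
      intro p hp
      rw [Finset.mem_inter, hmem, mem_fermiBall] at hp ⊢
      rw [sub_sub_cancel_left, len_neg, ← neg_sub, len_neg]
      exact hp.symm
    have h : ∑ p ∈ S ∩ fermiBall kF, f (lam k p) = ∑ p ∈ S ∩ fermiBall kF, f (lam k (k - p)) :=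
      Finset.sum_nbij' (fun p => k - p) (fun p => k - p) hinv hinv (fun p _ => sub_sub_cancel k p)
        (fun p _ => sub_sub_cancel k p) (fun p _ => by rw [sub_sub_cancel])
    have h' : ∀ p, lam k (k - p) = -lam k p := by
      intro p
      rw [lam, lam, sub_sub_cancel_left, sqLen_neg, ← neg_sub p k, sqLen_neg]
      ring
    simp only [h', hf, Finset.sum_neg_distrib] at h
    linarith
  have h2 := Finset.sum_inter_add_sum_sdiff S (fermiBall kF) (fun p => f (lam k p))
  rw [add_comm] at h2
  have h3 : lune kF k = S \ fermiBall kF := rfl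
  rw [h3, ← add_zero (∑ p ∈ S \ fermiBall kF, _), ← h1, h2, hS,
    Finset.sum_image fun a _ b _ h => add_right_cancel h]
  refine Finset.sum_congr rfl fun q _ => ?_
  congr 1
  rw [lam_eq, dot, dot, sqLen_eq]
  simp only [Pi.add_apply]
  push_cast
  ring

theorem sum_lam (kF : ℝ) (k : Momentum) :
    ∑ p ∈ lune kF k, lam k p = sqLen k / 2 * (fermiBall kF).card := by
  rw [sum_lune_odd kF k (fun x => x) (fun x => rfl), Finset.sum_add_distrib,
    sum_fermiBall_odd kF (fun q => dot q k), Finset.sum_const, nsmul_eq_mul]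
  · ring
  · intro q; simp only [dot, Pi.neg_apply]; push_cast; ring

/-- The second moment of the Fermi ball. -/
def secondMoment (kF : ℝ) : ℝ := ∑ q ∈ fermiBall kF, sqLen q

theorem sum_fermiBall_comp (kF : ℝ) (σ : Momentum → Momentum) (hσ : Function.Involutive σ)
    (hlen : ∀ q, sqLen (σ q) = sqLen q) (f : Momentum → ℝ) :
    ∑ q ∈ fermiBall kF, f q = ∑ q ∈ fermiBall kF, f (σ q) := by
  have hm : ∀ q ∈ fermiBall kF, σ q ∈ fermiBall kF := by
    intro q hq
    rw [mem_fermiBall, len] at hq ⊢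
    rwa [hlen]
  exact Finset.sum_nbij' σ σ hm hm (fun q _ => hσ q) (fun q _ => hσ q) (fun q _ => by rw [hσ])

theorem sum_fermiBall_mul (kF : ℝ) {i j : Fin 3} (hij : i ≠ j) :
    ∑ q ∈ fermiBall kF, (q i : ℝ) * q j = 0 := by
  have h := sum_fermiBall_comp kF (fun q => Function.update q i (-q i))
    (fun q => by simp) (fun q => ?_) (fun q => (q i : ℝ) * q j)
  · simp only [Function.update_self, Function.update_of_ne hij.symm, Int.cast_neg, neg_mul,
      Finset.sum_neg_distrib] at h
    linarith
  · refine Finset.sum_congr rfl fun l _ => ?_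
    by_cases hl : l = i
    · subst hl; simp
    · simp [Function.update_of_ne hl]

theorem sum_fermiBall_coord_sq (kF : ℝ) (i : Fin 3) :
    ∑ q ∈ fermiBall kF, (q i : ℝ) ^ 2 = secondMoment kF / 3 := by
  have h : ∀ j, ∑ q ∈ fermiBall kF, (q j : ℝ) ^ 2 = ∑ q ∈ fermiBall kF, (q i : ℝ) ^ 2 := by
    intro j
    rw [sum_fermiBall_comp kF (fun q => q ∘ Equiv.swap i j)]
    · simp
    · intro q
      ext l
      simp
    · intro q
      exact Equiv.sum_comp (Equiv.swap i j) (fun l => (q l : ℝ) ^ 2)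
  have h1 : secondMoment kF = ∑ j : Fin 3, ∑ q ∈ fermiBall kF, (q j : ℝ) ^ 2 := by
    rw [Finset.sum_comm]; rfl
  rw [h1]
  simp [h]

theorem sum_fermiBall_dot_sq (kF : ℝ) (k : Momentum) :
    ∑ q ∈ fermiBall kF, dot q k ^ 2 = sqLen k / 3 * secondMoment kF := by
  have h : ∀ q : Momentum, dot q k ^ 2 = (k 0 : ℝ) ^ 2 * (q 0 : ℝ) ^ 2 +
      (k 1 : ℝ) ^ 2 * (q 1 : ℝ) ^ 2 + (k 2 : ℝ) ^ 2 * (q 2 : ℝ) ^ 2 +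
      2 * k 0 * k 1 * ((q 0 : ℝ) * q 1) + 2 * k 0 * k 2 * ((q 0 : ℝ) * q 2) +
      2 * k 1 * k 2 * ((q 1 : ℝ) * q 2) := by
    intro q; rw [dot]; ring
  simp only [h, Finset.sum_add_distrib, ← Finset.mul_sum, sum_fermiBall_coord_sq]
  rw [sum_fermiBall_mul kF (by decide), sum_fermiBall_mul kF (by decide),
    sum_fermiBall_mul kF (by decide), sqLen_eq]
  ring

/-- Odd powers of q·k cancel over the ball, and cubic symmetry of the lattice turns Σ(q·k)² into
|k|²/3 times the second moment. -/
theorem sum_lam_cube (kF : ℝ) (k : Momentum) :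
    ∑ p ∈ lune kF k, lam k p ^ 3 =
      sqLen k ^ 2 / 2 * secondMoment kF + sqLen k ^ 3 / 8 * (fermiBall kF).card := by
  rw [sum_lune_odd kF k (fun x => x ^ 3) (fun x => by ring)]
  have h : ∀ q : Momentum, (dot q k + sqLen k / 2) ^ 3 = dot q k ^ 3 +
      3 * sqLen k / 2 * dot q k ^ 2 + 3 * (sqLen k / 2) ^ 2 * dot q k + (sqLen k / 2) ^ 3 := by
    intro q; ring
  have hodd : ∀ q : Momentum, dot (-q) k = -dot q k := by
    intro q; simp only [dot, Pi.neg_apply]; push_cast; ring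
  simp only [h, Finset.sum_add_distrib, ← Finset.mul_sum]
  rw [sum_fermiBall_dot_sq, sum_fermiBall_odd kF (fun q => dot q k) hodd,
    sum_fermiBall_odd kF (fun q => dot q k ^ 3) (fun q => by rw [hodd]; ring), Finset.sum_const,
    nsmul_eq_mul]
  ring

/-! ### Cardinalities -/

theorem card_cube (n : ℤ) (hn : 0 ≤ n) :
    ((Finset.Icc (fun _ => -n : Momentum) (fun _ => n)).card : ℝ) = (2 * n + 1) ^ 3 := by
  rw [Pi.card_Icc]
  simp only [Int.card_Icc, Finset.prod_const, Finset.card_univ, Fintype.card_fin]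
  push_cast
  congr 1
  have h : ((n + 1 - -n).toNat : ℤ) = 2 * n + 1 := by omega
  exact_mod_cast h

theorem abs_coord_le_floor {kF : ℝ} {p : Momentum} (hp : len p ≤ kF) (i : Fin 3) :
    -⌊kF⌋ ≤ p i ∧ p i ≤ ⌊kF⌋ := by
  have h := abs_le.1 ((abs_coord_le_len p i).trans hp)
  have h2 : p i ≤ ⌊kF⌋ := Int.le_floor.2 h.2
  have h1 : -p i ≤ ⌊kF⌋ := Int.le_floor.2 (by push_cast; linarith)
  omega

theorem card_fermiBall_le {kF : ℝ} (hkF : 1 ≤ kF) : ((fermiBall kF).card : ℝ) ≤ 27 * kF ^ 3 := by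
  have hfl : (0 : ℤ) ≤ ⌊kF⌋ := Int.floor_nonneg.2 (by linarith)
  have h1 : fermiBall kF ⊆ Finset.Icc (fun _ => -⌊kF⌋ : Momentum) (fun _ => ⌊kF⌋) := by
    intro p hp
    rw [mem_fermiBall] at hp
    exact Finset.mem_Icc.2 ⟨fun i => (abs_coord_le_floor hp i).1,
      fun i => (abs_coord_le_floor hp i).2⟩
  have h2 : ((fermiBall kF).card : ℝ) ≤ (2 * ⌊kF⌋ + 1) ^ 3 := by
    rw [← card_cube _ hfl]
    exact_mod_cast Finset.card_le_card h1
  have h3 : (2 * (⌊kF⌋ : ℝ) + 1) ≤ 3 * kF := by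
    have := Int.floor_le kF
    linarith
  have h4 : (0 : ℝ) ≤ ⌊kF⌋ := by exact_mod_cast hfl
  calc _ ≤ (2 * (⌊kF⌋ : ℝ) + 1) ^ 3 := h2
    _ ≤ (3 * kF) ^ 3 := by gcongr
    _ = _ := by ring

theorem le_card_fermiBall {kF : ℝ} (hkF : 2 ≤ kF) : kF ^ 3 / 8 ≤ ((fermiBall kF).card : ℝ) := by
  have hfl : (0 : ℤ) ≤ ⌊kF / 2⌋ := Int.floor_nonneg.2 (by linarith)
  have hfl' : (0 : ℝ) ≤ ⌊kF / 2⌋ := by exact_mod_cast hfl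
  have hfl2 : (⌊kF / 2⌋ : ℝ) ≤ kF / 2 := Int.floor_le _
  have h1 : Finset.Icc (fun _ => -⌊kF / 2⌋ : Momentum) (fun _ => ⌊kF / 2⌋) ⊆ fermiBall kF := by
    intro p hp
    obtain ⟨hp1, hp2⟩ := Finset.mem_Icc.1 hp
    have hi : ∀ i, (p i : ℝ) ^ 2 ≤ (kF / 2) ^ 2 := by
      intro i
      have h1 : (-⌊kF / 2⌋ : ℝ) ≤ p i := by exact_mod_cast hp1 i
      have h2 : (p i : ℝ) ≤ ⌊kF / 2⌋ := by exact_mod_cast hp2 i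
      exact sq_le_sq' (by linarith) (by linarith)
    rw [mem_fermiBall, len, Real.sqrt_le_left (by linarith), sqLen_eq]
    nlinarith [hi 0, hi 1, hi 2]
  have h2 : (2 * ⌊kF / 2⌋ + 1 : ℝ) ^ 3 ≤ (fermiBall kF).card := by
    rw [← card_cube _ hfl]
    exact_mod_cast Finset.card_le_card h1
  have h3 : kF / 2 ≤ 2 * ⌊kF / 2⌋ + 1 := by
    have := Int.lt_floor_add_one (kF / 2)
    linarith
  calc kF ^ 3 / 8 = (kF / 2) ^ 3 := by ring
    _ ≤ (2 * ⌊kF / 2⌋ + 1 : ℝ) ^ 3 := by gcongr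
    _ ≤ _ := h2

theorem card_lune_le_card_fermiBall (kF : ℝ) (l : Momentum) :
    (lune kF l).card ≤ (fermiBall kF).card :=
  (Finset.card_le_card Finset.sdiff_subset).trans Finset.card_image_le

/-- On the way from p to p − l − m, the intermediate point p − l is either inside the ball, so p ∈
L_l, or outside, so p − l ∈ L_m. This subadditivity reduces the count to unit vectors. -/
theorem card_lune_add_le (kF : ℝ) (l m : Momentum) :
    (lune kF (l + m)).card ≤ (lune kF l).card + (lune kF m).card := by
  have h : lune kF (l + m) ⊆ lune kF l ∪ (lune kF m).image (fun q => q + l) := by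
    intro p hp
    rw [mem_lune] at hp
    rw [Finset.mem_union, mem_lune, Finset.mem_image]
    by_cases hpl : len (p - l) ≤ kF
    · exact Or.inl ⟨hpl, hp.2⟩
    · refine Or.inr ⟨p - l, mem_lune.2 ⟨?_, not_le.1 hpl⟩, sub_add_cancel p l⟩
      rw [sub_sub]; exact hp.1
  exact (Finset.card_le_card h).trans ((Finset.card_union_le _ _).trans
    (Nat.add_le_add_left Finset.card_image_le _))

theorem card_lune_neg (kF : ℝ) (l : Momentum) : (lune kF (-l)).card = (lune kF l).card := by
  refine Finset.card_nbij' (fun p => -p) (fun p => -p) ?_ ?_ (fun p _ => neg_neg p)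
    (fun p _ => neg_neg p)
  · intro p hp
    have hp := mem_lune.1 hp
    refine mem_lune.2 ?_
    rw [← neg_add', len_neg, len_neg, ← sub_neg_eq_add]
    exact hp
  · intro p hp
    have hp := mem_lune.1 hp
    refine mem_lune.2 ?_
    rw [← neg_sub', len_neg, len_neg]
    exact hp

theorem sqLen_update_zero (p : Momentum) (i : Fin 3) :
    sqLen (Function.update p i 0) = sqLen p - (p i : ℝ) ^ 2 := by
  rw [sqLen_eq, sqLen_eq]
  fin_cases i <;> simp <;> ring

/-- Every lattice line in direction i meets the lune at most once, so projecting along i embeds the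
lune into a square of side 2⌊k_F⌋ + 1. -/
theorem card_lune_unit_le {kF : ℝ} (hkF : 1 ≤ kF) (i : Fin 3) :
    ((lune kF (Pi.single i 1)).card : ℝ) ≤ 9 * kF ^ 2 := by
  have hfl : (0 : ℤ) ≤ ⌊kF⌋ := Int.floor_nonneg.2 (by linarith)
  have hfl' : (0 : ℝ) ≤ ⌊kF⌋ := by exact_mod_cast hfl
  set a : Momentum := fun j => if j = i then 0 else -⌊kF⌋ with ha
  set b : Momentum := fun j => if j = i then 0 else ⌊kF⌋ with hb
  have hupd : ∀ p : Momentum, Function.update (p - Pi.single i 1) i 0 = Function.update p i 0 := by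
    intro p
    ext j
    by_cases hj : j = i
    · subst hj; simp
    · simp [hj]
  have hlune : ∀ p ∈ lune kF (Pi.single i 1),
      sqLen (Function.update p i 0) + ((p i : ℝ) - 1) ^ 2 ≤ kF ^ 2 ∧
      kF ^ 2 < sqLen (Function.update p i 0) + (p i : ℝ) ^ 2 := by
    intro p hp
    obtain ⟨h1, h2⟩ := mem_lune.1 hp
    have h3 := pow_le_pow_left₀ (len_nonneg _) h1 2
    have h4 := pow_lt_pow_left₀ h2 (by linarith) two_ne_zero
    rw [len_sq] at h3 h4
    have h5 := sqLen_update_zero (p - Pi.single i 1) i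
    rw [hupd] at h5
    have h6 := sqLen_update_zero p i
    have h7 : (((p - Pi.single i 1 : Momentum) i : ℤ) : ℝ) = p i - 1 := by simp
    rw [h7] at h5
    constructor <;> linarith
  have hinj : Set.InjOn (fun p : Momentum => Function.update p i 0)
      (lune kF (Pi.single i 1) : Set Momentum) := by
    -- A lune point has p_i² > (p_i − 1)², hence p_i ≥ 1. If p_i ≤ q_i − 1 on the same line, then
    -- (q_i − 1)² ≥ p_i² and q shifted back by one is still outside the ball.
    have key : ∀ p ∈ lune kF (Pi.single i 1), ∀ q ∈ lune kF (Pi.single i 1),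
        Function.update p i 0 = Function.update q i 0 → ¬ p i < q i := by
      intro p hp q hq h hlt
      obtain ⟨h1, h2⟩ := hlune p hp
      obtain ⟨h3, h4⟩ := hlune q hq
      rw [← h] at h3
      have h5 : 1 ≤ p i := by
        by_contra hc
        have : (p i : ℝ) ≤ 0 := by exact_mod_cast (by omega : p i ≤ 0)
        nlinarith
      have h6 : (p i : ℝ) ≤ q i - 1 := by exact_mod_cast (by omega : p i ≤ q i - 1)
      have h7 : (1 : ℝ) ≤ p i := by exact_mod_cast h5
      nlinarith
    intro p hp q hq h
    have hi : p i = q i :=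
      le_antisymm (not_lt.1 (key q hq p hp h.symm)) (not_lt.1 (key p hp q hq h))
    ext j
    by_cases hj : j = i
    · rw [hj, hi]
    · have := congrFun h j
      simpa [Function.update_of_ne hj] using this
  have hmaps : ∀ p ∈ lune kF (Pi.single i 1), Function.update p i 0 ∈ Finset.Icc a b := by
    intro p hp
    have h1 := (mem_lune.1 hp).1
    rw [Finset.mem_Icc]
    have h2 : ∀ j, j ≠ i → -⌊kF⌋ ≤ p j ∧ p j ≤ ⌊kF⌋ := by
      intro j hj
      have := abs_coord_le_floor h1 j
      simpa [hj] using this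
    constructor
    · intro j
      by_cases hj : j = i
      · subst hj; simp [ha]
      · simp [ha, hj, (h2 j hj).1]
    · intro j
      by_cases hj : j = i
      · subst hj; simp [hb]
      · simp [hb, hj, (h2 j hj).2]
  have hcard := Finset.card_le_card_of_injOn _ hmaps hinj
  have hIcc : ((Finset.Icc a b).card : ℝ) = (2 * ⌊kF⌋ + 1) ^ 2 := by
    have hn : (((⌊kF⌋ + 1 - -⌊kF⌋).toNat : ℕ) : ℝ) = 2 * ⌊kF⌋ + 1 := by
      have h : ((⌊kF⌋ + 1 - -⌊kF⌋).toNat : ℤ) = 2 * ⌊kF⌋ + 1 := by omega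
      exact_mod_cast h
    rw [Pi.card_Icc, Fin.prod_univ_three]
    push_cast
    rw [← hn]
    fin_cases i <;> simp [ha, hb] <;> ring
  have h3 : (2 * (⌊kF⌋ : ℝ) + 1) ≤ 3 * kF := by
    have := Int.floor_le kF
    linarith
  calc ((lune kF (Pi.single i 1)).card : ℝ) ≤ (Finset.Icc a b).card := by exact_mod_cast hcard
    _ = (2 * (⌊kF⌋ : ℝ) + 1) ^ 2 := hIcc
    _ ≤ (3 * kF) ^ 2 := by gcongr
    _ = _ := by ring

theorem card_lune_zero (kF : ℝ) : (lune kF 0).card = 0 := by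
  rw [Finset.card_eq_zero, Finset.eq_empty_iff_forall_notMem]
  intro p hp
  obtain ⟨h1, h2⟩ := mem_lune.1 hp
  rw [sub_zero] at h1
  linarith

theorem card_lune_nsmul_le (kF : ℝ) (l : Momentum) (n : ℕ) :
    (lune kF (n • l)).card ≤ n * (lune kF l).card := by
  induction n with
  | zero => simp [card_lune_zero]
  | succ n ih =>
    rw [succ_nsmul, Nat.succ_mul]
    exact (card_lune_add_le _ _ _).trans (Nat.add_le_add_right ih _)

theorem card_lune_zsmul_le (kF : ℝ) (l : Momentum) (z : ℤ) :
    (lune kF (z • l)).card ≤ z.natAbs * (lune kF l).card := by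
  rcases Int.natAbs_eq z with h | h
  · rw [h, natCast_zsmul, Int.natAbs_natCast]
    exact card_lune_nsmul_le _ _ _
  · rw [h, neg_zsmul, card_lune_neg, natCast_zsmul, Int.natAbs_neg, Int.natAbs_natCast]
    exact card_lune_nsmul_le _ _ _

theorem card_lune_le {kF : ℝ} (hkF : 1 ≤ kF) (l : Momentum) :
    ((lune kF l).card : ℝ) ≤ 27 * kF ^ 2 * len l := by
  have hl : l = l 0 • Pi.single 0 1 + l 1 • Pi.single 1 1 + l 2 • Pi.single 2 1 := by
    ext j
    fin_cases j <;> simp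
  have h1 : (lune kF l).card ≤ (l 0).natAbs * (lune kF (Pi.single 0 1)).card +
      (l 1).natAbs * (lune kF (Pi.single 1 1)).card +
      (l 2).natAbs * (lune kF (Pi.single 2 1)).card := by
    conv_lhs => rw [hl]
    refine (card_lune_add_le _ _ _).trans (Nat.add_le_add ((card_lune_add_le _ _ _).trans
      (Nat.add_le_add ?_ ?_)) ?_) <;> exact card_lune_zsmul_le _ _ _
  have h2 : ∀ i, (((l i).natAbs * (lune kF (Pi.single i 1)).card : ℕ) : ℝ) ≤
      len l * (9 * kF ^ 2) := by
    intro i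
    push_cast
    have h3 : (((l i).natAbs : ℕ) : ℝ) ≤ len l := by
      rw [Nat.cast_natAbs, Int.cast_abs]
      exact abs_coord_le_len l i
    exact mul_le_mul h3 (card_lune_unit_le hkF i) (Nat.cast_nonneg _) (len_nonneg l)
  have h3 : ((lune kF l).card : ℝ) ≤ _ := Nat.cast_le.2 h1
  push_cast at h3 h2
  linarith [h2 0, h2 1, h2 2]

/-- The exact value of Σλ is positive, so the sum cannot be empty. -/
theorem lune_nonempty {kF : ℝ} (hkF : 2 ≤ kF) {k : Momentum} (hk : k ≠ 0) :
    (lune kF k).Nonempty := by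
  rw [Finset.nonempty_iff_ne_empty]
  intro h
  have h1 := sum_lam kF k
  rw [h, Finset.sum_empty] at h1
  have h2 := one_le_sqLen hk
  have h3 := le_card_fermiBall hkF
  have h4 : 0 < kF ^ 3 := by positivity
  nlinarith

/-! ### The error sum of the Coulomb potential -/

/-- The maximum norm of a momentum. -/
def supLen (l : Momentum) : ℕ := Finset.univ.sup fun i => (l i).natAbs

theorem supLen_le_iff {l : Momentum} {n : ℕ} :
    supLen l ≤ n ↔ l ∈ Finset.Icc (fun _ => -(n : ℤ) : Momentum) (fun _ => (n : ℤ)) := by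
  rw [supLen, Finset.sup_le_iff, Finset.mem_Icc, Pi.le_def, Pi.le_def, ← forall_and]
  refine ⟨fun h i => ?_, fun h i _ => ?_⟩
  · have := h i (Finset.mem_univ i); omega
  · have := h i; omega

theorem supLen_pos {l : Momentum} (hl : l ≠ 0) : 0 < supLen l := by
  by_contra hc
  have h : supLen l ≤ 0 := not_lt.1 hc
  rw [supLen_le_iff, Finset.mem_Icc] at h
  exact hl (funext fun i => le_antisymm (by simpa using h.2 i) (by simpa using h.1 i))

theorem supLen_sq_le (l : Momentum) : (supLen l : ℝ) ^ 2 ≤ sqLen l := by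
  obtain ⟨i, -, hi⟩ := Finset.exists_mem_eq_sup Finset.univ Finset.univ_nonempty
    (fun i => (l i).natAbs)
  rw [supLen, hi, Nat.cast_natAbs, Int.cast_abs, sq_abs]
  exact Finset.single_le_sum (f := fun i => (l i : ℝ) ^ 2) (fun j _ => sq_nonneg _)
    (Finset.mem_univ i)

/-- The shell is a difference of two cubes and has (2n+1)³ − (2n−1)³ = 24n² + 2 points. -/
theorem card_filter_supLen_le (G : Finset Momentum) {n : ℕ} (hn : 0 < n) :
    ((G.filter fun l => supLen l = n).card : ℝ) ≤ 26 * (n : ℝ) ^ 2 := by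
  obtain ⟨m, rfl⟩ := Nat.exists_eq_succ_of_ne_zero hn.ne'
  have h1 : (G.filter fun l => supLen l = m + 1) ⊆
      Finset.Icc (fun _ => -((m + 1 : ℕ) : ℤ) : Momentum) (fun _ => ((m + 1 : ℕ) : ℤ)) \
        Finset.Icc (fun _ => -(m : ℤ) : Momentum) (fun _ => (m : ℤ)) := by
    intro l hl
    have hl := (Finset.mem_filter.1 hl).2
    rw [Finset.mem_sdiff, ← supLen_le_iff, ← supLen_le_iff]
    omega
  have h2 : Finset.Icc (fun _ => -(m : ℤ) : Momentum) (fun _ => (m : ℤ)) ⊆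
      Finset.Icc (fun _ => -((m + 1 : ℕ) : ℤ) : Momentum) (fun _ => ((m + 1 : ℕ) : ℤ)) := by
    intro l hl
    rw [← supLen_le_iff] at hl ⊢
    omega
  have h3 : ((G.filter fun l => supLen l = m + 1).card : ℝ) ≤ _ :=
    Nat.cast_le.2 (Finset.card_le_card h1)
  rw [Finset.card_sdiff_of_subset h2, Nat.cast_sub (Finset.card_le_card h2),
    card_cube _ (by positivity), card_cube _ (by positivity)] at h3
  push_cast at h3 ⊢
  have : (0 : ℝ) ≤ m := m.cast_nonneg
  nlinarith

/-- Split at ⌊k_F⌋: below it the first entry of the minimum contributes at most k_F², above it the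
tail of Σ n⁻² contributes at most 2k_F². -/
theorem sum_min_le {kF : ℝ} (hkF : 1 ≤ kF) (N : ℕ) :
    ∑ n ∈ Finset.Ioo 0 N, min kF (kF ^ 3 / (n : ℝ) ^ 2) ≤ 3 * kF ^ 2 := by
  have hK : (⌊kF⌋₊ : ℝ) ≤ kF := Nat.floor_le (by linarith)
  have hK' : kF < ⌊kF⌋₊ + 1 := Nat.lt_floor_add_one kF
  have hnn : ∀ n : ℕ, 0 ≤ min kF (kF ^ 3 / (n : ℝ) ^ 2) := fun n =>
    le_min (by linarith) (by positivity)
  calc ∑ n ∈ Finset.Ioo 0 N, min kF (kF ^ 3 / (n : ℝ) ^ 2)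
      ≤ ∑ n ∈ Finset.Ioc 0 ⌊kF⌋₊ ∪ Finset.Ioo ⌊kF⌋₊ N, min kF (kF ^ 3 / (n : ℝ) ^ 2) := by
        refine Finset.sum_le_sum_of_subset_of_nonneg ?_ fun n _ _ => hnn n
        intro n hn
        rw [Finset.mem_Ioo] at hn
        rw [Finset.mem_union, Finset.mem_Ioc, Finset.mem_Ioo]
        omega
    _ ≤ ∑ n ∈ Finset.Ioc 0 ⌊kF⌋₊, min kF (kF ^ 3 / (n : ℝ) ^ 2) +
          ∑ n ∈ Finset.Ioo ⌊kF⌋₊ N, min kF (kF ^ 3 / (n : ℝ) ^ 2) := by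
        rw [← Finset.sum_union_inter]
        exact le_add_of_nonneg_right (Finset.sum_nonneg fun n _ => hnn n)
    _ ≤ ∑ _n ∈ Finset.Ioc 0 ⌊kF⌋₊, kF + ∑ n ∈ Finset.Ioo ⌊kF⌋₊ N, kF ^ 3 * ((n : ℝ) ^ 2)⁻¹ :=
        add_le_add (Finset.sum_le_sum fun n _ => min_le_left _ _)
          (Finset.sum_le_sum fun n _ => (min_le_right _ _).trans_eq (div_eq_mul_inv _ _))
    _ ≤ kF * kF + kF ^ 3 * (2 / (⌊kF⌋₊ + 1)) := by
        rw [Finset.sum_const, Nat.card_Ioc, nsmul_eq_mul, ← Finset.mul_sum, Nat.sub_zero]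
        gcongr
        exact sum_Ioo_inv_sq_le _ _
    _ ≤ kF * kF + kF ^ 3 * (2 / kF) := by gcongr
    _ = 3 * kF ^ 2 := by field_simp; ring

theorem errorTerm_nonneg {kF : ℝ} (hkF : 0 ≤ kF) {V : Momentum → ℝ} (l : {l : Momentum // l ≠ 0})
    (hV : 0 ≤ V l.1) : 0 ≤ errorTerm kF V l := by
  rw [errorTerm]
  have := sqLen_nonneg l.1
  have : 0 ≤ min 1 (min (kF * V l.1) (kF ^ 3 * V l.1 / sqLen l.1)) :=
    le_min zero_le_one (le_min (by positivity) (by positivity))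
  positivity

theorem coulomb_nonneg {g : ℝ} (hg : 0 < g) (l : Momentum) : 0 ≤ coulomb g l :=
  div_nonneg hg.le (sqLen_nonneg l)

theorem errorTerm_coulomb_le {kF : ℝ} (hkF : 0 ≤ kF) {g : ℝ} (hg : 0 < g)
    (l : {l : Momentum // l ≠ 0}) :
    errorTerm kF (coulomb g) l ≤
      g ^ 2 * (min kF (kF ^ 3 / (supLen l.1 : ℝ) ^ 2) / (supLen l.1 : ℝ) ^ 2) := by
  have h1 : 0 < sqLen l.1 := one_pos.trans_le (one_le_sqLen l.2)
  have h2 : (0 : ℝ) < supLen l.1 := by exact_mod_cast supLen_pos l.2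
  have h3 := supLen_sq_le l.1
  have h4 : errorTerm kF (coulomb g) l =
      g * min 1 (min (kF * coulomb g l.1) (kF ^ 3 * coulomb g l.1 / sqLen l.1)) := by
    rw [errorTerm, mul_assoc, coulomb, div_mul_cancel₀ _ h1.ne', mul_comm]
  rw [h4, sq g, mul_assoc]
  refine mul_le_mul_of_nonneg_left ((min_le_right _ _).trans ?_) hg.le
  rw [← min_div_div_right (by positivity), mul_min_of_nonneg _ _ hg.le, coulomb]
  refine min_le_min ?_ ?_
  · rw [mul_div_assoc', mul_div_assoc', mul_comm kF]
    gcongr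
  · rw [mul_div_assoc', div_div, div_div, mul_div_assoc', mul_comm (kF ^ 3)]
    gcongr

/-- Grouped by maximum norm n, the at most 26n² points of a shell cancel the factor n⁻² of the
summand; 78 = 26 · 3. -/
theorem sum_errorTerm_coulomb_le {kF : ℝ} (hkF : 1 ≤ kF) {g : ℝ} (hg : 0 < g)
    (G : Finset {l : Momentum // l ≠ 0}) :
    ∑ l ∈ G, errorTerm kF (coulomb g) l ≤ 78 * g ^ 2 * kF ^ 2 := by
  set f : ℕ → ℝ := fun n => min kF (kF ^ 3 / (n : ℝ) ^ 2) / (n : ℝ) ^ 2 with hf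
  have hnn : ∀ n : ℕ, 0 ≤ min kF (kF ^ 3 / (n : ℝ) ^ 2) := fun n =>
    le_min (by linarith) (by positivity)
  set G' : Finset Momentum := G.map ⟨Subtype.val, Subtype.val_injective⟩ with hG'
  set N := G'.sup supLen + 1 with hN
  have h1 : ∑ l ∈ G', f (supLen l) ≤ 26 * (3 * kF ^ 2) := by
    have hmaps : ∀ l ∈ G', supLen l ∈ Finset.Ioo 0 N := by
      intro l hl
      rw [Finset.mem_Ioo, hN, Nat.lt_add_one_iff]
      refine ⟨?_, Finset.le_sup hl⟩
      obtain ⟨l', -, rfl⟩ := Finset.mem_map.1 hl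
      exact supLen_pos l'.2
    rw [← Finset.sum_fiberwise_of_maps_to hmaps]
    refine le_trans ?_ (mul_le_mul_of_nonneg_left (sum_min_le hkF N) (by norm_num))
    rw [Finset.mul_sum]
    refine Finset.sum_le_sum fun n hn => ?_
    have hn0 := (Finset.mem_Ioo.1 hn).1
    rw [Finset.sum_congr rfl fun l hl => by rw [(Finset.mem_filter.1 hl).2], Finset.sum_const,
      nsmul_eq_mul]
    have hn' : (0 : ℝ) < (n : ℝ) ^ 2 := by positivity
    calc _ ≤ 26 * (n : ℝ) ^ 2 * f n := by
          have : 0 ≤ f n := div_nonneg (hnn n) hn'.le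
          gcongr
          exact card_filter_supLen_le G' hn0
      _ = _ := by rw [hf]; field_simp
  calc ∑ l ∈ G, errorTerm kF (coulomb g) l ≤ ∑ l ∈ G, g ^ 2 * f (supLen l.1) :=
        Finset.sum_le_sum fun l _ => errorTerm_coulomb_le (by linarith) hg l
    _ = g ^ 2 * ∑ l ∈ G', f (supLen l) := by
        rw [hG', Finset.sum_map, Finset.mul_sum]; rfl
    _ ≤ g ^ 2 * (26 * (3 * kF ^ 2)) := by gcongr
    _ = _ := by ring

end Lattice

/-! ### Asymptotics of the moments of the Fermi ball -/

section Asymptotics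

open MeasureTheory Topology

/-- The unit ball of the Euclidean norm in `ℝ³`. -/
def unitBall : Set (Fin 3 → ℝ) := {x | ∑ i, x i ^ 2 ≤ 1}

theorem unitBall_eq_preimage :
    unitBall = (WithLp.toLp 2 : (Fin 3 → ℝ) → EuclideanSpace ℝ (Fin 3)) ⁻¹'
      Metric.closedBall 0 1 := by
  ext x
  rw [unitBall, Set.mem_ofPred_eq, Set.mem_preimage, mem_closedBall_zero_iff,
    ← sq_le_one_iff₀ (norm_nonneg _), EuclideanSpace.norm_sq_eq]
  simp

theorem isClosed_unitBall : IsClosed unitBall :=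
  isClosed_le (by fun_prop) continuous_const

theorem isBounded_unitBall : Bornology.IsBounded unitBall := by
  refine (Metric.isBounded_closedBall (x := (0 : Fin 3 → ℝ)) (r := 1)).subset fun x hx => ?_
  rw [mem_closedBall_zero_iff, pi_norm_le_iff_of_nonneg zero_le_one]
  intro i
  rw [Real.norm_eq_abs, ← sq_le_one_iff_abs_le_one]
  exact (Finset.single_le_sum (f := fun i => x i ^ 2) (fun j _ => sq_nonneg _)
    (Finset.mem_univ i)).trans hx

/-- A convex set has null boundary; this is the regularity required for lattice Riemann sums to
converge. -/
theorem volume_frontier_unitBall : volume (frontier unitBall) = 0 := by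
  refine Convex.addHaar_frontier volume ?_
  rw [unitBall_eq_preimage]
  exact (convex_closedBall (0 : EuclideanSpace ℝ (Fin 3)) 1).is_linear_preimage
    (WithLp.linearEquiv 2 ℝ (Fin 3 → ℝ)).symm.toLinearMap.isLinear

theorem setIntegral_unitBall (f : ℝ → ℝ) :
    ∫ x in unitBall, f (√(∑ i, x i ^ 2)) =
      3 * (volume.real (Metric.ball (0 : EuclideanSpace ℝ (Fin 3)) 1)) *
        ∫ y in (0 : ℝ)..1, y ^ 2 * f y := by
  have h1 : ∫ x in unitBall, f (√(∑ i, x i ^ 2)) =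
      ∫ x : EuclideanSpace ℝ (Fin 3), (Set.Iic 1).indicator f ‖x‖ := by
    rw [← integral_indicator isClosed_unitBall.measurableSet,
      ← (EuclideanSpace.volume_preserving_symm_measurableEquiv_toLp (Fin 3)).symm.integral_comp']
    refine integral_congr_ae (Eventually.of_forall fun x => ?_)
    have hn : ‖(WithLp.toLp 2 x : EuclideanSpace ℝ (Fin 3))‖ = √(∑ i, x i ^ 2) := by
      rw [EuclideanSpace.norm_eq]; simp
    change unitBall.indicator (fun x => f (√(∑ i, x i ^ 2))) x =
      (Set.Iic 1).indicator f ‖(WithLp.toLp 2 x : EuclideanSpace ℝ (Fin 3))‖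
    rw [hn]
    by_cases hx : x ∈ unitBall
    · rw [Set.indicator_of_mem hx, Set.indicator_of_mem]
      exact Real.sqrt_le_one.2 hx
    · rw [Set.indicator_of_notMem hx, Set.indicator_of_notMem]
      exact fun h => hx (Real.sqrt_le_one.1 h)
  rw [h1, integral_fun_norm_addHaar, intervalIntegral.integral_of_le zero_le_one]
  simp only [finrank_euclideanSpace, Fintype.card_fin, nsmul_eq_mul, smul_eq_mul]
  rw [mul_assoc]
  push_cast
  congr 2
  have h2 : ∀ y : ℝ, y ^ (3 - 1) * (Set.Iic 1).indicator f y =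
      (Set.Iic 1).indicator (fun y => y ^ 2 * f y) y := by
    intro y
    by_cases hy : y ∈ Set.Iic (1 : ℝ)
    · rw [Set.indicator_of_mem hy, Set.indicator_of_mem hy]
    · rw [Set.indicator_of_notMem hy, Set.indicator_of_notMem hy, mul_zero]
  simp only [h2]
  rw [setIntegral_indicator measurableSet_Iic, Set.Ioi_inter_Iic]

/-- Polar coordinates for |x|² and for 1 share the same prefactor, so the ratio (1/5)/(1/3) needs no
value of the volume. -/
theorem setIntegral_unitBall_sq :
    ∫ x in unitBall, ∑ i, x i ^ 2 = 3 / 5 * volume.real unitBall := by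
  have h1 := setIntegral_unitBall (fun y => y ^ 2)
  have h2 := setIntegral_unitBall (fun _ => 1)
  have h3 : ∀ x : Fin 3 → ℝ, √(∑ i, x i ^ 2) ^ 2 = ∑ i, x i ^ 2 := fun x =>
    Real.sq_sqrt (Finset.sum_nonneg fun _ _ => sq_nonneg _)
  simp only [h3, ← pow_add, integral_pow] at h1
  rw [setIntegral_const] at h2
  simp only [mul_one, integral_pow, smul_eq_mul] at h2
  rw [h1, h2]
  norm_num
  ring

/-- Dividing by n maps the Fermi ball of radius n onto the points of n⁻¹ℤ³ in the unit ball, so this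
is a Riemann sum. -/
theorem tendsto_sum_scaled_fermiBall {F : (Fin 3 → ℝ) → ℝ} (hF : Continuous F) :
    Tendsto (fun n : ℕ => (∑ q ∈ fermiBall n, F fun i => (q i : ℝ) / n) / (n : ℝ) ^ 3) atTop
      (𝓝 (∫ x in unitBall, F x)) := by
  refine (tendsto_tsum_div_pow_atTop_integral unitBall F hF isBounded_unitBall
    isClosed_unitBall.measurableSet volume_frontier_unitBall).congr' ?_
  filter_upwards [eventually_gt_atTop 0] with n hn
  rw [Fintype.card_fin]
  congr 1
  have hn' : (0 : ℝ) < n := by exact_mod_cast hn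
  have : NeZero n := ⟨hn.ne'⟩
  have hq : ∀ q : Momentum, (fun i => (q i : ℝ) / n) ∈ unitBall ↔ q ∈ fermiBall n := by
    intro q
    rw [mem_fermiBall, len, Real.sqrt_le_left hn'.le, sqLen, unitBall, Set.mem_ofPred_eq]
    simp only [div_pow, ← Finset.sum_div]
    rw [div_le_one (by positivity)]
  have key : ∀ Ls : Set (Fin 3 → ℝ), (∀ x, x ∈ Ls ↔ ∀ i, n * x i ∈ Set.range (algebraMap ℤ ℝ)) →
      ∑' x : ↑(unitBall ∩ Ls), F x = ∑ q ∈ fermiBall n, F fun i => (q i : ℝ) / n := by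
    intro Ls hLs
    have hmem : ∀ q : fermiBall n, (fun i => ((q : Momentum) i : ℝ) / n) ∈ unitBall ∩ Ls :=
      fun q => ⟨(hq q).2 q.2, (hLs _).2 fun i =>
        ⟨(q : Momentum) i, (mul_div_cancel₀ (((q : Momentum) i : ℤ) : ℝ) hn'.ne').symm⟩⟩
    let e : fermiBall n → ↑(unitBall ∩ Ls) := fun q => ⟨_, hmem q⟩
    have he : Function.Bijective e := by
      constructor
      · intro q r h
        ext i
        have h1 : ((q : Momentum) i : ℝ) / n = ((r : Momentum) i : ℝ) / n :=
          congrFun (congrArg Subtype.val h) i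
        rw [div_left_inj' hn'.ne'] at h1
        exact_mod_cast h1
      · rintro ⟨x, hx1, hx2⟩
        choose q hqx using (hLs x).1 hx2
        have hx : x = fun i => (q i : ℝ) / n := by
          ext i
          rw [eq_div_iff hn'.ne', mul_comm, ← hqx i]; rfl
        subst hx
        exact ⟨⟨q, (hq q).1 hx1⟩, rfl⟩
    rw [← Finset.sum_coe_sort (fermiBall n), ← tsum_fintype (L := .unconditional _)]
    exact ((Equiv.ofBijective e he).tsum_eq fun x : ↑(unitBall ∩ Ls) => F x).symm
  exact key _ fun x => BoxIntegral.unitPartition.mem_smul_span_iff (n := n)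

/-- Passing from natural to real radii. -/
theorem tendsto_div_pow_of_nat {a : ℝ → ℝ} (ha : Monotone a) {d : ℕ} {c : ℝ}
    (h : Tendsto (fun n : ℕ => a n / (n : ℝ) ^ d) atTop (𝓝 c)) :
    Tendsto (fun x : ℝ => a x / x ^ d) atTop (𝓝 c) := by
  have h1 : Tendsto (fun x : ℝ => a ⌊x⌋₊ / (⌊x⌋₊ : ℝ) ^ d * ((⌊x⌋₊ : ℝ) / x) ^ d) atTop
      (𝓝 (c * 1 ^ d)) :=
    (h.comp tendsto_nat_floor_atTop).mul (tendsto_nat_floor_div_atTop.pow d)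
  have h2 : Tendsto (fun x : ℝ => a ⌈x⌉₊ / (⌈x⌉₊ : ℝ) ^ d * ((⌈x⌉₊ : ℝ) / x) ^ d) atTop
      (𝓝 (c * 1 ^ d)) :=
    (h.comp tendsto_nat_ceil_atTop).mul (tendsto_nat_ceil_div_atTop.pow d)
  rw [one_pow, mul_one] at h1 h2
  refine tendsto_of_tendsto_of_tendsto_of_le_of_le' h1 h2 ?_ ?_
  · filter_upwards [eventually_ge_atTop 1] with x hx
    have hfl : 0 < ⌊x⌋₊ := Nat.floor_pos.2 hx
    rw [div_pow, mul_div, div_mul_cancel₀ _ (by positivity)]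
    gcongr
    exact ha (Nat.floor_le (by linarith))
  · filter_upwards [eventually_ge_atTop 1] with x hx
    have hce : 0 < ⌈x⌉₊ := Nat.ceil_pos.2 (by linarith)
    rw [div_pow, mul_div, div_mul_cancel₀ _ (by positivity)]
    gcongr
    exact ha (Nat.le_ceil _)

theorem fermiBall_mono {x y : ℝ} (h : x ≤ y) : fermiBall x ⊆ fermiBall y := fun _ hp =>
  mem_fermiBall.2 ((mem_fermiBall.1 hp).trans h)

theorem tendsto_card_fermiBall :
    Tendsto (fun kF : ℝ => ((fermiBall kF).card : ℝ) / kF ^ 3) atTop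
      (𝓝 (volume.real unitBall)) := by
  refine tendsto_div_pow_of_nat (a := fun kF => ((fermiBall kF).card : ℝ)) (fun x y h =>
    Nat.cast_le.2 (Finset.card_le_card (fermiBall_mono h))) ?_
  have h := tendsto_sum_scaled_fermiBall (F := fun _ => 1) continuous_const
  simpa using h

theorem tendsto_secondMoment :
    Tendsto (fun kF : ℝ => secondMoment kF / kF ^ 5) atTop
      (𝓝 (3 / 5 * volume.real unitBall)) := by
  refine tendsto_div_pow_of_nat (fun x y h =>
    Finset.sum_le_sum_of_subset_of_nonneg (fermiBall_mono h) fun q _ _ => sqLen_nonneg q) ?_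
  have h := tendsto_sum_scaled_fermiBall (F := fun x => ∑ i, x i ^ 2) (by fun_prop)
  rw [setIntegral_unitBall_sq] at h
  refine h.congr fun n => ?_
  simp only [div_pow, ← Finset.sum_div, sqLen]
  rw [div_div, ← pow_add]

theorem tendsto_secondMoment_div_card :
    Tendsto (fun kF : ℝ => secondMoment kF / ((fermiBall kF).card * kF ^ 2)) atTop
      (𝓝 (3 / 5)) := by
  have hpos : (1 : ℝ) / 8 ≤ volume.real unitBall := by
    refine ge_of_tendsto tendsto_card_fermiBall ?_
    filter_upwards [eventually_ge_atTop 2] with kF hkF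
    rw [le_div_iff₀ (by positivity)]
    linarith [le_card_fermiBall hkF]
  have hne : volume.real unitBall ≠ 0 := by linarith
  have h := tendsto_secondMoment.div tendsto_card_fermiBall hne
  rw [mul_div_cancel_right₀ _ hne] at h
  refine h.congr' ?_
  filter_upwards [eventually_ge_atTop 2] with kF hkF
  have h1 : (0 : ℝ) < (fermiBall kF).card :=
    lt_of_lt_of_le (by positivity) (le_card_fermiBall hkF)
  simp only [Pi.div_apply]
  field_simp

end Asymptotics

/-! ### Bounds for sums of excitation operators -/

section Excitation

variable {s : ℕ}

theorem excAnnihilate_apply (l p : Momentum) (Ψ : Fock s) :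
    excAnnihilate l p Ψ =
      (((√(s : ℝ))⁻¹ : ℝ) : ℂ) • ∑ σ : Fin s, hop (p - l, σ) (p, σ) Ψ := by
  rw [excAnnihilate, smul_apply, sum_apply]; rfl

theorem excCreate_apply (l p : Momentum) (Ψ : Fock s) :
    excCreate l p Ψ = (((√(s : ℝ))⁻¹ : ℝ) : ℂ) • ∑ σ : Fin s, hop (p, σ) (p - l, σ) Ψ := by
  rw [excCreate, smul_apply, sum_apply]; rfl

theorem inner_excCreate (l p : Momentum) (Φ Ψ : Fock s) :
    inner ℂ Φ (excCreate l p Ψ) = (inner ℂ (excAnnihilate l p Φ) Ψ : ℂ) := by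
  rw [excAnnihilate_apply, excCreate_apply, inner_smul_left, inner_smul_right, inner_sum,
    sum_inner, Complex.conj_ofReal]
  congr 1
  refine Finset.sum_congr rfl fun σ _ => ?_
  rw [← adjoint_hop (p - l, σ) (p, σ), ContinuousLinearMap.adjoint_inner_right]

/-- The filled modes of the Fermi state. -/
def fermiModes (kF : ℝ) (s : ℕ) : Finset (Mode s) := fermiBall kF ×ˢ Finset.univ

theorem mem_fermiModes {kF : ℝ} {m : Mode s} : m ∈ fermiModes kF s ↔ len m.1 ≤ kF := by
  rw [fermiModes, Finset.mem_product, mem_fermiBall]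
  simp

/-- At most `n` particles outside and at most `n` holes inside the Fermi ball. -/
def ExcitedAtMost (kF : ℝ) (n : ℕ) (T : Finset (Mode s)) : Prop :=
  (T \ fermiModes kF s).card ≤ n ∧ (fermiModes kF s \ T).card ≤ n

theorem norm_sum_sq_le {ι E : Type*} [SeminormedAddCommGroup E] (I : Finset ι) (f : ι → E) :
    ‖∑ i ∈ I, f i‖ ^ 2 ≤ I.card * ∑ i ∈ I, ‖f i‖ ^ 2 := by
  calc ‖∑ i ∈ I, f i‖ ^ 2 ≤ (∑ i ∈ I, ‖f i‖) ^ 2 := by gcongr; exact norm_sum_le _ _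
    _ ≤ _ := sq_sum_le_card_mul_sum_sq

theorem norm_sq_excAnnihilate_le (hs : 1 ≤ s) (l p : Momentum) (Ψ : Fock s) :
    ‖excAnnihilate l p Ψ‖ ^ 2 ≤ ∑ σ : Fin s, ‖hop (p - l, σ) (p, σ) Ψ‖ ^ 2 := by
  have hs' : (0 : ℝ) < s := by exact_mod_cast hs
  rw [excAnnihilate_apply, norm_smul, mul_pow, Complex.norm_real, Real.norm_eq_abs, sq_abs,
    inv_pow, Real.sq_sqrt hs'.le]
  have h := norm_sum_sq_le Finset.univ fun σ : Fin s => hop (p - l, σ) (p, σ) Ψ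
  rw [Finset.card_univ, Fintype.card_fin] at h
  rwa [inv_mul_le_iff₀ hs']

variable {kF : ℝ}

/-- The pairs of a nonzero transfer `l` and a momentum of the lune `L_l`. -/
abbrev LunePair (kF : ℝ) : Type := Σ l : {l : Momentum // l ≠ 0}, lune kF l.1

theorem lune_ne {l p : Momentum} (hp : p ∈ lune kF l) (σ τ : Fin s) :
    ((p, σ) : Mode s) ≠ (p - l, τ) := by
  intro h
  obtain ⟨h1, h2⟩ := mem_lune.1 hp
  have := congrArg Prod.fst h
  simp only at this
  rw [← this] at h1
  linarith

/-- The occupied mode (p, σ) and the empty mode (p − l, σ) determine p, σ and l. Hence all transfers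
l together contribute no more terms than there are particle-hole pairs in T. -/
theorem card_pairs_le {n : ℕ} {T : Finset (Mode s)} (hT : ExcitedAtMost kF n T)
    (J : Finset (LunePair kF)) :
    ((J ×ˢ (Finset.univ : Finset (Fin s))).filter fun x =>
      ((x.1.2 : Momentum), x.2) ∈ T ∧ ((x.1.2 : Momentum) - x.1.1.1, x.2) ∉ T).card ≤ n * n := by
  refine le_trans ?_ (Nat.mul_le_mul hT.1 hT.2)
  rw [← Finset.card_product]
  refine Finset.card_le_card_of_injOn
    (fun x => (((x.1.2 : Momentum), x.2), ((x.1.2 : Momentum) - x.1.1.1, x.2))) ?_ ?_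
  · rintro ⟨⟨l, p⟩, σ⟩ hx
    obtain ⟨h1, h2⟩ := (Finset.mem_filter.1 hx).2
    have h3 := mem_lune.1 p.2
    simp only [Finset.coe_product, Set.mem_prod, Finset.mem_coe, Finset.mem_sdiff,
      mem_fermiModes]
    exact ⟨⟨h1, not_le.2 h3.2⟩, h3.1, h2⟩
  · rintro ⟨⟨⟨l, hl⟩, ⟨p, hp⟩⟩, σ⟩ - ⟨⟨⟨l', hl'⟩, ⟨p', hp'⟩⟩, σ'⟩ - h
    simp only [Prod.mk.injEq] at h
    obtain ⟨⟨rfl, rfl⟩, h2, -⟩ := h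
    obtain rfl : l = l' := sub_right_injective h2
    rfl

/-- In the Slater basis the sum counts particle-hole pairs of each configuration, so the bound does
not depend on the number of transfers or on s. -/
theorem sum_norm_sq_excAnnihilate_le (hs : 1 ≤ s) {n : ℕ} {Φ : Fock s}
    (hΦ : ∀ T, Φ T ≠ 0 → ExcitedAtMost kF n T) (J : Finset (LunePair kF)) :
    ∑ x ∈ J, ‖excAnnihilate x.1.1 (x.2 : Momentum) Φ‖ ^ 2 ≤ (n : ℝ) ^ 2 * ‖Φ‖ ^ 2 := by
  refine (Finset.sum_le_sum fun x _ => norm_sq_excAnnihilate_le hs _ _ Φ).trans ?_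
  rw [← Finset.sum_product' J Finset.univ (fun (x : LunePair kF) (σ : Fin s) =>
    ‖hop ((x.2 : Momentum) - x.1.1, σ) ((x.2 : Momentum), σ) Φ‖ ^ 2)]
  have h1 := hasSum_sum (s := J ×ˢ (Finset.univ : Finset (Fin s)))
    fun x _ => hasSum_norm_sq_hop (lune_ne x.1.2.2 x.2 x.2) Φ
  refine hasSum_le (fun T => ?_) h1 ((hasSum_norm_sq Φ).mul_left _)
  rw [← Finset.sum_filter, Finset.sum_const, nsmul_eq_mul]
  by_cases hT : Φ T = 0
  · simp [hT]
  · have h2 := card_pairs_le (hΦ T hT) J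
    gcongr
    rw [sq]
    exact_mod_cast h2

theorem excCreate_apply_ne_zero {n : ℕ} {ξ : Fock s} {l p : Momentum} (hp : p ∈ lune kF l)
    (hξ : ∀ T, ξ T ≠ 0 → ExcitedAtMost kF n T) {T : Finset (Mode s)}
    (hT : excCreate l p ξ T ≠ 0) : ExcitedAtMost kF (n + 1) T := by
  rw [excCreate_apply, lp.coeFn_smul, Pi.smul_apply, lp_sum_apply] at hT
  obtain ⟨σ, -, hσ⟩ := Finset.exists_ne_zero_of_sum_ne_zero (right_ne_zero_of_smul hT)
  rw [← norm_ne_zero_iff, norm_hop_apply (lune_ne hp σ σ).symm] at hσ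
  split_ifs at hσ with h
  swap
  · exact absurd rfl hσ
  obtain ⟨h1, h2⟩ := hξ _ (norm_ne_zero_iff.1 hσ)
  constructor
  · refine le_trans ?_ (Nat.add_le_add_right h1 1)
    refine (Finset.card_le_card fun m hm => ?_).trans (Finset.card_insert_le ((p, σ) : Mode s) _)
    rw [Finset.mem_sdiff] at hm
    by_cases hmp : m = (p, σ)
    · exact hmp ▸ Finset.mem_insert_self _ _
    · exact Finset.mem_insert_of_mem (Finset.mem_sdiff.2
        ⟨Finset.mem_insert_of_mem (Finset.mem_erase.2 ⟨hmp, hm.1⟩), hm.2⟩)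
  · refine le_trans ?_ (Nat.add_le_add_right h2 1)
    refine (Finset.card_le_card fun m hm => ?_).trans
      (Finset.card_insert_le ((p - l, σ) : Mode s) _)
    rw [Finset.mem_sdiff] at hm
    by_cases hmp : m = (p - l, σ)
    · exact hmp ▸ Finset.mem_insert_self _ _
    · refine Finset.mem_insert_of_mem (Finset.mem_sdiff.2 ⟨hm.1, fun hm' => ?_⟩)
      rcases Finset.mem_insert.1 hm' with h3 | h3
      · exact hmp h3
      · exact hm.2 (Finset.mem_of_mem_erase h3)

/-- Duality: pair the sum Φ with itself, move each b* to the left, and apply the annihilation bound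
to Φ, which has at most n + 1 excitations. -/
theorem norm_sq_sum_excCreate_le (hs : 1 ≤ s) {n : ℕ} (J : Finset (LunePair kF))
    {ξ : LunePair kF → Fock s} (hξ : ∀ x ∈ J, ∀ T, ξ x T ≠ 0 → ExcitedAtMost kF n T) :
    ‖∑ x ∈ J, excCreate x.1.1 (x.2 : Momentum) (ξ x)‖ ^ 2 ≤
      ((n + 1 : ℕ) : ℝ) ^ 2 * ∑ x ∈ J, ‖ξ x‖ ^ 2 := by
  obtain ⟨Φ, hΦ⟩ : ∃ Φ, Φ = ∑ x ∈ J, excCreate x.1.1 (x.2 : Momentum) (ξ x) := ⟨_, rfl⟩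
  have hsupp : ∀ T, Φ T ≠ 0 → ExcitedAtMost kF (n + 1) T := by
    intro T hT
    rw [hΦ, lp_sum_apply] at hT
    obtain ⟨x, hx, hxT⟩ := Finset.exists_ne_zero_of_sum_ne_zero hT
    exact excCreate_apply_ne_zero x.2.2 (hξ x hx) hxT
  have h1 := sum_norm_sq_excAnnihilate_le hs hsupp J
  have h2 : ‖Φ‖ ^ 2 ≤ ∑ x ∈ J, ‖excAnnihilate x.1.1 (x.2 : Momentum) Φ‖ * ‖ξ x‖ := by
    calc ‖Φ‖ ^ 2 = ‖(inner ℂ Φ Φ : ℂ)‖ := by rw [inner_self_eq_norm_sq_to_K]; simp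
      _ = ‖∑ x ∈ J, (inner ℂ (excAnnihilate x.1.1 (x.2 : Momentum) Φ) (ξ x) : ℂ)‖ := by
        nth_rewrite 2 [hΦ]
        rw [inner_sum]
        simp only [inner_excCreate]
      _ ≤ _ := (norm_sum_le _ _).trans (Finset.sum_le_sum fun x _ => norm_inner_le_norm _ _)
  have h3 := Finset.sum_mul_sq_le_sq_mul_sq J
    (fun x => ‖excAnnihilate x.1.1 (x.2 : Momentum) Φ‖) (fun x => ‖ξ x‖)
  rw [← hΦ]
  have hS : 0 ≤ ∑ x ∈ J, ‖ξ x‖ ^ 2 := Finset.sum_nonneg fun _ _ => sq_nonneg _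
  rcases (norm_nonneg Φ).eq_or_lt with h0 | h0
  · rw [← h0, zero_pow two_ne_zero]
    positivity
  have h4 : ‖Φ‖ ^ 2 * ‖Φ‖ ^ 2 ≤
      ‖Φ‖ ^ 2 * (((n + 1 : ℕ) : ℝ) ^ 2 * ∑ x ∈ J, ‖ξ x‖ ^ 2) := by
    calc ‖Φ‖ ^ 2 * ‖Φ‖ ^ 2 = (‖Φ‖ ^ 2) ^ 2 := by ring
      _ ≤ (∑ x ∈ J, ‖excAnnihilate x.1.1 (x.2 : Momentum) Φ‖ * ‖ξ x‖) ^ 2 := by gcongr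
      _ ≤ _ := h3
      _ ≤ ((n + 1 : ℕ) : ℝ) ^ 2 * ‖Φ‖ ^ 2 * ∑ x ∈ J, ‖ξ x‖ ^ 2 := by gcongr
      _ = _ := by ring
  exact le_of_mul_le_mul_left h4 (by positivity)

/-- Vectors with few overlaps in the Slater basis are almost orthogonal. -/
theorem norm_sq_sum_le_of_overlap {ι : Type*} (I : Finset ι) (d : ι → ℂ) (χ : ι → Fock s) {n : ℕ}
    (hχ : ∀ T, (I.filter fun i => χ i T ≠ 0).card ≤ n) :
    ‖∑ i ∈ I, d i • χ i‖ ^ 2 ≤ n * ∑ i ∈ I, ‖d i‖ ^ 2 * ‖χ i‖ ^ 2 := by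
  have h1 := (hasSum_sum (s := I) fun i _ => (hasSum_norm_sq (χ i)).mul_left (‖d i‖ ^ 2)).mul_left
    (n : ℝ)
  refine hasSum_le (fun T => ?_) (hasSum_norm_sq _) h1
  rw [lp_sum_apply]
  have h2 : ∑ i ∈ I, (d i • χ i) T = ∑ i ∈ I.filter fun i => χ i T ≠ 0, d i * χ i T := by
    rw [Finset.sum_filter]
    refine Finset.sum_congr rfl fun i _ => ?_
    rw [lp.coeFn_smul, Pi.smul_apply, smul_eq_mul]
    split_ifs with h
    · rfl
    · rw [not_not.1 h, mul_zero]
  rw [h2]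
  refine (norm_sum_sq_le _ _).trans ?_
  have h3 : ∑ i ∈ I.filter (fun i => χ i T ≠ 0), ‖d i * χ i T‖ ^ 2 ≤
      ∑ i ∈ I, ‖d i‖ ^ 2 * ‖χ i T‖ ^ 2 := by
    refine (Finset.sum_le_sum_of_subset_of_nonneg (Finset.filter_subset _ _)
      fun _ _ _ => sq_nonneg _).trans (Finset.sum_le_sum fun i _ => ?_)
    rw [norm_mul, mul_pow]
  gcongr
  exact_mod_cast hχ T

end Excitation

/-! ### Number operators and hopping on pair states -/

namespace PairFamily

variable {s : ℕ} {Λ : Type*} [DecidableEq Λ] (X : PairFamily s Λ)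

theorem create_annihilate_ket (m : Mode s) (A : Finset Λ) :
    create m (annihilate m (X.ket A)) = if m ∈ X.slater A then X.ket A else 0 := by
  ext T
  rw [create_annihilate_apply]
  by_cases hT : T = X.slater A
  · subst hT
    split_ifs <;> rfl
  · rw [X.ket_apply_of_ne hT]
    split_ifs
    · rw [X.ket_apply_of_ne hT]
    · rfl
    · rw [X.ket_apply_of_ne hT]
    · rfl

theorem annihilate_create_ket (m : Mode s) (A : Finset Λ) :
    annihilate m (create m (X.ket A)) = if m ∈ X.slater A then 0 else X.ket A := by
  ext T
  rw [annihilate_create_apply]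
  by_cases hT : T = X.slater A
  · subst hT
    split_ifs <;> rfl
  · rw [X.ket_apply_of_ne hT]
    split_ifs
    · rfl
    · rw [X.ket_apply_of_ne hT]
    · rfl
    · rw [X.ket_apply_of_ne hT]

theorem exists_of_hop_ket_ne_zero {m m' : Mode s} (hm : m ∉ X.F) (hm' : m' ∈ X.F) {A : Finset Λ}
    (h : hop m' m (X.ket A) ≠ 0) : (∃ a, X.part a = m) ∧ ∃ b, X.hole b = m' := by
  obtain ⟨z, -, hA⟩ := X.exists_ket_eq A
  have hmm : m ≠ m' := fun h => hm (h ▸ hm')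
  rw [hA, map_smul, hop, ContinuousLinearMap.comp_apply, annihilate_slaterDet] at h
  split_ifs at h with h1
  swap
  · simp at h
  rw [map_smul, create_slaterDet] at h
  split_ifs at h with h2
  · simp at h
  have hm'A : m' ∉ X.slater A := fun h' => h2 (Finset.mem_erase.2 ⟨hmm.symm, h'⟩)
  constructor
  · have h3 : m ∈ X.slater A \ X.F := Finset.mem_sdiff.2 ⟨h1, hm⟩
    rw [slater_sdiff] at h3
    obtain ⟨a, -, ha⟩ := Finset.mem_image.1 h3
    exact ⟨a, ha⟩
  · have h3 : m' ∈ X.F \ X.slater A := Finset.mem_sdiff.2 ⟨hm', hm'A⟩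
    rw [sdiff_slater] at h3
    obtain ⟨a, -, ha⟩ := Finset.mem_image.1 h3
    exact ⟨a, ha⟩

theorem exists_of_hop_pairState_ne_zero [Fintype Λ] {m m' : Mode s} (hm : m ∉ X.F)
    (hm' : m' ∈ X.F) {y : Λ → ℂ} {M : ℕ} (h : hop m' m (X.pairState y M) ≠ 0) :
    (∃ a, X.part a = m) ∧ ∃ b, X.hole b = m' := by
  rw [pairState, map_sum] at h
  obtain ⟨A, -, hA⟩ := Finset.exists_ne_zero_of_sum_ne_zero h
  rw [map_smul] at hA
  exact X.exists_of_hop_ket_ne_zero hm hm' (right_ne_zero_of_smul hA)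

end PairFamily

/-! ### The pairs of the lune -/

section LuneFamily

variable {kF : ℝ} {s : ℕ} {k : Momentum}

/-- The particle-hole pairs `(p, σ), (p - k, σ)` with `p ∈ L_k`. -/
def luneFamily (kF : ℝ) (s : ℕ) (k : Momentum) : PairFamily s (lune kF k × Fin s) where
  F := fermiModes kF s
  part a := (a.1, a.2)
  hole a := (a.1 - k, a.2)
  part_injective := by
    rintro ⟨p, σ⟩ ⟨q, τ⟩ h
    simp only [Prod.mk.injEq] at h
    exact Prod.ext (Subtype.ext h.1) h.2
  hole_injective := by
    rintro ⟨p, σ⟩ ⟨q, τ⟩ h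
    simp only [Prod.mk.injEq, sub_left_inj] at h
    exact Prod.ext (Subtype.ext h.1) h.2
  part_notMem a := by
    rw [mem_fermiModes, not_le]
    exact (mem_lune.1 a.1.2).2
  hole_mem a := mem_fermiModes.2 (mem_lune.1 a.1.2).1

/-- The amplitude `φ_p / √s`. -/
def amp (s : ℕ) (φ : LuneSpace kF k) (a : lune kF k × Fin s) : ℂ :=
  φ a.1 * (((√(s : ℝ))⁻¹ : ℝ) : ℂ)

theorem excCreateVec_eq (φ : LuneSpace kF k) :
    (excCreateVec φ : Fock s →L[ℂ] Fock s) =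
      ∑ a, amp s φ a • (luneFamily kF s k).pairCreate a := by
  rw [excCreateVec, Fintype.sum_prod_type]
  refine Finset.sum_congr rfl fun p _ => ?_
  rw [excCreate, smul_smul, Finset.smul_sum]
  rfl

theorem norm_sq_amp (φ : LuneSpace kF k) (a : lune kF k × Fin s) :
    ‖amp s φ a‖ ^ 2 = ‖φ a.1‖ ^ 2 / s := by
  rw [amp, norm_mul, mul_pow, Complex.norm_real, Real.norm_eq_abs, sq_abs, inv_pow,
    Real.sq_sqrt (Nat.cast_nonneg s), div_eq_mul_inv]

theorem sum_norm_sq_amp (hs : 1 ≤ s) {φ : LuneSpace kF k} (hφ : ‖φ‖ = 1) :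
    ∑ a, ‖amp s φ a‖ ^ 2 = 1 := by
  have hs' : (s : ℝ) ≠ 0 := by exact_mod_cast (by omega : s ≠ 0)
  simp only [norm_sq_amp]
  rw [Fintype.sum_prod_type]
  simp only [Finset.sum_const, Finset.card_univ, Fintype.card_fin, nsmul_eq_mul]
  rw [Finset.sum_congr rfl fun p _ => mul_div_cancel₀ _ hs', ← EuclideanSpace.norm_sq_eq, hφ,
    one_pow]

/-- `∑_{|A| = M} ∏_{a ∈ A} φ_a / √s |A⟩`. -/
def modeState (s : ℕ) (φ : LuneSpace kF k) (M : ℕ) : Fock s :=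
  (luneFamily kF s k).pairState (amp s φ) M

theorem plasmonState_eq (φ : LuneSpace kF k) (M : ℕ) :
    plasmonState s φ M = (M.factorial : ℂ) • modeState s φ M := by
  rw [plasmonState, excCreateVec_eq, modeState, ← PairFamily.pow_sum_pairCreate_ket_empty,
    PairFamily.ket_empty, fermiState_eq]
  rfl

theorem plasmonStateNormalized_eq (φ : LuneSpace kF k) (M : ℕ) :
    plasmonStateNormalized s φ M = ((‖modeState s φ M‖⁻¹ : ℝ) : ℂ) • modeState s φ M := by
  have h : (M.factorial : ℂ) ≠ 0 := by exact_mod_cast M.factorial_ne_zero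
  rw [plasmonStateNormalized, plasmonState_eq, smul_smul, norm_smul]
  congr 1
  rw [Complex.norm_natCast, mul_inv]
  push_cast
  field_simp

theorem excCreateVec_modeState (φ : LuneSpace kF k) (m : ℕ) :
    excCreateVec φ (modeState s φ m) = ((m : ℂ) + 1) • modeState s φ (m + 1) := by
  rw [excCreateVec_eq, modeState, PairFamily.sum_pairCreate_pairState, modeState]

theorem excCreateVec_add (φ ψ : LuneSpace kF k) :
    (excCreateVec (φ + ψ) : Fock s →L[ℂ] Fock s) = excCreateVec φ + excCreateVec ψ := by
  simp only [excCreateVec, PiLp.add_apply, add_smul, Finset.sum_add_distrib]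

theorem excCreateVec_smul (z : ℂ) (φ : LuneSpace kF k) :
    (excCreateVec (z • φ) : Fock s →L[ℂ] Fock s) = z • excCreateVec φ := by
  simp only [excCreateVec, PiLp.smul_apply, smul_eq_mul, mul_smul, Finset.smul_sum]

theorem modeState_mem_particleSector (φ : LuneSpace kF k) (M : ℕ) :
    modeState s φ M ∈ particleSector s (particleNumber kF s) := by
  intro S hS
  by_contra hc
  obtain ⟨A, rfl, -⟩ := PairFamily.pairState_apply_ne_zero _ hc
  refine hS ?_
  rw [PairFamily.card_slater]
  change (fermiModes kF s).card = _
  rw [fermiModes, Finset.card_product, Finset.card_univ, Fintype.card_fin, particleNumber,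
    mul_comm]

/-! ### The kinetic energy -/

/-- The particle mode of a pair as a mode outside the Fermi ball. -/
def partOutside (a : lune kF k × Fin s) : {a : Mode s // a.1 ∉ fermiBall kF} :=
  ⟨(luneFamily kF s k).part a, fun h =>
    (luneFamily kF s k).part_notMem a (mem_fermiModes.2 (mem_fermiBall.1 h))⟩

theorem partOutside_injective : Function.Injective (partOutside (kF := kF) (s := s) (k := k)) :=
  fun _ _ h => (luneFamily kF s k).part_injective (congrArg Subtype.val h)

theorem kinTerm_modeState_eq_zero (φ : LuneSpace kF k) (M : ℕ)
    {m : {a : Mode s // a.1 ∉ fermiBall kF}} (hm : m ∉ Set.range (partOutside (k := k))) :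
    kinTerm kF (modeState s φ M) m = 0 := by
  rw [kinTerm, modeState, PairFamily.pairState, map_sum, map_sum, Finset.sum_eq_zero, smul_zero]
  intro A _
  rw [map_smul, map_smul, PairFamily.create_annihilate_ket, if_neg, smul_zero]
  intro h
  rcases (PairFamily.mem_slater _).1 h with ⟨h1, -⟩ | ⟨a, -, ha⟩
  · exact m.2 (mem_fermiBall.2 (mem_fermiModes.1 h1))
  · exact hm ⟨a, Subtype.ext ha⟩

theorem summable_kinTerm_modeState (φ : LuneSpace kF k) (M : ℕ) :
    Summable (kinTerm kF (modeState s φ M)) :=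
  (partOutside_injective.summable_iff fun _ hm => kinTerm_modeState_eq_zero φ M hm).1
    (Summable.of_finite)

/-- Each ket is an eigenvector: every excited pair costs |p|² − |p − k|² = 2λ_{k,p}. -/
theorem kinetic_modeState (φ : LuneSpace kF k) (M : ℕ) :
    (∑' a, kinTerm kF (modeState s φ M) a) - kinHole kF (modeState s φ M) =
      ∑ A ∈ Finset.powersetCard M (Finset.univ : Finset (lune kF k × Fin s)),
        ((∑ a ∈ A, ((2 * lam k a.1 : ℝ) : ℂ)) * ∏ a ∈ A, amp s φ a) •
          (luneFamily kF s k).ket A := by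
  have hsupp : Function.support (kinTerm kF (modeState s φ M)) ⊆
      Set.range (partOutside (k := k)) := by
    intro m hm
    by_contra hc
    exact hm (kinTerm_modeState_eq_zero φ M hc)
  rw [← partOutside_injective.tsum_eq hsupp, tsum_fintype, kinHole, ← Finset.sum_product'
    (fermiBall kF) Finset.univ (fun (p : Momentum) (σ : Fin s) =>
      (sqLen p : ℂ) • annihilate (p, σ) (create (p, σ) (modeState s φ M)))]
  have h1 : ∀ a : lune kF k × Fin s, kinTerm kF (modeState s φ M) (partOutside a) =
      ∑ A ∈ Finset.powersetCard M (Finset.univ : Finset (lune kF k × Fin s)),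
        ((if a ∈ A then (sqLen a.1 : ℂ) else 0) * ∏ a ∈ A, amp s φ a) •
          (luneFamily kF s k).ket A := by
    intro a
    rw [kinTerm, modeState, PairFamily.pairState, map_sum, map_sum, Finset.smul_sum]
    refine Finset.sum_congr rfl fun A _ => ?_
    rw [map_smul, map_smul, PairFamily.create_annihilate_ket]
    change _ • _ • (if (luneFamily kF s k).part a ∈ _ then _ else _) = _
    simp only [PairFamily.part_mem_slater]
    split_ifs
    · rw [smul_smul]; rfl
    · simp
  have h2 : ∀ m ∈ fermiBall kF ×ˢ (Finset.univ : Finset (Fin s)),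
      (sqLen m.1 : ℂ) • annihilate m (create m (modeState s φ M)) =
      ∑ A ∈ Finset.powersetCard M (Finset.univ : Finset (lune kF k × Fin s)),
        ((if m ∈ (luneFamily kF s k).slater A then 0 else (sqLen m.1 : ℂ)) *
          ∏ a ∈ A, amp s φ a) • (luneFamily kF s k).ket A := by
    intro m _
    rw [modeState, PairFamily.pairState, map_sum, map_sum, Finset.smul_sum]
    refine Finset.sum_congr rfl fun A _ => ?_
    rw [map_smul, map_smul, PairFamily.annihilate_create_ket]
    split_ifs
    · simp
    · rw [smul_smul]
  rw [Finset.sum_congr rfl fun a _ => h1 a, Finset.sum_congr rfl h2, Finset.sum_comm,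
    Finset.sum_comm (s := fermiBall kF ×ˢ Finset.univ), ← Finset.sum_sub_distrib]
  refine Finset.sum_congr rfl fun A _ => ?_
  rw [← Finset.sum_smul, ← Finset.sum_smul, ← sub_smul, ← Finset.sum_mul, ← Finset.sum_mul,
    ← sub_mul]
  congr 2
  have h3 : ∑ m ∈ fermiBall kF ×ˢ (Finset.univ : Finset (Fin s)),
      (if m ∈ (luneFamily kF s k).slater A then 0 else (sqLen m.1 : ℂ)) =
      ∑ a ∈ A, (sqLen (a.1 - k) : ℂ) := by
    have h4 : ∀ m : Mode s, (if m ∈ (luneFamily kF s k).slater A then 0 else (sqLen m.1 : ℂ)) =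
        if m ∉ (luneFamily kF s k).slater A then (sqLen m.1 : ℂ) else 0 := by
      intro m; rw [ite_not]
    simp only [h4]
    rw [← Finset.sum_filter, ← Finset.sdiff_eq_filter]
    change ∑ m ∈ (luneFamily kF s k).F \ (luneFamily kF s k).slater A, _ = _
    rw [PairFamily.sdiff_slater, Finset.sum_image fun a _ b _ h =>
      (luneFamily kF s k).hole_injective h]
    rfl
  rw [h3, Finset.sum_ite_mem, Finset.univ_inter, ← Finset.sum_sub_distrib]
  refine Finset.sum_congr rfl fun a _ => ?_
  rw [lam]
  push_cast
  ring

/-- The additive eigenvalue Σ 2λ acts as a derivation on the product of amplitudes, replacing one φ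
by 2hφ without error. -/
theorem kinetic_modeState_succ (φ : LuneSpace kF k) (m : ℕ) :
    (∑' a, kinTerm kF (modeState s φ (m + 1)) a) - kinHole kF (modeState s φ (m + 1)) =
      (2 : ℂ) • excCreateVec (hOp kF k φ) (modeState s φ m) := by
  rw [kinetic_modeState, ← PairFamily.sum_smul_pairCreate_pairState, excCreateVec_eq,
    ← smul_apply, Finset.smul_sum, modeState]
  congr 1
  refine Finset.sum_congr rfl fun a _ => ?_
  rw [smul_smul, amp, amp, hOp_apply]
  congr 1
  push_cast
  ring

end LuneFamily

/-! ### The action of the effective Hamiltonian on plasmon states -/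

section Error

variable {kF : ℝ} {s : ℕ} {k : Momentum} {V : Momentum → ℝ} {φ : LuneSpace kF k}

/-- The part of `c*_{p-l,σ} c_{p,σ}` acting on a plasmon state that is not the bosonic
annihilation of a plasmon. -/
def errVec (s : ℕ) (φ : LuneSpace kF k) (m : ℕ) (l p : Momentum) (σ : Fin s) : Fock s :=
  hop (p - l, σ) (p, σ) (modeState s φ (m + 1)) -
    if h : l = k ∧ p ∈ lune kF k then amp s φ (⟨p, h.2⟩, σ) • modeState s φ m else 0

theorem errVec_of_ne {m : ℕ} {l p : Momentum} {σ : Fin s} (hl : l ≠ k) :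
    errVec s φ m l p σ = hop (p - l, σ) (p, σ) (modeState s φ (m + 1)) := by
  rw [errVec, dif_neg fun h => hl h.1, sub_zero]

theorem errVec_self {m : ℕ} {p : Momentum} {σ : Fin s} (hp : p ∈ lune kF k) :
    errVec s φ m k p σ =
      (luneFamily kF s k).pairAnnihilate (⟨p, hp⟩, σ)
        ((luneFamily kF s k).pairState (amp s φ) (m + 1)) -
      amp s φ (⟨p, hp⟩, σ) • (luneFamily kF s k).pairState (amp s φ) m := by
  rw [errVec, dif_pos ⟨rfl, hp⟩]
  rfl

theorem part_notMem_fermiModes {l p : Momentum} (hp : p ∈ lune kF l) (σ : Fin s) :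
    ((p, σ) : Mode s) ∉ (luneFamily kF s k).F := by
  change _ ∉ fermiModes kF s
  rw [mem_fermiModes, not_le]
  exact (mem_lune.1 hp).2

theorem hole_mem_fermiModes {l p : Momentum} (hp : p ∈ lune kF l) (σ : Fin s) :
    ((p - l, σ) : Mode s) ∈ (luneFamily kF s k).F :=
  mem_fermiModes.2 (mem_lune.1 hp).1

theorem hole_ne_of_ne {l p : Momentum} (hl : l ≠ k) (σ : Fin s) (a : lune kF k × Fin s)
    (ha : (luneFamily kF s k).part a = (p, σ)) :
    (luneFamily kF s k).hole a ≠ (p - l, σ) := by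
  intro h
  have h1 : (a.1 : Momentum) = p := congrArg Prod.fst ha
  have h2 : (a.1 : Momentum) - k = p - l := congrArg Prod.fst h
  rw [h1] at h2
  exact hl (sub_right_injective h2).symm

theorem norm_sq_errVec_le (hs : 1 ≤ s) (hφ : ‖φ‖ = 1) {β : ℝ} (hβ : ∀ a, ‖amp s φ a‖ ^ 2 ≤ β)
    {m : ℕ} (hm : (m + 1 : ℕ) * β ≤ 1 / 2) {l p : Momentum} (hp : p ∈ lune kF l) (σ : Fin s) :
    ‖errVec s φ m l p σ‖ ^ 2 ≤
      4 * ((m + 1 : ℕ) : ℝ) ^ 2 * β ^ 2 * ‖modeState s φ (m + 1)‖ ^ 2 := by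
  by_cases hl : l = k
  · subst hl
    rw [errVec_self hp]
    exact PairFamily.norm_sq_pairAnnihilate_sub_le _ (sum_norm_sq_amp hs hφ) hβ hm _
  · rw [errVec_of_ne hl]
    exact PairFamily.norm_sq_hop_pairState_le _ (sum_norm_sq_amp hs hφ) hβ hm
      (part_notMem_fermiModes hp σ) (hole_mem_fermiModes hp σ) (hole_ne_of_ne hl σ)

/-- In both cases the hole (p − k, σ) is open in T, whatever l is; with at most m holes in T, few
(p, σ) are possible. -/
theorem errVec_apply_ne_zero {m : ℕ} {l p : Momentum} (hp : p ∈ lune kF l) {σ : Fin s}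
    {T : Finset (Mode s)} (h : errVec s φ m l p σ T ≠ 0) :
    ExcitedAtMost kF m T ∧ (p - k, σ) ∈ fermiModes kF s \ T := by
  by_cases hl : l = k
  · subst hl
    rw [errVec_self hp] at h
    obtain ⟨h1, h2, h3⟩ := PairFamily.pairAnnihilate_sub_apply_ne_zero _ h
    exact ⟨⟨h1.le, h2.le⟩, h3⟩
  · rw [errVec_of_ne hl] at h
    obtain ⟨h1, h2, a, ha, h3⟩ := PairFamily.hop_pairState_apply_ne_zero _
      (part_notMem_fermiModes hp σ) (hole_mem_fermiModes hp σ) (hole_ne_of_ne hl σ) h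
    refine ⟨⟨(Nat.succ_injective h1).le, (Nat.succ_injective h2).le⟩, ?_⟩
    have h4 : (luneFamily kF s k).hole a = (p - k, σ) := by
      have h5 : (a.1 : Momentum) = p := congrArg Prod.fst ha
      have h6 : a.2 = σ := congrArg Prod.snd ha
      rw [← h5, ← h6]; rfl
    rw [← h4]
    exact h3

/-- Both the removed particle and the filled hole come from pairs of L_k. This leaves finitely many
l and makes the interaction series a finite sum on plasmon states. -/
theorem mem_of_errVec_ne_zero {m : ℕ} {l p : Momentum} (hp : p ∈ lune kF l) {σ : Fin s}
    (h : errVec s φ m l p σ ≠ 0) : p ∈ lune kF k ∧ p - l + k ∈ lune kF k := by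
  by_cases hl : l = k
  · subst hl
    exact ⟨hp, by rwa [sub_add_cancel]⟩
  · rw [errVec_of_ne hl] at h
    obtain ⟨⟨a, ha⟩, b, hb⟩ := PairFamily.exists_of_hop_pairState_ne_zero _
      (part_notMem_fermiModes hp σ) (hole_mem_fermiModes hp σ) h
    have h1 : (a.1 : Momentum) = p := congrArg Prod.fst ha
    have h2 : (b.1 : Momentum) - k = p - l := congrArg Prod.fst hb
    refine ⟨h1 ▸ a.1.2, ?_⟩
    rw [← h2, sub_add_cancel]
    exact b.1.2

/-- The error part of `Q_l` acting on a plasmon state. -/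
def errQuad (s : ℕ) (V : Momentum → ℝ) (φ : LuneSpace kF k) (m : ℕ)
    (l : {l : Momentum // l ≠ 0}) : Fock s :=
  ∑ p : lune kF l.1, excCreateVec (DOp kF s V l.1 (EuclideanSpace.single p 1))
    ((((√(s : ℝ))⁻¹ : ℝ) : ℂ) • ∑ σ : Fin s, errVec s φ m l.1 p σ)

theorem errQuad_eq_zero {m : ℕ} {l : {l : Momentum // l ≠ 0}}
    (hl : l.1 ∉ (lune kF k ×ˢ lune kF k).image fun x => x.1 - x.2 + k) :
    errQuad s V φ m l = 0 := by
  refine Finset.sum_eq_zero fun p _ => ?_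
  rw [Finset.sum_eq_zero, smul_zero, map_zero]
  intro σ _
  by_contra hc
  obtain ⟨h1, h2⟩ := mem_of_errVec_ne_zero p.2 hc
  refine hl (Finset.mem_image.2 ⟨((p : Momentum), (p : Momentum) - l.1 + k),
    Finset.mem_product.2 ⟨h1, h2⟩, ?_⟩)
  simp only
  abel

theorem exists_support_errQuad (V : Momentum → ℝ) (φ : LuneSpace kF k) (m : ℕ) :
    ∃ L : Finset {l : Momentum // l ≠ 0}, ∀ l, l ∉ L → errQuad s V φ m l = 0 := by
  have h : {l : {l : Momentum // l ≠ 0} |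
      l.1 ∈ (lune kF k ×ˢ lune kF k).image fun x => x.1 - x.2 + k}.Finite :=
    (Finset.finite_toSet _).preimage Subtype.val_injective.injOn
  exact ⟨h.toFinset, fun l hl => errQuad_eq_zero fun h' => hl (h.mem_toFinset.2 h')⟩

theorem sum_smul_single (φ : LuneSpace kF k) :
    ∑ p : lune kF k, φ p • (EuclideanSpace.single p 1 : LuneSpace kF k) = φ := by
  refine PiLp.ext fun q => ?_
  have h (p : lune kF k) : (φ p • (EuclideanSpace.single p 1 : LuneSpace kF k)) q =
      if q = p then φ p else 0 := by
    rw [PiLp.smul_apply, PiLp.single_apply, smul_eq_mul, mul_ite, mul_one, mul_zero]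
  rw [WithLp.ofLp_sum, Finset.sum_apply]
  simp only [h]
  rw [Finset.sum_ite_eq, if_pos (Finset.mem_univ _)]

theorem sum_excCreateVec_smul {k' : Momentum} (φ : LuneSpace kF k)
    (A : LuneSpace kF k →L[ℂ] LuneSpace kF k') (Ψ : Fock s) :
    ∑ p : lune kF k, excCreateVec (A (EuclideanSpace.single p 1)) (φ p • Ψ) =
      excCreateVec (A φ) Ψ := by
  have h : ∀ I : Finset (lune kF k), excCreateVec (∑ p ∈ I, φ p • A (EuclideanSpace.single p 1)) Ψ =
      ∑ p ∈ I, excCreateVec (A (EuclideanSpace.single p 1)) (φ p • Ψ) := by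
    intro I
    induction I using Finset.induction_on with
    | empty => simp [excCreateVec]
    | insert p I hp ih =>
      rw [Finset.sum_insert hp, Finset.sum_insert hp, ← ih, excCreateVec_add, excCreateVec_smul,
        map_smul]
      rfl
  rw [← h]
  conv_rhs => rw [← sum_smul_single φ, map_sum]
  simp only [map_smul]

theorem quadTerm_modeState (hs : 1 ≤ s) (m : ℕ) (l : {l : Momentum // l ≠ 0}) :
    quadTerm kF V (modeState s φ (m + 1)) l = errQuad s V φ m l +
      if l.1 = k then excCreateVec (DOp kF s V k φ) (modeState s φ m) else 0 := by
  have hs' : (√(s : ℝ)) ≠ 0 := by positivity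
  obtain ⟨l, hl0⟩ := l
  by_cases hl : l = k
  · subst hl
    rw [if_pos rfl, ← sum_excCreateVec_smul φ (DOp kF s V l), errQuad, ← Finset.sum_add_distrib]
    refine Finset.sum_congr rfl fun p _ => ?_
    rw [← map_add, excAnnihilate_apply]
    change excCreateVec (DOp kF s V l _) _ = _
    congr 1
    have h1 : ∀ σ : Fin s, errVec s φ m l p σ = hop ((p : Momentum) - l, σ) ((p : Momentum), σ)
        (modeState s φ (m + 1)) - amp s φ (p, σ) • modeState s φ m := by
      intro σ
      rw [errVec, dif_pos ⟨rfl, p.2⟩]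
    simp only [h1, amp, Finset.sum_sub_distrib, Finset.sum_const, Finset.card_univ,
      Fintype.card_fin]
    rw [smul_sub, ← Nat.cast_smul_eq_nsmul ℂ, smul_smul, smul_smul]
    -- The s spin components each contribute s^{-1/2} from b_{k,p} and s^{-1/2} from the amplitude.
    have h2 : (((√(s : ℝ))⁻¹ : ℝ) : ℂ) * (s : ℂ) * (φ p * (((√(s : ℝ))⁻¹ : ℝ) : ℂ)) = φ p := by
      have h3 : (√(s : ℝ))⁻¹ * (s * (√(s : ℝ))⁻¹) = 1 := by
        have h4 := Real.mul_self_sqrt (Nat.cast_nonneg (α := ℝ) s)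
        nth_rewrite 2 [← h4]
        field_simp
      have h5 : (((√(s : ℝ))⁻¹ * (s * (√(s : ℝ))⁻¹) : ℝ) : ℂ) = 1 := by rw [h3]; simp
      push_cast at h5 ⊢
      linear_combination φ p * h5
    rw [h2, sub_add_cancel]
  · rw [if_neg hl, add_zero, quadTerm, errQuad]
    refine Finset.sum_congr rfl fun p _ => ?_
    rw [excAnnihilate_apply]
    change excCreateVec (DOp kF s V l _) _ = _
    simp only [errVec_of_ne hl]

theorem summable_quadTerm_modeState_succ (hs : 1 ≤ s) (m : ℕ) :
    Summable (quadTerm kF V (modeState s φ (m + 1))) := by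
  have h : quadTerm kF V (modeState s φ (m + 1)) = fun l => errQuad s V φ m l +
      if l.1 = k then excCreateVec (DOp kF s V k φ) (modeState s φ m) else 0 :=
    funext fun l => quadTerm_modeState hs m l
  rw [h]
  obtain ⟨L, hL⟩ := exists_support_errQuad (s := s) V φ m
  refine (summable_of_ne_finset_zero (s := L) fun l hl => hL l hl).add ?_
  by_cases hk : k = 0
  · convert (summable_zero : Summable fun _ : {l : Momentum // l ≠ 0} => (0 : Fock s)) using 2
    rename_i l
    exact if_neg fun h => l.2 (h.trans hk)
  · refine summable_of_ne_finset_zero (s := {⟨k, hk⟩}) fun l hl => if_neg fun h => hl ?_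
    exact Finset.mem_singleton.2 (Subtype.ext h)

/-- The kinetic part 2hφ and the bosonic part 2Dφ add up to 2Ẽφ = ε_kφ, and creating one more
plasmon supplies the factor m + 1. -/
theorem heffFun_modeState_sub (hs : 1 ≤ s) (hk : k ≠ 0)
    (hφ : (2 : ℂ) • EOp kF s V k φ = (plasmonEnergy kF s V k : ℂ) • φ) (m : ℕ)
    {L : Finset {l : Momentum // l ≠ 0}} (hL : ∀ l, l ∉ L → errQuad s V φ m l = 0) :
    heffFun kF V (modeState s φ (m + 1)) -
      (((m + 1 : ℕ) * plasmonEnergy kF s V k : ℝ) : ℂ) • modeState s φ (m + 1) =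
        (2 : ℂ) • ∑ l ∈ L, errQuad s V φ m l := by
  have h1 : HasSum (fun l : {l : Momentum // l ≠ 0} =>
      if l.1 = k then excCreateVec (DOp kF s V k φ) (modeState s φ m) else 0)
      (excCreateVec (DOp kF s V k φ) (modeState s φ m)) := by
    convert hasSum_ite_eq (⟨k, hk⟩ : {l : Momentum // l ≠ 0})
      (excCreateVec (DOp kF s V k φ) (modeState s φ m)) using 3
    rw [Subtype.ext_iff]
  have h2 : HasSum (errQuad s V φ m) (∑ l ∈ L, errQuad s V φ m l) := hasSum_sum_of_ne_finset_zero hL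
  have h3 : quadTerm kF V (modeState s φ (m + 1)) = fun l => errQuad s V φ m l +
      if l.1 = k then excCreateVec (DOp kF s V k φ) (modeState s φ m) else 0 :=
    funext fun l => quadTerm_modeState hs m l
  rw [heffFun, kinetic_modeState_succ, h3, (h2.add h1).tsum_eq]
  have h4 : (2 : ℂ) • (excCreateVec (hOp kF k φ) (modeState s φ m) : Fock s) +
      (2 : ℂ) • excCreateVec (DOp kF s V k φ) (modeState s φ m) =
      (((m + 1 : ℕ) * plasmonEnergy kF s V k : ℝ) : ℂ) • modeState s φ (m + 1) := by
    rw [← smul_add, ← add_apply, ← excCreateVec_add, DOp, sub_apply, add_sub_cancel, ← smul_apply,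
      ← excCreateVec_smul, hφ, excCreateVec_smul, smul_apply, excCreateVec_modeState, smul_smul]
    congr 1
    push_cast
    ring
  rw [← h4, smul_add]
  abel

/-- The vector multiplying `b*_{l,q}` in the error. -/
def errCoeff (s : ℕ) (V : Momentum → ℝ) (φ : LuneSpace kF k) (m : ℕ) (x : LunePair kF) : Fock s :=
  ∑ y : lune kF x.1.1 × Fin s,
    (DOp kF s V x.1.1 (EuclideanSpace.single y.1 1) x.2 * (((√(s : ℝ))⁻¹ : ℝ) : ℂ)) •
      errVec s φ m x.1.1 y.1 y.2

theorem sum_errQuad (m : ℕ) (L : Finset {l : Momentum // l ≠ 0}) :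
    ∑ l ∈ L, errQuad s V φ m l =
      ∑ x ∈ L.sigma fun _ => Finset.univ,
        excCreate x.1.1 (x.2 : Momentum) (errCoeff s V φ m x) := by
  rw [Finset.sum_sigma]
  refine Finset.sum_congr rfl fun l _ => ?_
  simp only [errQuad, excCreateVec, sum_apply, smul_apply]
  rw [Finset.sum_comm]
  refine Finset.sum_congr rfl fun q _ => ?_
  rw [errCoeff, Fintype.sum_prod_type, map_sum]
  refine Finset.sum_congr rfl fun p _ => ?_
  rw [← map_smul, smul_smul, Finset.smul_sum]

theorem errCoeff_apply_ne_zero {m : ℕ} {x : LunePair kF} {T : Finset (Mode s)}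
    (h : errCoeff s V φ m x T ≠ 0) : ExcitedAtMost kF m T := by
  rw [errCoeff, lp_sum_apply] at h
  obtain ⟨y, -, hy⟩ := Finset.exists_ne_zero_of_sum_ne_zero h
  rw [lp.coeFn_smul, Pi.smul_apply] at hy
  exact (errVec_apply_ne_zero y.1.2 (right_ne_zero_of_smul hy)).1

theorem card_errVec_overlap_le {m : ℕ} (l : Momentum) (T : Finset (Mode s)) :
    ((Finset.univ : Finset (lune kF l × Fin s)).filter fun y =>
      errVec s φ m l y.1 y.2 T ≠ 0).card ≤ m + 1 := by
  rcases ((Finset.univ : Finset (lune kF l × Fin s)).filter fun y =>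
      errVec s φ m l y.1 y.2 T ≠ 0).eq_empty_or_nonempty with h | ⟨y, hy⟩
  · rw [h]; simp
  · have h1 := (errVec_apply_ne_zero y.1.2 (Finset.mem_filter.1 hy).2).1.2
    refine le_trans ?_ (h1.trans m.le_succ)
    refine Finset.card_le_card_of_injOn (fun y => ((y.1 : Momentum) - k, y.2)) ?_ ?_
    · intro y hy
      exact (errVec_apply_ne_zero y.1.2 (Finset.mem_filter.1 hy).2).2
    · rintro ⟨p, σ⟩ - ⟨q, τ⟩ - h
      simp only [Prod.mk.injEq, sub_left_inj] at h
      exact Prod.ext (Subtype.ext h.1) h.2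

theorem norm_sq_errCoeff_le (hs : 1 ≤ s) (hφ : ‖φ‖ = 1) {β : ℝ}
    (hβ : ∀ a, ‖amp s φ a‖ ^ 2 ≤ β) {m : ℕ} (hm : (m + 1 : ℕ) * β ≤ 1 / 2) (x : LunePair kF) :
    ‖errCoeff s V φ m x‖ ^ 2 ≤ ((m + 1 : ℕ) : ℝ) *
      ((∑ p : lune kF x.1.1, ‖DOp kF s V x.1.1 (EuclideanSpace.single p 1) x.2‖ ^ 2) *
        (4 * ((m + 1 : ℕ) : ℝ) ^ 2 * β ^ 2 * ‖modeState s φ (m + 1)‖ ^ 2)) := by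
  have hs' : (s : ℝ) ≠ 0 := by exact_mod_cast (by omega : s ≠ 0)
  refine (norm_sq_sum_le_of_overlap _ _ _ (card_errVec_overlap_le x.1.1)).trans ?_
  refine mul_le_mul_of_nonneg_left ?_ (Nat.cast_nonneg _)
  rw [Fintype.sum_prod_type, Finset.sum_mul]
  refine Finset.sum_le_sum fun p _ => ?_
  set Γ := 4 * ((m + 1 : ℕ) : ℝ) ^ 2 * β ^ 2 * ‖modeState s φ (m + 1)‖ ^ 2
  set d := ‖DOp kF s V x.1.1 (EuclideanSpace.single p 1) x.2‖ ^ 2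
  calc _ ≤ ∑ _σ : Fin s, d / s * Γ := by
        refine Finset.sum_le_sum fun σ _ => ?_
        have h1 : ‖DOp kF s V x.1.1 (EuclideanSpace.single p 1) x.2 *
            (((√(s : ℝ))⁻¹ : ℝ) : ℂ)‖ ^ 2 = d / s := by
          rw [norm_mul, mul_pow, Complex.norm_real, Real.norm_eq_abs, sq_abs, inv_pow,
            Real.sq_sqrt (Nat.cast_nonneg s), div_eq_mul_inv]
        rw [h1]
        have h2 : 0 ≤ d / s := by positivity
        exact mul_le_mul_of_nonneg_left (norm_sq_errVec_le hs hφ hβ hm p.2 σ) h2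
    _ = d * Γ := by
        rw [Finset.sum_const, Finset.card_univ, Fintype.card_fin, nsmul_eq_mul]
        field_simp

/-- The fifth power collects (m+1)² from the creation bound, m+1 from the overlaps, and (m+1)² from
the size of `errVec`. -/
theorem norm_sq_sum_errQuad_le (hs : 1 ≤ s) (hφ : ‖φ‖ = 1) {β : ℝ}
    (hβ : ∀ a, ‖amp s φ a‖ ^ 2 ≤ β) {m : ℕ} (hm : (m + 1 : ℕ) * β ≤ 1 / 2)
    (L : Finset {l : Momentum // l ≠ 0}) :
    ‖∑ l ∈ L, errQuad s V φ m l‖ ^ 2 ≤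
      4 * ((m + 1 : ℕ) : ℝ) ^ 5 * β ^ 2 * ‖modeState s φ (m + 1)‖ ^ 2 *
        ∑ l ∈ L, hsNormSq kF s V l.1 := by
  rw [sum_errQuad]
  refine (norm_sq_sum_excCreate_le hs _ fun x _ T hT => errCoeff_apply_ne_zero hT).trans ?_
  set Γ := 4 * ((m + 1 : ℕ) : ℝ) ^ 2 * β ^ 2 * ‖modeState s φ (m + 1)‖ ^ 2 with hΓ
  calc _ ≤ ((m + 1 : ℕ) : ℝ) ^ 2 * ∑ l ∈ L, ((m + 1 : ℕ) : ℝ) * (hsNormSq kF s V l.1 * Γ) := by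
        gcongr
        rw [Finset.sum_sigma]
        refine Finset.sum_le_sum fun l _ => ?_
        refine (Finset.sum_le_sum fun q _ => norm_sq_errCoeff_le hs hφ hβ hm ⟨l, q⟩).trans ?_
        rw [← Finset.mul_sum, ← Finset.sum_mul]
        have h : ∑ q : lune kF l.1, ∑ p : lune kF l.1,
            ‖DOp kF s V l.1 (EuclideanSpace.single p 1) q‖ ^ 2 = hsNormSq kF s V l.1 :=
          Finset.sum_comm
        exact le_of_eq (congrArg (fun t => ((m + 1 : ℕ) : ℝ) * (t * Γ)) h)
    _ = _ := by
        rw [← Finset.mul_sum, ← Finset.sum_mul, hΓ]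
        ring

/-! ### The vacuum -/

theorem excAnnihilate_modeState_zero {l p : Momentum} (hp : p ∈ lune kF l) :
    excAnnihilate l p (modeState s φ 0) = 0 := by
  rw [excAnnihilate_apply, Finset.sum_eq_zero, smul_zero]
  intro σ _
  rw [modeState, PairFamily.pairState, Finset.powersetCard_zero, Finset.sum_singleton,
    PairFamily.ket_empty, map_smul, hop, ContinuousLinearMap.comp_apply, annihilate_slaterDet,
    if_neg (part_notMem_fermiModes hp σ), map_zero, smul_zero]

theorem quadTerm_modeState_zero : quadTerm kF V (modeState s φ 0) = fun _ => 0 := by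
  funext l
  exact Finset.sum_eq_zero fun p _ => by rw [excAnnihilate_modeState_zero p.2, map_zero]

theorem heffFun_modeState_zero : heffFun kF V (modeState s φ 0) = 0 := by
  rw [heffFun, kinetic_modeState, quadTerm_modeState_zero]
  simp

theorem modeState_mem_domain (hs : 1 ≤ s) (M : ℕ) :
    modeState s φ M ∈ (Heff kF s V).domain := by
  refine ⟨modeState_mem_particleSector φ M, summable_kinTerm_modeState φ M, ?_⟩
  cases M with
  | zero => rw [quadTerm_modeState_zero]; exact summable_zero
  | succ m => exact summable_quadTerm_modeState_succ hs m

/-- The quasi-eigenvalue estimate in terms of the Hilbert–Schmidt norms of `Ẽ_l - h_l`. -/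
theorem norm_Heff_sub_le (hs : 1 ≤ s) (hk : k ≠ 0) (hφ : IsPlasmonMode kF s V k φ) {β : ℝ}
    (hβ : ∀ a, ‖amp s φ a‖ ^ 2 ≤ β) {M : ℕ} (hM : M * β ≤ 1 / 2) :
    ‖plasmonStateNormalized s φ M‖ = 1 ∧
    ∃ hdom : plasmonStateNormalized s φ M ∈ (Heff kF s V).domain,
      ∃ L : Finset {l : Momentum // l ≠ 0},
        ‖Heff kF s V ⟨plasmonStateNormalized s φ M, hdom⟩ -
          ((M * plasmonEnergy kF s V k : ℝ) : ℂ) • plasmonStateNormalized s φ M‖ ^ 2 ≤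
          16 * (M : ℝ) ^ 5 * β ^ 2 * ∑ l ∈ L, hsNormSq kF s V l.1 := by
  have hpos : 0 < ‖modeState s φ M‖ :=
    PairFamily.pairState_norm_pos _ (sum_norm_sq_amp hs hφ.1) hβ hM
  have hdom0 := modeState_mem_domain (kF := kF) (V := V) (φ := φ) hs M
  rw [plasmonStateNormalized_eq]
  refine ⟨?_, Submodule.smul_mem _ _ hdom0, ?_⟩
  · rw [norm_smul, Complex.norm_real, norm_inv, norm_norm, inv_mul_cancel₀ hpos.ne']
  change ∃ L : Finset {l : Momentum // l ≠ 0}, ‖heffFun kF V _ - _‖ ^ 2 ≤ _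
  rw [heffFun_smul _ _ _ hdom0, smul_comm, ← smul_sub, norm_smul, Complex.norm_real, norm_inv,
    norm_norm, mul_pow, inv_pow]
  cases M with
  | zero =>
    refine ⟨∅, ?_⟩
    rw [heffFun_modeState_zero]
    simp
  | succ m =>
    obtain ⟨L, hL⟩ := exists_support_errQuad (s := s) V φ m
    refine ⟨L, ?_⟩
    rw [heffFun_modeState_sub hs hk hφ.2 m hL, norm_smul, mul_pow, inv_mul_le_iff₀ (by positivity)]
    have h := norm_sq_sum_errQuad_le (V := V) hs hφ.1 hβ hM L
    rw [Complex.norm_ofNat]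
    calc _ ≤ 2 ^ 2 * _ := mul_le_mul_of_nonneg_left h (by norm_num)
      _ = _ := by ring

end Error

/-! ### Quantitative bounds -/

section Quantitative

variable {kF : ℝ} {s : ℕ} {V : Momentum → ℝ} {k : Momentum}

theorem torus_volume_bounds : 432 ≤ 2 * (2 * Real.pi) ^ 3 ∧ 2 * (2 * Real.pi) ^ 3 ≤ 500 := by
  have h1 : 6 ≤ 2 * Real.pi := by linarith [Real.pi_gt_three]
  have h2 : 2 * Real.pi ≤ 6.2832 := by linarith [Real.pi_lt_d4]
  have h3 : (6 : ℝ) ^ 3 ≤ (2 * Real.pi) ^ 3 := pow_le_pow_left₀ (by norm_num) h1 3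
  have h4 : (2 * Real.pi) ^ 3 ≤ 6.2832 ^ 3 := pow_le_pow_left₀ (by linarith) h2 3
  constructor
  · linarith
  · norm_num at h4; linarith

theorem coupling_le (hV : 0 ≤ V k) : coupling s V k ≤ s * V k / 432 := by
  have := torus_volume_bounds.1
  exact div_le_div_of_nonneg_left (by positivity) (by norm_num) this

theorem le_coupling (hV : 0 ≤ V k) : s * V k / 500 ≤ coupling s V k := by
  have := torus_volume_bounds
  exact div_le_div_of_nonneg_left (by positivity) (by linarith) this.2

theorem le_sum_lam (hK : 2 ≤ kF) : len k ^ 2 * kF ^ 3 / 16 ≤ ∑ p ∈ lune kF k, lam k p := by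
  rw [sum_lam, len_sq]
  have h := mul_le_mul_of_nonneg_left (le_card_fermiBall hK) (sqLen_nonneg k)
  linarith

theorem sum_lam_le (hK : 1 ≤ kF) : ∑ p ∈ lune kF k, lam k p ≤ 27 / 2 * (sqLen k * kF ^ 3) := by
  rw [sum_lam]
  have h := mul_le_mul_of_nonneg_left (card_fermiBall_le hK) (sqLen_nonneg k)
  linarith

theorem le_coupling_mul_sum_lam (hK : 2 ≤ kF) (hV : 0 ≤ V k) :
    s * V k * len k ^ 2 * kF ^ 3 / 8000 ≤ coupling s V k * ∑ p ∈ lune kF k, lam k p := by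
  have h := mul_le_mul (le_coupling (s := s) hV) (le_sum_lam (k := k) hK) (by positivity)
    (coupling_nonneg hV)
  linarith

/-- The Hilbert–Schmidt bound in terms of the summand of the error bound. -/
theorem hsNormSq_le_errorTerm (hK : 1 ≤ kF) (l : {l : Momentum // l ≠ 0}) (hV : 0 ≤ V l.1) :
    hsNormSq kF s V l.1 ≤ s ^ 2 * kF ^ 3 * errorTerm kF V l := by
  have hl : 0 < sqLen l.1 := by linarith [one_le_sqLen l.2]
  have hc := coupling_nonneg (s := s) hV
  have hcs := coupling_le (s := s) hV
  have hK0 : 0 < kF := by linarith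
  -- The column bound is linear in s, the entry bounds quadratic; with s² throughout, the spin
  -- cancels against β² later.
  have hss : (s : ℝ) ≤ (s : ℝ) ^ 2 := by
    exact_mod_cast Nat.le_self_pow two_ne_zero s
  have h1 : hsNormSq kF s V l.1 ≤ s ^ 2 * kF ^ 3 * (1 * (V l.1 * sqLen l.1)) := by
    calc hsNormSq kF s V l.1 ≤ 2 * coupling s V l.1 * ∑ p ∈ lune kF l.1, lam l.1 p :=
          hsNormSq_le_sum_lam hV
      _ ≤ 2 * (s * V l.1 / 432) * (27 / 2 * (sqLen l.1 * kF ^ 3)) := by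
          have := sum_lam_le (k := l.1) hK
          have h0 : 0 ≤ ∑ p ∈ lune kF l.1, lam l.1 p :=
            Finset.sum_nonneg fun p hp => (lam_pos hp).le
          gcongr
      _ = (s : ℝ) * (kF ^ 3 * (V l.1 * sqLen l.1)) / 16 := by ring
      _ ≤ (s : ℝ) ^ 2 * (kF ^ 3 * (V l.1 * sqLen l.1)) := by
          have : (s : ℝ) * (kF ^ 3 * (V l.1 * sqLen l.1)) ≤
            (s : ℝ) ^ 2 * (kF ^ 3 * (V l.1 * sqLen l.1)) := by gcongr
          have h0 : 0 ≤ (s : ℝ) * (kF ^ 3 * (V l.1 * sqLen l.1)) := by positivity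
          linarith
      _ = _ := by ring
  have h2 : hsNormSq kF s V l.1 ≤ s ^ 2 * kF ^ 3 * (kF * V l.1 * (V l.1 * sqLen l.1)) := by
    calc hsNormSq kF s V l.1 ≤ (coupling s V l.1 * (lune kF l.1).card) ^ 2 := hsNormSq_le_card hV
      _ ≤ (s * V l.1 / 27 * (27 * kF ^ 2 * len l.1)) ^ 2 := by
          have := card_lune_le hK l.1
          have h0 : coupling s V l.1 ≤ s * V l.1 / 27 := by
            have : 0 ≤ s * V l.1 := by positivity
            linarith
          gcongr
      _ = s ^ 2 * V l.1 ^ 2 * kF ^ 4 * len l.1 ^ 2 := by ring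
      _ = _ := by rw [len_sq]; ring
  have h3 : hsNormSq kF s V l.1 ≤
      s ^ 2 * kF ^ 3 * (kF ^ 3 * V l.1 / sqLen l.1 * (V l.1 * sqLen l.1)) := by
    calc hsNormSq kF s V l.1 ≤ (coupling s V l.1 * (lune kF l.1).card) ^ 2 := hsNormSq_le_card hV
      _ ≤ (s * V l.1 / 27 * (27 * kF ^ 3)) ^ 2 := by
          have := (Nat.cast_le.2 (card_lune_le_card_fermiBall kF l.1)).trans (card_fermiBall_le hK)
          have h0 : coupling s V l.1 ≤ s * V l.1 / 27 := by
            have : 0 ≤ s * V l.1 := by positivity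
            linarith
          gcongr
      _ = _ := by field_simp
  have h4 : (s : ℝ) ^ 2 * kF ^ 3 * errorTerm kF V l =
      min (s ^ 2 * kF ^ 3 * (1 * (V l.1 * sqLen l.1)))
      (min (s ^ 2 * kF ^ 3 * (kF * V l.1 * (V l.1 * sqLen l.1)))
        (s ^ 2 * kF ^ 3 * (kF ^ 3 * V l.1 / sqLen l.1 * (V l.1 * sqLen l.1)))) := by
    have h0 : 0 ≤ V l.1 * sqLen l.1 := by positivity
    have h5 : (0 : ℝ) ≤ s ^ 2 * kF ^ 3 := by positivity
    rw [← mul_min_of_nonneg _ _ h5, ← mul_min_of_nonneg _ _ h5, ← min_mul_of_nonneg _ _ h0,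
      ← min_mul_of_nonneg _ _ h0, errorTerm, mul_assoc (min _ _)]
  rw [h4]
  exact le_min h1 (le_min h2 h3)

/-- The hypotheses on the momentum and the potential under which a plasmon exists. -/
structure PlasmonRegime (kF : ℝ) (s : ℕ) (V : Momentum → ℝ) (k : Momentum) : Prop where
  two_le : 2 ≤ kF
  one_le_spin : 1 ≤ s
  ne_zero : k ≠ 0
  len_le : len k ≤ kF
  lt_potential : 18000 < kF * V k

namespace PlasmonRegime

variable (h : PlasmonRegime kF s V k)
include h

theorem pos : 0 < kF := by linarith [h.two_le]

theorem potential_pos : 0 < V k := by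
  have := h.lt_potential
  exact pos_of_mul_pos_right (by linarith : 0 < kF * V k) h.pos.le

theorem len_pos : 0 < len k := by linarith [one_le_len h.ne_zero]

theorem one_le_spin_cast : (1 : ℝ) ≤ s := by exact_mod_cast h.one_le_spin

theorem nonempty : (lune kF k).Nonempty := lune_nonempty h.two_le h.ne_zero

theorem coupling_pos : 0 < coupling s V k := by
  have h1 := h.one_le_spin_cast
  have h2 := h.potential_pos
  have h3 : 0 < s * V k / 500 := by positivity
  exact h3.trans_le (le_coupling h2.le)

theorem le_gap : s * V k * len k ^ 2 * kF ^ 3 / 8000 ≤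
    coupling s V k * ∑ p ∈ lune kF k, lam k p :=
  le_coupling_mul_sum_lam h.two_le h.potential_pos.le

theorem lam_bound : ∀ p ∈ lune kF k, lam k p ≤ 3 / 2 * (kF * len k) :=
  fun _ hp => lam_le h.len_le hp

/-- This fixes the threshold: 18000 = (3/2)² · 8000, from λ ≤ (3/2)k_F|k| and the lower bound on κm.
-/
theorem gap : (3 / 2 * (kF * len k)) ^ 2 ≤ coupling s V k * ∑ p ∈ lune kF k, lam k p := by
  refine le_trans ?_ h.le_gap
  have h1 : 18000 ≤ (s : ℝ) * (kF * V k) := by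
    have := h.lt_potential
    nlinarith [h.one_le_spin_cast]
  have h2 := h.pos
  have h3 : 18000 * (kF * len k) ^ 2 ≤ (s : ℝ) * (kF * V k) * (kF * len k) ^ 2 := by gcongr
  calc (3 / 2 * (kF * len k)) ^ 2 = 18000 * (kF * len k) ^ 2 / 8000 := by ring
    _ ≤ (s : ℝ) * (kF * V k) * (kF * len k) ^ 2 / 8000 := by gcongr
    _ = _ := by ring

theorem two_mul_le_energyLower :
    2 * (coupling s V k * ∑ p ∈ lune kF k, lam k p) ≤ energyLower kF s V k := by
  have h1 : 0 ≤ (∑ p ∈ lune kF k, lam k p ^ 3) / ∑ p ∈ lune kF k, lam k p :=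
    div_nonneg (Finset.sum_nonneg fun p hp => pow_nonneg (lam_pos hp).le 3)
      (sum_lam_pos h.nonempty).le
  rw [energyLower]
  linarith

theorem sqrt_energyLower_le : √(energyLower kF s V k) ≤ plasmonEnergy kF s V k / 2 := by
  rw [Real.sqrt_le_left (by linarith [plasmonEnergy_nonneg (s := s) (V := V) h.nonempty])]
  exact energyLower_le h.nonempty h.coupling_pos h.potential_pos.le

/-- The constant is (3/2)⁴ · 8000. -/
theorem sq_sub_le : (plasmonEnergy kF s V k / 2) ^ 2 - energyLower kF s V k ≤
    40500 * (kF * len k ^ 2 / (s * V k)) := by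
  refine (sq_sub_energyLower_le h.nonempty h.coupling_pos h.potential_pos.le h.lam_bound
    h.gap).trans ?_
  have h1 := h.one_le_spin_cast
  have h2 := h.potential_pos
  have h3 := h.len_pos
  have h4 := h.pos
  refine (div_le_div_of_nonneg_left (by positivity) (by positivity) h.le_gap).trans (le_of_eq ?_)
  field_simp
  norm_num

theorem sqrt_gap_le : √(s * V k) * len k * (kF * √kF) / 90 ≤ √(energyLower kF s V k) := by
  have h1 := h.one_le_spin_cast
  have h2 := h.potential_pos
  have h3 := h.len_pos
  have h4 := h.pos
  refine Real.le_sqrt_of_sq_le ?_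
  have h5 : (√(s * V k) * len k * (kF * √kF) / 90) ^ 2 =
      s * V k * len k ^ 2 * kF ^ 3 / 8100 := by
    have h6 := Real.sq_sqrt (show 0 ≤ s * V k by positivity)
    have h7 := Real.sq_sqrt h4.le
    calc _ = √(s * V k) ^ 2 * len k ^ 2 * (kF ^ 2 * √kF ^ 2) / 8100 := by ring
      _ = _ := by rw [h6, h7]; ring
  rw [h5]
  have h8 : 0 < s * V k * len k ^ 2 * kF ^ 3 := by positivity
  have := h.le_gap
  have := h.two_mul_le_energyLower
  linarith

theorem le_plasmonEnergy :
    1 / 45 * (√(s * V k) * len k * (kF * √kF)) ≤ plasmonEnergy kF s V k := by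
  have h1 := h.sqrt_gap_le
  have h2 := h.sqrt_energyLower_le
  linarith

theorem plasmonEnergy_sub_nonneg :
    0 ≤ plasmonEnergy kF s V k - 2 * √(energyLower kF s V k) := by
  linarith [h.sqrt_energyLower_le]

theorem plasmonEnergy_sub_le : plasmonEnergy kF s V k - 2 * √(energyLower kF s V k) ≤
    10 ^ 7 * ((√kF)⁻¹ * len k * (V k * √(V k))⁻¹) := by
  have h1 := h.one_le_spin_cast
  have h2 := h.potential_pos
  have h3 := h.len_pos
  have h4 := h.pos
  set x := plasmonEnergy kF s V k / 2 with hx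
  set y := √(energyLower kF s V k) with hy
  have hV : 0 < √(V k) := Real.sqrt_pos.2 h2
  have hF : 0 < √kF := Real.sqrt_pos.2 h4
  have hy1 : √(V k) * len k * (kF * √kF) / 90 ≤ y := by
    refine le_trans ?_ h.sqrt_gap_le
    have : √(V k) ≤ √(s * V k) := Real.sqrt_le_sqrt (by nlinarith)
    gcongr
  have hy0 : 0 < y := lt_of_lt_of_le (by positivity) hy1
  have hxy : y ≤ x := h.sqrt_energyLower_le
  have hE : y ^ 2 = energyLower kF s V k :=
    Real.sq_sqrt (Real.sqrt_pos.1 hy0).le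
  have h5 : x ^ 2 - y ^ 2 ≤ 40500 * (kF * len k ^ 2 / V k) := by
    rw [hE]
    refine h.sq_sub_le.trans ?_
    have : V k ≤ s * V k := by nlinarith
    gcongr
  -- As y ≤ x, the difference of squares is at least 2y(x − y).
  have h6 : (x - y) * (2 * y) ≤ 40500 * (kF * len k ^ 2 / V k) := by nlinarith
  have h7 : 2 * (x - y) ≤ 40500 * (kF * len k ^ 2 / V k) / y := by
    rw [le_div_iff₀ hy0]; linarith
  calc plasmonEnergy kF s V k - 2 * y = 2 * (x - y) := by rw [hx]; ring
    _ ≤ 40500 * (kF * len k ^ 2 / V k) / (√(V k) * len k * (kF * √kF) / 90) :=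
        h7.trans (div_le_div_of_nonneg_left (by positivity) (by positivity) hy1)
    _ = 3645000 * ((√kF)⁻¹ * len k * (V k * √(V k))⁻¹) := by
        field_simp
        norm_num
    _ ≤ _ := by
        have : 0 ≤ (√kF)⁻¹ * len k * (V k * √(V k))⁻¹ := by positivity
        linarith

/-- 96 = 4 · (3/2) · 16, from the mode bound, the maximum of λ and the lower bound on Σλ. -/
theorem norm_sq_amp_le {φ : LuneSpace kF k} (hφ : IsPlasmonMode kF s V k φ)
    (a : lune kF k × Fin s) : ‖amp s φ a‖ ^ 2 ≤ 96 / (kF ^ 2 * len k) / s := by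
  have h1 := h.one_le_spin_cast
  have h3 := h.len_pos
  have h4 := h.pos
  rw [norm_sq_amp]
  gcongr
  refine (norm_sq_mode_le h.nonempty h.coupling_pos h.potential_pos.le h.lam_bound h.gap hφ
    a.1).trans ?_
  refine (div_le_div_of_nonneg_left (by positivity) (by positivity) (le_sum_lam h.two_le)).trans
    (le_of_eq ?_)
  field_simp
  norm_num

/-- Only finitely many l contribute, so any bound E on finite partial sums suffices; E can be the
full series or an explicit Coulomb estimate. The factor 1/200 gives Mβ ≤ 96/200 < 1/2. -/
theorem norm_Heff_sub_le (hV : ∀ l, l ≠ 0 → 0 ≤ V l) {φ : LuneSpace kF k}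
    (hφ : IsPlasmonMode kF s V k φ) {M : ℕ} (hM : (M : ℝ) ≤ 1 / 200 * kF ^ 2 * len k) :
    ‖plasmonStateNormalized s φ M‖ = 1 ∧
      ∃ hdom : plasmonStateNormalized s φ M ∈ (Heff kF s V).domain,
        ∀ E : ℝ, (∀ L : Finset {l : Momentum // l ≠ 0}, ∑ l ∈ L, errorTerm kF V l ≤ E) →
          ‖Heff kF s V ⟨plasmonStateNormalized s φ M, hdom⟩
              - ((M * plasmonEnergy kF s V k : ℝ) : ℂ) • plasmonStateNormalized s φ M‖
            ≤ 384 * √E * ((M : ℝ) ^ (5 / 2 : ℝ) / (√kF * len k)) := by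
  have h1 := h.one_le_spin_cast
  have h3 := h.len_pos
  have h4 := h.pos
  have hMβ : M * (96 / (kF ^ 2 * len k) / s) ≤ 1 / 2 := by
    calc M * (96 / (kF ^ 2 * len k) / s)
        ≤ (1 / 200 * kF ^ 2 * len k) * (96 / (kF ^ 2 * len k) / 1) := by gcongr
      _ ≤ 1 / 2 := by
          have : (1 / 200 * kF ^ 2 * len k) * (96 / (kF ^ 2 * len k) / 1) = 96 / 200 := by
            field_simp
          rw [this]; norm_num
  obtain ⟨hn, hdom, L, hL⟩ :=
    Plasmon.norm_Heff_sub_le h.one_le_spin h.ne_zero hφ (h.norm_sq_amp_le hφ) hMβ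
  refine ⟨hn, hdom, fun E hE => ?_⟩
  have hE0 : 0 ≤ E := by simpa using hE ∅
  have hM5 : ((M : ℝ) ^ (5 / 2 : ℝ)) ^ 2 = (M : ℝ) ^ 5 := by
    rw [← Real.rpow_natCast, ← Real.rpow_mul (Nat.cast_nonneg M), ← Real.rpow_natCast]
    norm_num
  have hsum : ∑ l ∈ L, hsNormSq kF s V l.1 ≤ s ^ 2 * kF ^ 3 * E := by
    refine (Finset.sum_le_sum fun l _ =>
      hsNormSq_le_errorTerm (by linarith [h.two_le]) l (hV l.1 l.2)).trans ?_
    rw [← Finset.mul_sum]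
    gcongr
    exact hE L
  refine le_of_sq_le_sq (hL.trans ?_) (by positivity)
  -- The spin cancels, k_F³ against (k_F²|k|)² leaves 1/(k_F|k|²), and 16 · 96² = 384².
  calc 16 * (M : ℝ) ^ 5 * (96 / (kF ^ 2 * len k) / s) ^ 2 * ∑ l ∈ L, hsNormSq kF s V l.1
      ≤ 16 * (M : ℝ) ^ 5 * (96 / (kF ^ 2 * len k) / s) ^ 2 * (s ^ 2 * kF ^ 3 * E) := by gcongr
    _ = 384 ^ 2 * E * ((M : ℝ) ^ 5 / (kF * len k ^ 2)) := by
        field_simp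
        ring
    _ = _ := by
        rw [mul_pow, mul_pow, div_pow, mul_pow, Real.sq_sqrt hE0, Real.sq_sqrt h4.le, hM5]

end PlasmonRegime

end Quantitative

/-! ### Asymptotics -/

theorem eventually_mul_rpow_le {a b : ℝ} (hab : a < b) (A : ℝ) :
    ∀ᶠ x : ℝ in atTop, A * x ^ a ≤ x ^ b := by
  filter_upwards [(tendsto_rpow_atTop (sub_pos.2 hab)).eventually_ge_atTop A,
    eventually_gt_atTop 0] with x hx hx0
  calc A * x ^ a ≤ x ^ (b - a) * x ^ a := by gcongr
    _ = x ^ b := by rw [← Real.rpow_add hx0, sub_add_cancel]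

/-- The sole use of δ < 1/2: |k|² is of smaller order than k_F. -/
theorem eventually_mul_sq_le {δ : ℝ} (hδ : δ < 1 / 2) (A : ℝ) :
    ∀ᶠ x : ℝ in atTop, ∀ y : ℝ, 0 ≤ y → y ≤ x ^ δ → A * y ^ 2 ≤ x := by
  filter_upwards [eventually_mul_rpow_le (show δ + δ < 1 by linarith) (max A 0),
    eventually_gt_atTop 0] with x hx hx0 y hy hyx
  calc A * y ^ 2 ≤ max A 0 * y ^ 2 := by gcongr; exact le_max_left _ _
    _ ≤ max A 0 * (x ^ δ) ^ 2 := by gcongr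
    _ = max A 0 * x ^ (δ + δ) := by rw [Real.rpow_add hx0, sq]
    _ ≤ x := by simpa using hx

theorem rpow_three_halves {x : ℝ} (hx : 0 < x) : x ^ (3 / 2 : ℝ) = x * √x := by
  rw [show (3 / 2 : ℝ) = 1 + 1 / 2 by norm_num, Real.rpow_add hx, Real.rpow_one,
    Real.sqrt_eq_rpow]

theorem rpow_neg_half {x : ℝ} (hx : 0 < x) : x ^ (-(1 / 2) : ℝ) = (√x)⁻¹ := by
  rw [Real.rpow_neg hx.le, Real.sqrt_eq_rpow]

theorem rpow_neg_three_halves {x : ℝ} (hx : 0 < x) : x ^ (-(3 / 2) : ℝ) = (x * √x)⁻¹ := by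
  rw [Real.rpow_neg hx.le, rpow_three_halves hx]

section Coulomb

variable {kF : ℝ} {s : ℕ} {k : Momentum} {g : ℝ}

theorem plasmonRegime_coulomb (hK : 2 ≤ kF) (hs : 1 ≤ s) (hk : k ≠ 0) (hg : 0 < g)
    (h : 18001 / g * len k ^ 2 ≤ kF) (hle : len k ≤ kF) :
    PlasmonRegime kF s (coulomb g) k := by
  refine ⟨hK, hs, hk, hle, ?_⟩
  have h1 : 0 < sqLen k := by linarith [one_le_sqLen hk]
  rw [len_sq, div_mul_eq_mul_div, div_le_iff₀ hg] at h
  rw [coulomb, mul_div_assoc', lt_div_iff₀ h1]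
  linarith

theorem energyLower_coulomb (kF : ℝ) (s : ℕ) (g : ℝ) (k : Momentum) :
    energyLower kF s (coulomb g) k = s / (2 * Real.pi) ^ 3 * (g / len k ^ 2)
      * ∑ p ∈ lune kF k, lam k p
      + (∑ p ∈ lune kF k, lam k p ^ 3) / ∑ p ∈ lune kF k, lam k p := by
  rw [energyLower, coupling, coulomb, len_sq]
  congr 1
  have := Real.pi_pos
  field_simp

/-- An exact identity: the first moment gives the plasma term 2gn, and the ratio Σλ³/Σλ gives the
dispersive term plus |k|⁴. -/
theorem energyLower_coulomb_eq (hK : 2 ≤ kF) (hk : k ≠ 0) :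
    4 * energyLower kF s (coulomb g) k = 2 * g * density kF s +
      (4 * (kF ^ 2 * len k ^ 2) * (secondMoment kF / ((fermiBall kF).card * kF ^ 2)) +
        len k ^ 4) := by
  have h1 : 0 < sqLen k := by linarith [one_le_sqLen hk]
  have h2 : (0 : ℝ) < (fermiBall kF).card :=
    lt_of_lt_of_le (by positivity) (le_card_fermiBall hK)
  have h3 := Real.pi_pos
  rw [energyLower_coulomb, sum_lam_cube, sum_lam, density, particleNumber,
    show len k ^ 4 = (len k ^ 2) ^ 2 by ring, len_sq]
  push_cast
  field_simp
  ring

theorem abs_plasmonEnergy_sq_sub_le (h : PlasmonRegime kF s (coulomb g) k) (hg : 0 < g) :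
    |plasmonEnergy kF s (coulomb g) k ^ 2 - 4 * energyLower kF s (coulomb g) k| ≤
      162000 / g * len k ^ 2 * (kF * len k ^ 2) := by
  have h1 := h.one_le_spin_cast
  have h3 := h.len_pos
  have h4 := h.pos
  have h5 := energyLower_le h.nonempty h.coupling_pos h.potential_pos.le
  have h6 := h.sq_sub_le
  rw [abs_of_nonneg (by linarith)]
  have h7 : kF * len k ^ 2 / (s * coulomb g k) ≤ kF * len k ^ 2 / (1 * coulomb g k) := by
    have := h.potential_pos
    gcongr
  have h8 : kF * len k ^ 2 / (1 * coulomb g k) = len k ^ 2 * (kF * len k ^ 2) / g := by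
    rw [coulomb, ← len_sq]
    field_simp
  calc _ = 4 * ((plasmonEnergy kF s (coulomb g) k / 2) ^ 2 -
        energyLower kF s (coulomb g) k) := by ring
    _ ≤ 4 * (40500 * (len k ^ 2 * (kF * len k ^ 2) / g)) := by rw [← h8]; linarith
    _ = _ := by ring

end Coulomb

end

end Plasmon
-- Assembly of the three statements
theorem mainTheorem4 :
    -- general repulsive potentials
    (∃ c > (0 : ℝ), ∃ C > (0 : ℝ), ∃ c' > (0 : ℝ), ∃ C' > (0 : ℝ),
      ∀ᶠ kF : ℝ in Filter.atTop, ∀ s : ℕ, 1 ≤ s →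
      ∀ V : Plasmon.Momentum → ℝ, (∀ l, l ≠ 0 → V (-l) = V l) → (∀ l, l ≠ 0 → 0 ≤ V l) →
      ∀ k ∈ Plasmon.fermiBall kF, k ≠ 0 → c * kF⁻¹ < V k →
        IsGreatest (Plasmon.plasmonSpectrum kF s V k) (Plasmon.plasmonEnergy kF s V k) ∧
        c' * (s : ℝ) ^ (1 / 2 : ℝ) * kF ^ (3 / 2 : ℝ) * Plasmon.len k * V k ^ (1 / 2 : ℝ)
          ≤ Plasmon.plasmonEnergy kF s V k ∧
        0 ≤ Plasmon.plasmonEnergy kF s V k - 2 * √(2 * Plasmon.moment kF s V k 1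
              + Plasmon.moment kF s V k 3 / Plasmon.moment kF s V k 1) ∧
        Plasmon.plasmonEnergy kF s V k - 2 * √(2 * Plasmon.moment kF s V k 1
              + Plasmon.moment kF s V k 3 / Plasmon.moment kF s V k 1)
          ≤ C' * kF ^ (-(1 / 2) : ℝ) * Plasmon.len k * V k ^ (-(3 / 2) : ℝ) ∧
        ∀ φ : Plasmon.LuneSpace kF k, Plasmon.IsPlasmonMode kF s V k φ →
        ∀ M : ℕ, (M : ℝ) ≤ C * kF ^ 2 * Plasmon.len k →
          ‖Plasmon.plasmonStateNormalized s φ M‖ = 1 ∧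
          ∃ hdom : Plasmon.plasmonStateNormalized s φ M ∈ (Plasmon.Heff kF s V).domain,
            Summable (Plasmon.errorTerm kF V) →
            ‖Plasmon.Heff kF s V ⟨Plasmon.plasmonStateNormalized s φ M, hdom⟩
                - ((M * Plasmon.plasmonEnergy kF s V k : ℝ) : ℂ)
                    • Plasmon.plasmonStateNormalized s φ M‖
              ≤ C' * √(∑' l, Plasmon.errorTerm kF V l)
                  * ((M : ℝ) ^ (5 / 2 : ℝ) / (√kF * Plasmon.len k))) ∧
    -- the Coulomb potential
    (∀ g : ℝ, 0 < g → ∃ c > (0 : ℝ), ∃ C > (0 : ℝ),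
      ∀ δ ∈ Set.Ioo (0 : ℝ) (1 / 2), ∀ ε ∈ Set.Ioo (0 : ℝ) 2,
      ∀ᶠ kF : ℝ in Filter.atTop, ∀ s : ℕ, 1 ≤ s →
      ∀ k : Plasmon.Momentum, k ≠ 0 → Plasmon.len k ≤ kF ^ δ →
        IsGreatest (Plasmon.plasmonSpectrum kF s (Plasmon.coulomb g) k)
          (Plasmon.plasmonEnergy kF s (Plasmon.coulomb g) k) ∧
        c * kF ^ (3 / 2 : ℝ) ≤ Plasmon.plasmonEnergy kF s (Plasmon.coulomb g) k ∧
        0 ≤ Plasmon.plasmonEnergy kF s (Plasmon.coulomb g) k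
          - 2 * √(s / (2 * Real.pi) ^ 3 * (g / Plasmon.len k ^ 2)
                * ∑ p ∈ Plasmon.lune kF k, Plasmon.lam k p
              + (∑ p ∈ Plasmon.lune kF k, Plasmon.lam k p ^ 3)
                / ∑ p ∈ Plasmon.lune kF k, Plasmon.lam k p) ∧
        Plasmon.plasmonEnergy kF s (Plasmon.coulomb g) k
          - 2 * √(s / (2 * Real.pi) ^ 3 * (g / Plasmon.len k ^ 2)
                * ∑ p ∈ Plasmon.lune kF k, Plasmon.lam k p
              + (∑ p ∈ Plasmon.lune kF k, Plasmon.lam k p ^ 3)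
                / ∑ p ∈ Plasmon.lune kF k, Plasmon.lam k p)
          ≤ C * kF ^ (-(1 / 2) : ℝ) * Plasmon.len k ^ 4 ∧
        ∀ φ : Plasmon.LuneSpace kF k, Plasmon.IsPlasmonMode kF s (Plasmon.coulomb g) k φ →
        ∀ M : ℕ, (M : ℝ) ≤ kF ^ ε →
          ‖Plasmon.plasmonStateNormalized s φ M‖ = 1 ∧
          ∃ hdom : Plasmon.plasmonStateNormalized s φ M
              ∈ (Plasmon.Heff kF s (Plasmon.coulomb g)).domain,
            ‖Plasmon.Heff kF s (Plasmon.coulomb g)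
                  ⟨Plasmon.plasmonStateNormalized s φ M, hdom⟩
                - ((M * Plasmon.plasmonEnergy kF s (Plasmon.coulomb g) k : ℝ) : ℂ)
                    • Plasmon.plasmonStateNormalized s φ M‖
              ≤ C * (Plasmon.len k)⁻¹ * √kF * (M : ℝ) ^ (5 / 2 : ℝ)) ∧
    -- the plasmon dispersion relation for the Coulomb potential
    (∀ g : ℝ, 0 < g → ∀ δ ∈ Set.Ioo (0 : ℝ) (1 / 2), ∀ η > (0 : ℝ),
      ∀ᶠ kF : ℝ in Filter.atTop, ∀ s : ℕ, 1 ≤ s →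
      ∀ k : Plasmon.Momentum, k ≠ 0 → Plasmon.len k ≤ kF ^ δ →
        |Plasmon.plasmonEnergy kF s (Plasmon.coulomb g) k ^ 2
            - (2 * g * Plasmon.density kF s + 12 / 5 * kF ^ 2 * Plasmon.len k ^ 2)|
          ≤ η * (kF ^ 2 * Plasmon.len k ^ 2)) := by
  refine ⟨⟨18000, by norm_num, 1 / 200, by norm_num, 1 / 45, by norm_num, 10 ^ 7, by norm_num,
    ?_⟩, fun g hg => ⟨√g / 45, by positivity, 10 ^ 7 * (g * √g)⁻¹ + 3456 * g, by positivity, ?_⟩,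
    ?_⟩
  · filter_upwards [eventually_ge_atTop 2] with kF hK s hs V _ hV k hkB hk hVk
    have hK0 : 0 < kF := by linarith
    have h : Plasmon.PlasmonRegime kF s V k := by
      refine ⟨hK, hs, hk, Plasmon.mem_fermiBall.1 hkB, ?_⟩
      rw [mul_comm]
      exact (div_lt_iff₀ hK0).1 (by rwa [div_eq_mul_inv])
    have hlow : 2 * Plasmon.moment kF s V k 1 +
        Plasmon.moment kF s V k 3 / Plasmon.moment kF s V k 1 = Plasmon.energyLower kF s V k := by
      rw [Plasmon.moment_eq h.potential_pos.le, Plasmon.moment_eq h.potential_pos.le,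
        Plasmon.energyLower, mul_div_mul_left _ _ h.coupling_pos.ne']
      simp only [pow_one]
    rw [hlow, Plasmon.rpow_three_halves hK0, Plasmon.rpow_neg_half hK0,
      Plasmon.rpow_neg_three_halves h.potential_pos, ← Real.sqrt_eq_rpow, ← Real.sqrt_eq_rpow]
    refine ⟨Plasmon.isGreatest_plasmonEnergy s V h.nonempty, ?_, h.plasmonEnergy_sub_nonneg, ?_,
      fun φ hφ M hM => ?_⟩
    · refine le_of_eq_of_le ?_ h.le_plasmonEnergy
      rw [Real.sqrt_mul (Nat.cast_nonneg s)]
      ring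
    · refine h.plasmonEnergy_sub_le.trans_eq ?_
      ring
    · obtain ⟨hn, hdom, hE⟩ := h.norm_Heff_sub_le hV hφ hM
      refine ⟨hn, hdom, fun hsum => (hE _ fun L => hsum.sum_le_tsum L fun l _ =>
        Plasmon.errorTerm_nonneg hK0.le l (hV l.1 l.2)).trans ?_⟩
      have := h.len_pos
      gcongr
      norm_num
  · rintro δ ⟨hδ0, hδ⟩ ε ⟨hε0, hε⟩
    filter_upwards [eventually_ge_atTop 2, Plasmon.eventually_mul_sq_le hδ (18001 / g),
      Plasmon.eventually_mul_sq_le hδ 1, Plasmon.eventually_mul_rpow_le hε 200]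
      with kF hK h1 h2 h3 s hs k hk hkδ
    have hK0 : 0 < kF := by linarith
    have hlen := Plasmon.one_le_len hk
    have hlen2 := h2 _ (by linarith) hkδ
    have h : Plasmon.PlasmonRegime kF s (Plasmon.coulomb g) k :=
      Plasmon.plasmonRegime_coulomb hK hs hk hg (h1 _ (by linarith) hkδ) (by nlinarith)
    have hlen0 := h.len_pos
    have hcoul : Plasmon.coulomb g k = g / Plasmon.len k ^ 2 := by
      rw [Plasmon.coulomb, Plasmon.len_sq]
    have hsqrt : √(Plasmon.coulomb g k) = √g / Plasmon.len k := by
      rw [hcoul, Real.sqrt_div hg.le, Real.sqrt_sq hlen0.le]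
    rw [← Plasmon.energyLower_coulomb, Plasmon.rpow_three_halves hK0, Plasmon.rpow_neg_half hK0]
    refine ⟨Plasmon.isGreatest_plasmonEnergy s _ h.nonempty, ?_, h.plasmonEnergy_sub_nonneg, ?_,
      fun φ hφ M hM => ?_⟩
    · refine le_trans ?_ h.le_plasmonEnergy
      rw [Real.sqrt_mul (Nat.cast_nonneg s), hsqrt]
      have hs1 : 1 ≤ √(s : ℝ) := Real.one_le_sqrt.2 h.one_le_spin_cast
      calc √g / 45 * (kF * √kF) ≤ √(s : ℝ) * (√g / 45 * (kF * √kF)) :=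
            le_mul_of_one_le_left (by positivity) hs1
        _ = _ := by field_simp
    · refine h.plasmonEnergy_sub_le.trans ?_
      rw [hsqrt, hcoul]
      calc 10 ^ 7 * ((√kF)⁻¹ * Plasmon.len k *
            (g / Plasmon.len k ^ 2 * (√g / Plasmon.len k))⁻¹)
          = 10 ^ 7 * (g * √g)⁻¹ * (√kF)⁻¹ * Plasmon.len k ^ 4 := by field_simp
        _ ≤ _ := by
          gcongr
          linarith
    -- Here ε < 2 enters: 200 k_F^ε ≤ k_F² eventually.
    · have hM' : (M : ℝ) ≤ 1 / 200 * kF ^ 2 * Plasmon.len k := by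
        have h4 : kF ^ (2 : ℝ) = kF ^ 2 := Real.rpow_natCast kF 2
        rw [h4] at h3
        have h5 : 1 / 200 * kF ^ 2 ≤ 1 / 200 * kF ^ 2 * Plasmon.len k :=
          le_mul_of_one_le_right (by positivity) hlen
        linarith
      obtain ⟨hn, hdom, hE⟩ := h.norm_Heff_sub_le (fun l _ => Plasmon.coulomb_nonneg hg l) hφ hM'
      -- 78 ≤ 9² makes the bound on the error sum a perfect square; 384 · 9 = 3456.
      refine ⟨hn, hdom, (hE ((9 * g * kF) ^ 2) fun L =>
        (Plasmon.sum_errorTerm_coulomb_le (by linarith) hg L).trans ?_).trans ?_⟩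
      · have : 0 ≤ g ^ 2 * kF ^ 2 := by positivity
        nlinarith
      · rw [Real.sqrt_sq (by positivity)]
        have h6 : kF = √kF * √kF := (Real.mul_self_sqrt hK0.le).symm
        have h7 : 0 < √kF := Real.sqrt_pos.2 hK0
        calc 384 * (9 * g * kF) * ((M : ℝ) ^ (5 / 2 : ℝ) / (√kF * Plasmon.len k))
            = 3456 * g * (Plasmon.len k)⁻¹ * √kF * (M : ℝ) ^ (5 / 2 : ℝ) := by
              nth_rewrite 1 [h6]
              field_simp
              ring
          _ ≤ _ := by
              gcongr
              have : 0 ≤ 10 ^ 7 * (g * √g)⁻¹ := by positivity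
              linarith
  · rintro g hg δ ⟨hδ0, hδ⟩ η hη
    -- Three errors receive η/3 each: the deviation of ε_k² from its approximation, the term |k|⁴,
    -- and the second moment, whose prefactor 4 requires η/12.
    have hlim := Metric.tendsto_nhds.1 Plasmon.tendsto_secondMoment_div_card (η / 12)
      (by positivity)
    filter_upwards [eventually_ge_atTop 2, Plasmon.eventually_mul_sq_le hδ (18001 / g),
      Plasmon.eventually_mul_sq_le hδ 1, Plasmon.eventually_mul_sq_le hδ (3 / η),
      Plasmon.eventually_mul_sq_le hδ (3 / η * (162000 / g)), hlim]
      with kF hK h1 h2 h3 h4 h5 s hs k hk hkδ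
    have hK0 : 0 < kF := by linarith
    have hlen := Plasmon.one_le_len hk
    have hlen2 := h2 _ (by linarith) hkδ
    have h : Plasmon.PlasmonRegime kF s (Plasmon.coulomb g) k :=
      Plasmon.plasmonRegime_coulomb hK hs hk hg (h1 _ (by linarith) hkδ) (by nlinarith)
    have h6 := Plasmon.abs_plasmonEnergy_sq_sub_le h hg
    rw [Plasmon.energyLower_coulomb_eq hK hk] at h6
    have h7 := h3 _ (by linarith) hkδ
    have h8 := h4 _ (by linarith) hkδ
    rw [Real.dist_eq] at h5
    set n := Plasmon.len k with hn
    set r := Plasmon.secondMoment kF / ((Plasmon.fermiBall kF).card * kF ^ 2)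
    have h9 : 162000 / g * n ^ 2 * (kF * n ^ 2) ≤ η / 3 * (kF ^ 2 * n ^ 2) := by
      have h10 : 162000 / g * n ^ 2 ≤ η / 3 * kF := by
        calc 162000 / g * n ^ 2 = η / 3 * (3 / η * (162000 / g) * n ^ 2) := by field_simp
          _ ≤ _ := by gcongr
      calc 162000 / g * n ^ 2 * (kF * n ^ 2) ≤ η / 3 * kF * (kF * n ^ 2) := by gcongr
        _ = _ := by ring
    have h11 : n ^ 4 ≤ η / 3 * (kF ^ 2 * n ^ 2) := by
      have h10 : n ^ 2 ≤ η / 3 * kF := by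
        calc n ^ 2 = η / 3 * (3 / η * n ^ 2) := by field_simp
          _ ≤ _ := by gcongr
      calc n ^ 4 = n ^ 2 * n ^ 2 := by ring
        _ ≤ η / 3 * kF * n ^ 2 := by gcongr
        _ ≤ η / 3 * (kF * kF) * n ^ 2 := by
            gcongr
            nlinarith
        _ = _ := by ring
    have h12 : |4 * (kF ^ 2 * n ^ 2) * (r - 3 / 5)| ≤ η / 3 * (kF ^ 2 * n ^ 2) := by
      rw [abs_mul, abs_of_nonneg (by positivity : (0 : ℝ) ≤ 4 * (kF ^ 2 * n ^ 2))]
      calc 4 * (kF ^ 2 * n ^ 2) * |r - 3 / 5| ≤ 4 * (kF ^ 2 * n ^ 2) * (η / 12) := by gcongr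
        _ = _ := by ring
    have h13 : (0 : ℝ) ≤ n ^ 4 := by positivity
    rw [abs_le] at h6 h12 ⊢
    constructor <;> linarith [h6.1, h6.2, h12.1, h12.2]
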